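/- Let $d,N\in\mathbb N$, $\Lambda>0$, $T>0$, let $\mathbb T^d=\mathbb R^d/(\Lambda\mathbb Z)^d\cong[0,\Lambda)^d$ (functions on $\mathbb T^d$ are identified with $\Lambda$-periodic functions on $\mathbb R^d$), and let $$G_h(z)=(4\pi h)^{-d/2}\exp\Big(-\frac{|z|^2}{4h}\Big),\qquad z\in\mathbb R^d,\ h>0.$$ Let $u^0\in H^1(\mathbb T^d;\mathbb R^N)$ with $|u^0|=1$ a.e. For a time-step size $h>0$ define $u^n:\mathbb T^d\to\mathbb S^{N-1}$ (a.e.), $n\ge1$, iteratively by $$v^n:=G_h*u^{n-1},\qquad u^n:=\frac{v^n}{|v^n|},$$ where $*$ is convolution on $\mathbb R^d$. Let $u^h(\cdot,t):=u^n$ for $t\in[nh,(n+1)h)$, $n\ge 0$, and $u^h(\cdot,t):=u^0$ for $t<0$, and for a function $v$ of time write $\partial_t^hv(t):=\frac{v(t)-v(t-h)}{h}$. Then the functions $u^h$ are precompact as $h\downarrow0$ in the following sense: for every sequence of step sizes $h_k>0$ with $h_k\to0$ there are a subsequence (not relabelled) and a map $u\in H^1(\mathbb T^d\times(0,T);\mathbb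 R^N)$ with $|u|\le1$ a.e. such that, along this subsequence, $$u^h\to u\ \text{ strongly in }L^2(\mathbb T^d\times(0,T)),$$ $$\nabla G_h*u^h\rightharpoonup\nabla u\ \text{ and }\ \partial_t^h(G_h*u^h)\rightharpoonup\partial_tu\ \text{ weakly in }L^2(\mathbb T^d\times(0,T)).$$ Furthermore, $u$ is a weak solution of the harmonic map heat flow into the sphere $\mathbb S^{N-1}$, $$\partial_tu-\Delta u=|\nabla u|^2u,$$ that is, $|u|=1$ a.e. in $\mathbb T^d\times(0,T)$ and, for all smooth $\varphi:\mathbb T^d\times[0,T]\to\mathbb R^N$, $$\int_0^T\!\!\int_{\mathbb T^d}\big(\partial_tu\cdot\varphi+\nabla u:\nabla\varphi\big)\,dx\,dt=\int_0^T\!\!\int_{\mathbb T^d}|\nabla u|^2\,u\cdot\varphi\,dx\,dt.$$ -/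

import Mathlib

open MeasureTheory Filter Topology
open scoped ContDiff Convolution

namespace HMHF

/-- The space `ℝ^d` with the Euclidean norm. -/
abbrev Vec (d : ℕ) : Type := EuclideanSpace ℝ (Fin d)

/-- The half-open cell `[0, Λ)^d`, a fundamental domain of the torus `ℝ^d / (Λ ℤ)^d`. -/
def cell (d : ℕ) (Λ : ℝ) : Set (Vec d) := {x | ∀ i, 0 ≤ x i ∧ x i < Λ}

/-- Functions on the torus `T^d` are `Λ`-periodic functions on `ℝ^d`. -/
def IsPeriodic {d : ℕ} {α : Type} (Λ : ℝ) (f : Vec d → α) : Prop :=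
  ∀ x i, f (x + EuclideanSpace.single i Λ) = f x

/-- Lebesgue measure on the torus, realised on the cell `[0, Λ)^d`. -/
noncomputable def torusMeasure (d : ℕ) (Λ : ℝ) : Measure (Vec d) :=
  volume.restrict (cell d Λ)

/-- Lebesgue measure on the cylinder `[0, Λ)^d × (0, T)`. -/
noncomputable def cylinderMeasure (d : ℕ) (Λ T : ℝ) : Measure (Vec d × ℝ) :=
  volume.restrict (cell d Λ ×ˢ Set.Ioo 0 T)

/-! ### Sobolev functions on the torus and on the space-time cylinder -/

/-- `w` is the weak partial derivative `∂ᵢ u` on the torus. -/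
def HasWeakPartial {d N : ℕ} (Λ : ℝ) (i : Fin d) (u w : Vec d → Vec N) : Prop :=
  ∀ φ : Vec d → ℝ, ContDiff ℝ ∞ φ → IsPeriodic Λ φ →
    ∫ x, fderiv ℝ φ x (EuclideanSpace.single i 1) • u x ∂torusMeasure d Λ =
      -∫ x, φ x • w x ∂torusMeasure d Λ

/-- `u ∈ H¹(T^d; ℝ^N)`. -/
def IsTorusH1 {d N : ℕ} (Λ : ℝ) (u : Vec d → Vec N) : Prop :=
  IsPeriodic Λ u ∧ MemLp u 2 (torusMeasure d Λ) ∧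
    ∃ Du : Fin d → Vec d → Vec N, ∀ i,
      MemLp (Du i) 2 (torusMeasure d Λ) ∧ HasWeakPartial Λ i u (Du i)

/-- The unit vector in the `i`-th spatial direction of space-time. -/
noncomputable def spaceDir {d : ℕ} (i : Fin d) : Vec d × ℝ := (EuclideanSpace.single i 1, 0)

/-- The unit vector in the time direction of space-time. -/
def timeDir (d : ℕ) : Vec d × ℝ := (0, 1)

/-- `w` is the weak derivative of `u` in the space-time direction `e` on `T^d × (0, T)`:
test functions are smooth, periodic in space, and compactly supported in `(0, T)` in time. -/
def HasWeakDerivAlong {d N : ℕ} (Λ T : ℝ) (e : Vec d × ℝ) (u w : Vec d × ℝ → Vec N) : Prop :=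
  ∀ φ : Vec d × ℝ → ℝ, ContDiff ℝ ∞ φ → (∀ t, IsPeriodic Λ fun x => φ (x, t)) →
    (∃ a b, 0 < a ∧ b < T ∧ ∀ x t, φ (x, t) ≠ 0 → t ∈ Set.Icc a b) →
    ∫ p, fderiv ℝ φ p e • u p ∂cylinderMeasure d Λ T =
      -∫ p, φ p • w p ∂cylinderMeasure d Λ T

/-- `u ∈ H¹(T^d × (0, T); ℝ^N)`, with weak spatial derivatives `Du i = ∂ᵢ u` and weak time
derivative `ut = ∂ₜ u`. -/
structure IsCylinderH1 {d N : ℕ} (Λ T : ℝ) (u : Vec d × ℝ → Vec N)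
    (Du : Fin d → Vec d × ℝ → Vec N) (ut : Vec d × ℝ → Vec N) : Prop where
  periodic : ∀ t, IsPeriodic Λ fun x => u (x, t)
  memLp : MemLp u 2 (cylinderMeasure d Λ T)
  memLp_space : ∀ i, MemLp (Du i) 2 (cylinderMeasure d Λ T)
  memLp_time : MemLp ut 2 (cylinderMeasure d Λ T)
  weakDeriv_space : ∀ i, HasWeakDerivAlong Λ T (spaceDir i) u (Du i)
  weakDeriv_time : HasWeakDerivAlong Λ T (timeDir d) u ut

/-! ### Strong and weak convergence in `L²` -/

/-- Strong convergence `f k → g` in `L²(μ)`. -/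
def TendstoStronglyL2 {X : Type} [MeasurableSpace X] {N : ℕ} (μ : Measure X)
    (f : ℕ → X → Vec N) (g : X → Vec N) : Prop :=
  (∀ k, MemLp (f k) 2 μ) ∧ MemLp g 2 μ ∧
    Tendsto (fun k => eLpNorm (f k - g) 2 μ) atTop (𝓝 0)

/-- Weak convergence `f k ⇀ g` in `L²(μ)`. -/
def TendstoWeaklyL2 {X : Type} [MeasurableSpace X] {N : ℕ} (μ : Measure X)
    (f : ℕ → X → Vec N) (g : X → Vec N) : Prop :=
  (∀ k, MemLp (f k) 2 μ) ∧ MemLp g 2 μ ∧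
    ∀ ψ : X → Vec N, MemLp ψ 2 μ →
      Tendsto (fun k => ∫ x, inner ℝ (f k x) (ψ x) ∂μ) atTop (𝓝 (∫ x, inner ℝ (g x) (ψ x) ∂μ))

/-! ### The thresholding scheme -/

/-- The heat kernel `G_h(z) = (4 π h)^(-d/2) exp(-|z|² / (4 h))` on `ℝ^d`. -/
noncomputable def heatKernel (d : ℕ) (h : ℝ) (z : Vec d) : ℝ :=
  (4 * Real.pi * h) ^ (-(d : ℝ) / 2) * Real.exp (-‖z‖ ^ 2 / (4 * h))

/-- The convolution `G_h ∗ u`. -/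
noncomputable def heatConv {d N : ℕ} (h : ℝ) (u : Vec d → Vec N) : Vec d → Vec N :=
  heatKernel d h ⋆[ContinuousLinearMap.lsmul ℝ ℝ, volume] u

/-- The convolution `(∂ᵢ G_h) ∗ u`, i.e. the `i`-th component of `∇G_h ∗ u`. -/
noncomputable def gradHeatConv {d N : ℕ} (h : ℝ) (i : Fin d) (u : Vec d → Vec N) :
    Vec d → Vec N :=
  (fun z => fderiv ℝ (heatKernel d h) z (EuclideanSpace.single i 1))
    ⋆[ContinuousLinearMap.lsmul ℝ ℝ, volume] u

/-- The iterates `u^n` of the scheme: `u^0 = u0`, then diffusion `v = G_h ∗ u^(n-1)` followed by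
projection `u^n = v / |v|` (with value `0` on the null set where `v = 0`). -/
noncomputable def iterate {d N : ℕ} (h : ℝ) (u0 : Vec d → Vec N) : ℕ → Vec d → Vec N
  | 0 => u0
  | n + 1 => fun x => ‖heatConv h (iterate h u0 n) x‖⁻¹ • heatConv h (iterate h u0 n) x

/-- The piecewise constant interpolation at time `t`: it equals `u^n` for `t ∈ [n h, (n+1) h)`,
and it is extended by `u0` to negative times. -/
noncomputable def interp {d N : ℕ} (h : ℝ) (u0 : Vec d → Vec N) (t : ℝ) : Vec d → Vec N :=
  iterate h u0 ⌊t / h⌋₊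

/-- `u^h` as a function on space-time. -/
noncomputable def approx {d N : ℕ} (h : ℝ) (u0 : Vec d → Vec N) (p : Vec d × ℝ) : Vec N :=
  interp h u0 p.2 p.1

/-- `∂ᵢ G_h ∗ u^h` as a function on space-time. -/
noncomputable def approxGrad {d N : ℕ} (h : ℝ) (u0 : Vec d → Vec N) (i : Fin d)
    (p : Vec d × ℝ) : Vec N :=
  gradHeatConv h i (interp h u0 p.2) p.1

/-- The backward difference quotient
`∂ₜ^h (G_h ∗ u^h)(t) = ((G_h ∗ u^h)(t) - (G_h ∗ u^h)(t - h)) / h` on space-time. -/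
noncomputable def approxTimeDeriv {d N : ℕ} (h : ℝ) (u0 : Vec d → Vec N)
    (p : Vec d × ℝ) : Vec N :=
  h⁻¹ • (heatConv h (interp h u0 p.2) p.1 - heatConv h (interp h u0 (p.2 - h)) p.1)

/-! ### The harmonic map heat flow -/

/-- `u : T^d × (0, T) → S^(N-1)` of class `H¹`, with weak derivatives `Du`, `ut`, solves
`∂ₜ u - Δu = |∇u|² u` weakly:
`∬ ∂ₜu · φ + ∇u : ∇φ = ∬ |∇u|² u · φ` for all smooth `φ : T^d × [0, T] → ℝ^N`. -/
structure IsWeakSolution {d N : ℕ} (Λ T : ℝ) (u : Vec d × ℝ → Vec N)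
    (Du : Fin d → Vec d × ℝ → Vec N) (ut : Vec d × ℝ → Vec N) : Prop where
  isH1 : IsCylinderH1 Λ T u Du ut
  norm_eq_one : ∀ᵐ p ∂cylinderMeasure d Λ T, ‖u p‖ = 1
  equation : ∀ φ : Vec d × ℝ → Vec N, ContDiff ℝ ∞ φ →
    (∀ t, IsPeriodic Λ fun x => φ (x, t)) →
    ∫ p, (inner ℝ (ut p) (φ p) + ∑ i, inner ℝ (Du i p) (fderiv ℝ φ p (spaceDir i)))
        ∂cylinderMeasure d Λ T =
      ∫ p, (∑ i, ‖Du i p‖ ^ 2) * inner ℝ (u p) (φ p) ∂cylinderMeasure d Λ T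

end HMHF

namespace HMHF

/-! ### The cell as a fundamental domain -/

/-! Write `G` for convolution with the heat kernel: a self-adjoint Fourier multiplier with symbol
exp(-h|ξ|²) in (0, 1]. The scheme descends the thresholding energy |cell| - ⟨u, G u⟩ (`energy`).
Normalising G u maximises ⟨·, G u⟩ pointwise among maps into the unit ball, and ⟨δ, G δ⟩ ≥ ‖G δ‖²,
so a step from u to u' lowers the energy by at least ‖G (u' - u)‖² (`energy_thresholdStep`). Since
|u0| = 1, the initial energy is at most h times the Dirichlet integral of u0, because 1 - exp(-y) ≤
y (`energy_initial_le`). Hence, with one constant E, every iterate has energy at most h E and the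
dissipations sum to at most h E. Mode by mode this bounds ∇G u^h in L² at every time, gives ‖u^h - G
u^h‖² ≤ h E on components, and bounds ∂ₜ^h G u^h in L² of space-time (`sum_integral_gradS_sq_le`,
`integral_sub_heatS_sq_le`, `integral_dComp_sq_le`).

Compactness (`exists_strong_limit`): each Fourier coefficient of G u^h is Hölder-1/2 in time up to
an error that vanishes with h, so an Arzelà–Ascoli argument over the countably many modes makes all
of them converge along one subsequence. The gradient bound controls the high modes as in Rellich's
theorem, which gives strong convergence. Gradients and difference quotients have weak limits by
Banach–Alaoglu. The energy also bounds |cell| - ∫ |u^n|², so the limit has unit length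
(`sum_sq_eq_one`).

The nonlinear equation is reached through its antisymmetric form, in which every term is a strongly
convergent factor times a weakly convergent one. Because u^n is parallel to G u^(n-1), the wedge of
u^n with ∂ₜ^h G u equals h⁻¹ u^n ∧ G u^n. Symmetrising in the convolution variable and expanding the
test function shows that this is the weak divergence of u^n ∧ ∇G u^n up to O(√h)
(`abs_commutator_le`). In the limit ∫ φ u ∧ ∂ₜu + ∇φ · (u ∧ ∇u) = 0 (`wedge_equation`). Testing the
(a, b) entry with ψ u_b, summing over b and using |u| = 1, u · ∂ᵢu = 0 and u · ∂ₜu = 0 gives the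
harmonic map heat flow (`flow_equation`). As u is not smooth, it is replaced in test functions by
its Fourier series in space, truncated to finitely many modes; these truncations are admissible
(`TameFam`) and converge in L² together with their gradients. -/

/-- The basis `Λ e₁, …, Λ e_d` of the period lattice. -/
noncomputable def cellBasis (d : ℕ) {Λ : ℝ} (hΛ : 0 < Λ) : Module.Basis (Fin d) ℝ (Vec d) :=
  (EuclideanSpace.basisFun (Fin d) ℝ).toBasis.isUnitSMul (w := fun _ => Λ)
    fun _ => (isUnit_iff_ne_zero.2 hΛ.ne')

lemma cellBasis_apply {d : ℕ} {Λ : ℝ} (hΛ : 0 < Λ) (i : Fin d) :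
    cellBasis d hΛ i = EuclideanSpace.single i Λ := by
  rw [cellBasis, Module.Basis.isUnitSMul_apply]
  ext j
  simp

lemma cellBasis_repr {d : ℕ} {Λ : ℝ} (hΛ : 0 < Λ) (x : Vec d) (i : Fin d) :
    (cellBasis d hΛ).repr x i = x i / Λ := by
  have h : x = ∑ j, (x j / Λ) • cellBasis d hΛ j := by
    ext k
    simp [cellBasis_apply, Finset.sum_apply, Pi.single_apply, hΛ.ne']
  conv_lhs => rw [h]
  rw [Module.Basis.repr_sum_self]

lemma fundamentalDomain_cellBasis {d : ℕ} {Λ : ℝ} (hΛ : 0 < Λ) :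
    ZSpan.fundamentalDomain (cellBasis d hΛ) = cell d Λ := by
  ext x
  simp [ZSpan.mem_fundamentalDomain, cellBasis_repr, cell, div_lt_one hΛ, le_div_iff₀ hΛ]

lemma measurableSet_cell (d : ℕ) {Λ : ℝ} (hΛ : 0 < Λ) : MeasurableSet (cell d Λ) :=
  fundamentalDomain_cellBasis (d := d) hΛ ▸ ZSpan.fundamentalDomain_measurableSet _

lemma isAddFundamentalDomain_cell (d : ℕ) {Λ : ℝ} (hΛ : 0 < Λ) :
    IsAddFundamentalDomain (Submodule.span ℤ (Set.range (cellBasis d hΛ))).toAddSubgroup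
      (cell d Λ) volume :=
  fundamentalDomain_cellBasis (d := d) hΛ ▸ ZSpan.isAddFundamentalDomain' (cellBasis d hΛ) volume

lemma countable_lattice (d : ℕ) {Λ : ℝ} (hΛ : 0 < Λ) :
    Countable (Submodule.span ℤ (Set.range (cellBasis d hΛ))).toAddSubgroup := by
  have : Countable (Submodule.span ℤ (Set.range (cellBasis d hΛ))) := inferInstance
  exact this

lemma isBounded_cell (d : ℕ) {Λ : ℝ} (hΛ : 0 < Λ) : Bornology.IsBounded (cell d Λ) :=
  fundamentalDomain_cellBasis (d := d) hΛ ▸ ZSpan.fundamentalDomain_isBounded _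

lemma volume_cell_lt_top (d : ℕ) {Λ : ℝ} (hΛ : 0 < Λ) : volume (cell d Λ) < ⊤ :=
  (isBounded_cell d hΛ).measure_lt_top

lemma isFiniteMeasure_torusMeasure (d : ℕ) {Λ : ℝ} (hΛ : 0 < Λ) :
    IsFiniteMeasure (torusMeasure d Λ) :=
  ⟨by rw [torusMeasure, Measure.restrict_apply_univ]; exact volume_cell_lt_top d hΛ⟩

lemma IsPeriodic.add_lattice {d : ℕ} {α : Type} {Λ : ℝ} (hΛ : 0 < Λ) {f : Vec d → α}
    (hf : IsPeriodic Λ f) {v : Vec d}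
    (hv : v ∈ Submodule.span ℤ (Set.range (cellBasis d hΛ))) (x : Vec d) : f (x + v) = f x := by
  induction hv using Submodule.span_induction generalizing x with
  | mem v hv =>
    obtain ⟨i, rfl⟩ := hv
    rw [cellBasis_apply, hf]
  | zero => simp
  | add v w _ _ hv hw => rw [← add_assoc, hw, hv]
  | smul n v _ hv =>
    induction n using Int.induction_on generalizing x with
    | zero => simp
    | succ n ih => rw [add_smul, one_smul, ← add_assoc, hv, ih]
    -- To subtract a generator, its invariance is used at the point already shifted back by it.
    | pred n ih =>
      rw [sub_smul, one_smul]
      have := hv (x + (-(n : ℤ) • v - v))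
      rw [add_assoc, sub_add_cancel, ih] at this
      exact this.symm

/-- A translate of a fundamental domain is again one, and a periodic function has the same integral
over all of them. -/
lemma IsPeriodic.integral_add {d : ℕ} {E : Type} [NormedAddCommGroup E] [NormedSpace ℝ E]
    {Λ : ℝ} (hΛ : 0 < Λ) {f : Vec d → E} (hf : IsPeriodic Λ f) (z : Vec d) :
    ∫ x, f (x + z) ∂torusMeasure d Λ = ∫ x, f x ∂torusMeasure d Λ := by
  have := countable_lattice d hΛ
  have h1 := isAddFundamentalDomain_cell d hΛ
  have h2 := h1.vadd_of_comm z
  have h3 := h2.setIntegral_eq h1 (f := f) (fun g x => by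
    have := hf.add_lattice hΛ g.2 x
    rw [add_comm] at this
    exact this)
  open scoped Pointwise in
  have h5 : z +ᵥ cell d Λ = (fun x => z + x) '' cell d Λ := rfl
  rw [torusMeasure, ← h3, h5]
  have h4 := (measurePreserving_add_left (volume : Measure (Vec d)) z).setIntegral_image_emb
    (measurableEmbedding_addLeft z) f (cell d Λ)
  rw [h4]
  simp_rw [add_comm]

/-- The exceptional set is invariant under a countable lattice, so it is a countable union of
translates of a null set. -/
lemma ae_of_ae_torusMeasure {d : ℕ} {Λ : ℝ} (hΛ : 0 < Λ) {p : Vec d → Prop}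
    (hp : IsPeriodic Λ p) (h : ∀ᵐ x ∂torusMeasure d Λ, p x) : ∀ᵐ x : Vec d, p x := by
  rw [torusMeasure, ae_restrict_iff' (measurableSet_cell d hΛ)] at h
  have := countable_lattice d hΛ
  refine (isAddFundamentalDomain_cell d hΛ).measure_zero_of_invariant {x | ¬ p x} (fun g => ?_) ?_
  · ext x
    rw [Set.mem_vadd_set_iff_neg_vadd_mem]
    have := hp.add_lattice hΛ (-g).2 x
    rw [add_comm] at this
    simp only [Set.mem_ofPred_eq]
    exact not_congr (iff_of_eq this)
  · refine measure_mono_null ?_ h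
    rintro x ⟨hx, hx'⟩
    simp only [Set.mem_ofPred_eq, Set.mem_compl_iff] at *
    tauto

/-- The representative of `x` in the cell. -/
noncomputable def cellFract {d : ℕ} (Λ : ℝ) (x : Vec d) : Vec d :=
  WithLp.toLp 2 fun i => Λ * Int.fract (x i / Λ)

lemma cellFract_of_mem {d : ℕ} {Λ : ℝ} (hΛ : 0 < Λ) {x : Vec d} (hx : x ∈ cell d Λ) :
    cellFract Λ x = x := by
  ext i
  have : Int.fract (x i / Λ) = x i / Λ :=
    Int.fract_eq_self.2 ⟨div_nonneg (hx i).1 hΛ.le, (div_lt_one hΛ).2 (hx i).2⟩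
  simp [cellFract, this, mul_div_cancel₀ _ hΛ.ne']

lemma measurable_cellFract {d : ℕ} (Λ : ℝ) : Measurable (cellFract Λ : Vec d → Vec d) := by
  unfold cellFract
  refine (PiLp.continuous_toLp 2 _).measurable.comp (measurable_pi_lambda _ fun i => ?_)
  exact ((measurable_fract.comp ((by fun_prop : Continuous fun x : Vec d => x i / Λ).measurable))).const_mul _

lemma cellFract_add_single {d : ℕ} {Λ : ℝ} (hΛ : 0 < Λ) (x : Vec d) (i : Fin d) :
    cellFract Λ (x + EuclideanSpace.single i Λ) = cellFract Λ x := by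
  ext j
  by_cases hj : j = i
  · subst hj
    simp [cellFract, add_div, div_self hΛ.ne']
  · simp [cellFract, hj]

/-- Composition with `cellFract` makes any representative exactly periodic without changing it on
the cell. It serves both the initial map and the limit, which are given only almost everywhere. -/
lemma isPeriodic_comp_cellFract {d : ℕ} {α : Type} {Λ : ℝ} (hΛ : 0 < Λ) (f : Vec d → α) :
    IsPeriodic Λ fun x => f (cellFract Λ x) := fun x i => by
  simp only [cellFract_add_single hΛ]

/-! ### Parseval's identity on the cell -/

section Parseval

noncomputable local instance : MeasureSpace UnitAddCircle := ⟨AddCircle.haarAddCircle⟩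

/-- The parametrisation of the cell by the unit torus. -/
noncomputable def cellParam (d : ℕ) (Λ : ℝ) (y : UnitAddTorus (Fin d)) : Vec d :=
  WithLp.toLp 2 (Λ • (UnitAddTorus.measurableEquivPiIoc (fun _ => (0 : ℝ)) y).1)

lemma measurePreserving_cellParam (d : ℕ) {Λ : ℝ} (hΛ : 0 < Λ) :
    MeasurePreserving (cellParam d Λ) volume (ENNReal.ofReal ((Λ ^ d)⁻¹) • torusMeasure d Λ) := by
  have h1 := UnitAddTorus.measurePreserving_equivPiIoc (fun _ : Fin d => (0 : ℝ))
  have hS : MeasurableSet {x : Fin d → ℝ | ∀ i, x i ∈ Set.Ioc (0:ℝ) (0 + 1)} := by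
    convert MeasurableSet.univ_pi (fun _ : Fin d => measurableSet_Ioc (a := (0:ℝ)) (b := 0 + 1))
    ext; simp
  have h2 := measurePreserving_subtype_coe (μa := (volume : Measure (Fin d → ℝ))) hS
  have h3 : MeasurePreserving (fun x : Fin d → ℝ => WithLp.toLp 2 (Λ • x) : (Fin d → ℝ) → Vec d)
      volume (ENNReal.ofReal ((Λ ^ d)⁻¹) • volume) := by
    have ha : MeasurePreserving (fun x : Fin d → ℝ => Λ • x) volume
        (ENNReal.ofReal ((Λ ^ d)⁻¹) • volume) := by
      refine ⟨by fun_prop, ?_⟩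
      rw [Measure.map_addHaar_smul _ hΛ.ne']
      simp [abs_of_pos hΛ]
    exact ((PiLp.volume_preserving_toLp (Fin d)).smul_measure _).comp ha
  have hcell : (fun x : Fin d → ℝ => WithLp.toLp 2 (Λ • x) : (Fin d → ℝ) → Vec d) ⁻¹' cell d Λ
      = Set.univ.pi fun _ => Set.Ico (0:ℝ) 1 := by
    ext x
    simp only [cell, Set.mem_preimage, Set.mem_ofPred_eq, Pi.smul_apply, smul_eq_mul, Set.mem_pi,
      Set.mem_univ, true_imp_iff, Set.mem_Ico]
    refine forall_congr' fun i => and_congr ?_ ?_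
    · exact mul_nonneg_iff_of_pos_left hΛ
    · exact mul_lt_iff_lt_one_right hΛ
  have h4 := h3.restrict_preimage (measurableSet_cell d hΛ)
  rw [hcell] at h4
  -- The cell is built from half-open intervals closed on the left, the parametrisation of the unit
  -- torus from ones closed on the right; the boxes differ by a null set.
  have h5 : (volume : Measure (Fin d → ℝ)).restrict (Set.univ.pi fun _ => Set.Ico (0:ℝ) 1)
      = volume.restrict {x : Fin d → ℝ | ∀ i, x i ∈ Set.Ioc (0:ℝ) (0 + 1)} := by
    have e : {x : Fin d → ℝ | ∀ i, x i ∈ Set.Ioc (0:ℝ) (0 + 1)}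
      = Set.univ.pi fun _ => Set.Ioc (0:ℝ) 1 := by ext; simp
    rw [e]
    exact Measure.restrict_congr_set (Measure.univ_pi_Ico_ae_eq_Icc.trans
      Measure.univ_pi_Ioc_ae_eq_Icc.symm)
  rw [h5, Measure.restrict_smul] at h4
  exact h4.comp (h2.comp h1)

/-- The wave vector `2 π n / Λ`. -/
noncomputable def waveVec {d : ℕ} (Λ : ℝ) (n : Fin d → ℤ) : Vec d :=
  WithLp.toLp 2 fun i => 2 * Real.pi * n i / Λ

/-- The character `exp (i ξ_n · x)`. -/
noncomputable def character {d : ℕ} (Λ : ℝ) (n : Fin d → ℤ) (x : Vec d) : ℂ :=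
  Complex.exp ((inner ℝ (waveVec Λ n) x : ℝ) * Complex.I)

lemma mFourier_eq_character {d : ℕ} {Λ : ℝ} (hΛ : 0 < Λ) (n : Fin d → ℤ)
    (y : UnitAddTorus (Fin d)) :
    UnitAddTorus.mFourier n y = character Λ n (cellParam d Λ y) := by
  have hy : ∀ i, y i = (((UnitAddTorus.measurableEquivPiIoc (fun _ => (0 : ℝ)) y).1 i : ℝ) :
      UnitAddCircle) := fun i => by
    conv_lhs => rw [← (UnitAddTorus.measurableEquivPiIoc (fun _ => (0 : ℝ))).symm_apply_apply y]
    rw [UnitAddTorus.coe_symm_measurableEquivPiIoc_apply]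
  simp only [UnitAddTorus.mFourier, ContinuousMap.coe_mk, character]
  have h1 : ∀ i, fourier (n i) (y i) = Complex.exp
      (2 * Real.pi * Complex.I * n i * ((UnitAddTorus.measurableEquivPiIoc (fun _ => (0 : ℝ)) y).1 i : ℝ)) := by
    intro i
    rw [hy i, fourier_coe_apply]
    simp
  rw [Finset.prod_congr rfl fun i _ => h1 i, ← Complex.exp_sum]
  congr 1
  rw [PiLp.inner_apply, Complex.ofReal_sum, Finset.sum_mul]
  refine Finset.sum_congr rfl fun i _ => ?_
  simp only [waveVec, cellParam, RCLike.inner_apply, conj_trivial, Pi.smul_apply, smul_eq_mul]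
  push_cast
  have : (Λ : ℂ) ≠ 0 := by exact_mod_cast hΛ.ne'
  field_simp

/-- The (unnormalised) Fourier coefficients of a function on the cell. -/
noncomputable def fourierCoeffCell {d : ℕ} (Λ : ℝ) (f : Vec d → ℂ) (n : Fin d → ℤ) : ℂ :=
  ∫ x, character Λ (-n) x * f x ∂torusMeasure d Λ

lemma integral_comp_cellParam {d : ℕ} {Λ : ℝ} (hΛ : 0 < Λ) {f : Vec d → ℂ}
    (hf : AEStronglyMeasurable f (torusMeasure d Λ)) :
    ∫ y, f (cellParam d Λ y) = ((Λ ^ d)⁻¹ : ℝ) * ∫ x, f x ∂torusMeasure d Λ := by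
  have h := measurePreserving_cellParam d hΛ
  rw [← integral_map (μ := volume) (φ := cellParam d Λ) h.measurable.aemeasurable (f := f), h.map_eq,
    integral_smul_measure, ENNReal.toReal_ofReal (by positivity), Complex.real_smul]
  rw [h.map_eq]
  exact hf.mono_ac (Measure.smul_absolutelyContinuous)

lemma continuous_character {d : ℕ} (Λ : ℝ) (n : Fin d → ℤ) :
    Continuous (character Λ n : Vec d → ℂ) := by
  unfold character
  fun_prop

lemma norm_character {d : ℕ} (Λ : ℝ) (n : Fin d → ℤ) (x : Vec d) : ‖character Λ n x‖ = 1 := by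
  rw [character, Complex.norm_exp_ofReal_mul_I]

/-- Parseval on the unit torus, transported by `cellParam`. The coefficients are not normalised:
each is `Λ ^ d` times a normalised one, while the mean contributes one factor `(Λ ^ d)⁻¹`, which
leaves `Λ ^ d` in front of the integral. -/
lemma hasSum_fourierCoeffCell {d : ℕ} {Λ : ℝ} (hΛ : 0 < Λ) {f g : Vec d → ℂ}
    (hf : MemLp f 2 (torusMeasure d Λ)) (hg : MemLp g 2 (torusMeasure d Λ)) :
    HasSum (fun n => (starRingEnd ℂ) (fourierCoeffCell Λ f n) * fourierCoeffCell Λ g n)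
      ((Λ ^ d : ℝ) * ∫ x, (starRingEnd ℂ) (f x) * g x ∂torusMeasure d Λ) := by
  have h := measurePreserving_cellParam d hΛ
  have key : ∀ {f : Vec d → ℂ}, MemLp f 2 (torusMeasure d Λ) →
      MemLp (fun y => f (cellParam d Λ y)) 2 volume := fun hf =>
    (hf.smul_measure ENNReal.ofReal_ne_top).comp_measurePreserving h
  have hc : ∀ {f : Vec d → ℂ} (hf : MemLp f 2 (torusMeasure d Λ)) (n : Fin d → ℤ),
      fourierCoeffCell Λ f n = (Λ ^ d : ℝ) * UnitAddTorus.mFourierCoeff ((key hf).toLp) n := by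
    intro f hf n
    rw [UnitAddTorus.mFourierCoeff]
    have : ∫ t, UnitAddTorus.mFourier (-n) t • (key hf).toLp _ t =
        ∫ t, (fun x => character Λ (-n) x * f x) (cellParam d Λ t) := by
      refine integral_congr_ae ?_
      filter_upwards [(key hf).coeFn_toLp] with t ht
      rw [ht, mFourier_eq_character hΛ, smul_eq_mul]
    rw [this, integral_comp_cellParam hΛ (f := fun x => character Λ (-n) x * f x)
      ((continuous_character Λ (-n)).aestronglyMeasurable.mul hf.1), fourierCoeffCell, ← mul_assoc,
      ← Complex.ofReal_mul, mul_inv_cancel₀ (by positivity), Complex.ofReal_one, one_mul]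
  have hs := UnitAddTorus.hasSum_prod_mFourierCoeff (key hf).toLp (key hg).toLp
  have hi : ∫ t, (starRingEnd ℂ) ((key hf).toLp _ t) * (key hg).toLp _ t =
      ∫ t, (fun x => (starRingEnd ℂ) (f x) * g x) (cellParam d Λ t) := by
    refine integral_congr_ae ?_
    filter_upwards [(key hf).coeFn_toLp, (key hg).coeFn_toLp] with t h1 h2
    rw [h1, h2]
  rw [hi, integral_comp_cellParam hΛ (f := fun x => (starRingEnd ℂ) (f x) * g x) ((Complex.continuous_conj.comp_aestronglyMeasurable hf.1).mul
    hg.1)] at hs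
  have hs2 := hs.mul_left (((Λ ^ d : ℝ) : ℂ) * (Λ ^ d : ℝ))
  have e1 : (fun n => (starRingEnd ℂ) (fourierCoeffCell Λ f n) * fourierCoeffCell Λ g n) =
      fun n => ((Λ ^ d : ℝ) : ℂ) * (Λ ^ d : ℝ) *
      ((starRingEnd ℂ) (UnitAddTorus.mFourierCoeff ((key hf).toLp) n) *
        UnitAddTorus.mFourierCoeff ((key hg).toLp) n) := by
    funext n
    rw [hc hf, hc hg, map_mul, Complex.conj_ofReal]
    ring
  have e2 : ((Λ ^ d : ℝ) : ℂ) * ∫ x, (starRingEnd ℂ) (f x) * g x ∂torusMeasure d Λ =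
      ((Λ ^ d : ℝ) : ℂ) * (Λ ^ d : ℝ) * (((Λ ^ d)⁻¹ : ℝ) *
        ∫ x, (starRingEnd ℂ) (f x) * g x ∂torusMeasure d Λ) := by
    rw [Complex.ofReal_inv]
    have : ((Λ ^ d : ℝ) : ℂ) ≠ 0 := by exact_mod_cast (pow_pos hΛ d).ne'
    field_simp
  rw [e1, e2]
  exact hs2

end Parseval

end HMHF

namespace HMHF

/-! ### The heat kernel -/

lemma heatKernel_nonneg {d : ℕ} {h : ℝ} (hh : 0 < h) (z : Vec d) : 0 ≤ heatKernel d h z := by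
  unfold heatKernel
  positivity

lemma contDiff_heatKernel (d : ℕ) (h : ℝ) : ContDiff ℝ ∞ (heatKernel d h) := by
  unfold heatKernel
  exact contDiff_const.mul (((contDiff_norm_sq ℝ).neg.div_const _).exp)

lemma continuous_heatKernel (d : ℕ) (h : ℝ) : Continuous (heatKernel d h) :=
  (contDiff_heatKernel d h).continuous

lemma heatKernel_neg {d : ℕ} (h : ℝ) (z : Vec d) : heatKernel d h (-z) = heatKernel d h z := by
  simp [heatKernel]

lemma fderiv_heatKernel {d : ℕ} (h : ℝ) (z v : Vec d) :
    fderiv ℝ (heatKernel d h) z v = -(inner ℝ z v / (2 * h)) * heatKernel d h z := by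
  have h1 : HasFDerivAt (fun z : Vec d => -‖z‖ ^ 2 / (4 * h))
      ((4 * h)⁻¹ • (-(2 • (innerSL ℝ z)) : Vec d →L[ℝ] ℝ)) z := by
    simp_rw [div_eq_inv_mul]
    exact ((hasStrictFDerivAt_norm_sq z).hasFDerivAt.neg).const_mul _
  have h2 := (h1.exp.const_mul ((4 * Real.pi * h) ^ (-(d : ℝ) / 2)))
  have h3 : HasFDerivAt (heatKernel d h) _ z := h2
  rw [h3.fderiv]
  simp only [smul_apply, neg_apply, innerSL_apply_apply,
    smul_eq_mul, heatKernel, nsmul_eq_mul]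
  push_cast
  ring

lemma fderiv_heatKernel_single {d : ℕ} (h : ℝ) (z : Vec d) (i : Fin d) :
    fderiv ℝ (heatKernel d h) z (EuclideanSpace.single i 1) =
      -(z i / (2 * h)) * heatKernel d h z := by
  rw [fderiv_heatKernel, EuclideanSpace.inner_single_right]
  simp

/-- The Fourier transform of a Gaussian with parameter 1/(4h): the normalisation of the kernel
cancels the prefactor. -/
lemma integral_heatKernel_mul_cexp {d : ℕ} {h : ℝ} (hh : 0 < h) (w : Vec d) :
    ∫ z, (heatKernel d h z : ℂ) * Complex.exp ((inner ℝ w z : ℝ) * Complex.I) =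
      Real.exp (-h * ‖w‖ ^ 2) := by
  have hb : 0 < (((4 * h)⁻¹ : ℝ) : ℂ).re := by
    rw [Complex.ofReal_re]; positivity
  have key := GaussianFourier.integral_cexp_neg_mul_sq_norm_add hb Complex.I w
  have e : ∀ z : Vec d, (heatKernel d h z : ℂ) * Complex.exp ((inner ℝ w z : ℝ) * Complex.I) =
      (((4 * Real.pi * h) ^ (-(d : ℝ) / 2) : ℝ) : ℂ) *
        Complex.exp (-(((4 * h)⁻¹ : ℝ) : ℂ) * ‖z‖ ^ 2 + Complex.I * (inner ℝ w z : ℝ)) := by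
    intro z
    rw [heatKernel, Complex.ofReal_mul, mul_assoc, Complex.ofReal_exp, ← Complex.exp_add]
    congr 3
    · push_cast
      ring
    · ring
  simp_rw [e]
  rw [integral_const_mul]
  erw [key]
  have e1 : (Real.pi / (((4 * h)⁻¹ : ℝ) : ℂ)) = ((4 * Real.pi * h : ℝ) : ℂ) := by
    push_cast
    field_simp
  have e2 : ((Module.finrank ℝ (Vec d) : ℂ) / 2) = (((d : ℝ) / 2 : ℝ) : ℂ) := by simp
  rw [e1, e2, ← Complex.ofReal_cpow (by positivity), ← mul_assoc, ← Complex.ofReal_mul,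
    ← Real.rpow_add (by positivity), neg_div, neg_add_cancel, Real.rpow_zero, Complex.ofReal_one,
    one_mul, Complex.ofReal_exp]
  congr 1
  push_cast
  rw [Complex.I_sq]
  have : (h : ℂ) ≠ 0 := by exact_mod_cast hh.ne'
  field_simp

lemma integrable_heatKernel (d : ℕ) {h : ℝ} (hh : 0 < h) : Integrable (heatKernel d h) := by
  have hb : 0 < (((4 * h)⁻¹ : ℝ) : ℂ).re := by
    rw [Complex.ofReal_re]; positivity
  have key := (GaussianFourier.integrable_cexp_neg_mul_sq_norm_add hb 0 (0 : Vec d)).re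
  have : heatKernel d h = fun z => (4 * Real.pi * h) ^ (-(d : ℝ) / 2) *
      RCLike.re (Complex.exp (-(((4 * h)⁻¹ : ℝ) : ℂ) * ‖z‖ ^ 2 + 0 * (inner ℝ 0 z : ℝ))) := by
    funext z
    have : (-(((4 * h)⁻¹ : ℝ) : ℂ) * ‖z‖ ^ 2 + 0 * (inner ℝ 0 z : ℝ)) =
        ((-‖z‖ ^ 2 / (4 * h) : ℝ) : ℂ) := by
      push_cast; ring
    rw [this, ← Complex.ofReal_exp]
    rfl
  rw [this]
  exact key.const_mul _

lemma integral_heatKernel (d : ℕ) {h : ℝ} (hh : 0 < h) : ∫ z, heatKernel d h z = 1 := by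
  have := integral_heatKernel_mul_cexp (d := d) hh 0
  simp only [inner_zero_left, Complex.ofReal_zero, zero_mul, Complex.exp_zero, mul_one,
    norm_zero] at this
  rw [integral_complex_ofReal] at this
  norm_num at this
  exact_mod_cast this

/-- Half of the Gaussian exponent absorbs the polynomial: with y = |z|²/(8h) one has y²/2 ≤ exp y,
and what remains is the kernel at time 2h. The factor `2 ^ (d / 2)` compensates the change of
normalisation. -/
lemma norm_pow_four_mul_heatKernel_le {d : ℕ} {h : ℝ} (hh : 0 < h) (z : Vec d) :
    ‖z‖ ^ 4 * heatKernel d h z ≤ 128 * 2 ^ ((d : ℝ) / 2) * h ^ 2 * heatKernel d (2 * h) z := by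
  have h1 : (‖z‖ ^ 2 / (8 * h)) ^ 2 / 2 ≤ Real.exp (‖z‖ ^ 2 / (8 * h)) := by
    have := Real.quadratic_le_exp_of_nonneg (x := ‖z‖ ^ 2 / (8 * h)) (by positivity)
    have : 0 ≤ ‖z‖ ^ 2 / (8 * h) := by positivity
    linarith
  have h2 : ‖z‖ ^ 4 ≤ 128 * h ^ 2 * Real.exp (‖z‖ ^ 2 / (8 * h)) := by
    calc ‖z‖ ^ 4 = 128 * h ^ 2 * ((‖z‖ ^ 2 / (8 * h)) ^ 2 / 2) := by field_simp; ring
      _ ≤ _ := by gcongr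
  have h3 : heatKernel d (2 * h) z = 2 ^ (-((d : ℝ) / 2)) * ((4 * Real.pi * h) ^ (-(d : ℝ) / 2) *
      (Real.exp (‖z‖ ^ 2 / (8 * h)) * Real.exp (-‖z‖ ^ 2 / (4 * h)))) := by
    rw [heatKernel, ← Real.exp_add, show 4 * Real.pi * (2 * h) = 2 * (4 * Real.pi * h) by ring,
      Real.mul_rpow (by positivity) (by positivity), ← neg_div, mul_assoc]
    congr 3
    field_simp
    ring
  have h4 : (2 : ℝ) ^ ((d : ℝ) / 2) * 2 ^ (-((d : ℝ) / 2)) = 1 := by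
    rw [← Real.rpow_add (by norm_num), add_neg_cancel, Real.rpow_zero]
  calc ‖z‖ ^ 4 * heatKernel d h z
      ≤ (128 * h ^ 2 * Real.exp (‖z‖ ^ 2 / (8 * h))) * heatKernel d h z :=
        mul_le_mul_of_nonneg_right h2 (heatKernel_nonneg hh z)
    _ = 128 * h ^ 2 * (2 ^ ((d : ℝ) / 2) * 2 ^ (-((d : ℝ) / 2))) *
        ((4 * Real.pi * h) ^ (-(d : ℝ) / 2) *
      (Real.exp (‖z‖ ^ 2 / (8 * h)) * Real.exp (-‖z‖ ^ 2 / (4 * h)))) := by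
        rw [h4, heatKernel]; ring
    _ = _ := by rw [h3]; ring

lemma integrable_norm_pow_four_mul_heatKernel (d : ℕ) {h : ℝ} (hh : 0 < h) :
    Integrable fun z : Vec d => ‖z‖ ^ 4 * heatKernel d h z := by
  refine ((integrable_heatKernel d (h := 2 * h) (by positivity)).const_mul
    (128 * 2 ^ ((d : ℝ) / 2) * h ^ 2)).mono'
    ((by have := continuous_heatKernel d h; fun_prop : Continuous _).aestronglyMeasurable)
    (Eventually.of_forall fun z => ?_)
  rw [Real.norm_of_nonneg (mul_nonneg (by positivity) (heatKernel_nonneg hh z))]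
  exact norm_pow_four_mul_heatKernel_le hh z

lemma integral_norm_pow_four_mul_heatKernel_le (d : ℕ) {h : ℝ} (hh : 0 < h) :
    ∫ z : Vec d, ‖z‖ ^ 4 * heatKernel d h z ≤ 128 * 2 ^ ((d : ℝ) / 2) * h ^ 2 := by
  calc ∫ z : Vec d, ‖z‖ ^ 4 * heatKernel d h z
      ≤ ∫ z : Vec d, 128 * 2 ^ ((d : ℝ) / 2) * h ^ 2 * heatKernel d (2 * h) z :=
        integral_mono (integrable_norm_pow_four_mul_heatKernel d hh)
          ((integrable_heatKernel d (by positivity)).const_mul _)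
          (norm_pow_four_mul_heatKernel_le hh)
    _ = _ := by rw [integral_const_mul, integral_heatKernel d (by positivity), mul_one]

lemma integrable_norm_pow_mul_heatKernel (d : ℕ) {h : ℝ} (hh : 0 < h) {k : ℕ} (hk : k ≤ 4) :
    Integrable fun z : Vec d => ‖z‖ ^ k * heatKernel d h z := by
  refine ((integrable_heatKernel d hh).add (integrable_norm_pow_four_mul_heatKernel d hh)).mono'
    ((by have := continuous_heatKernel d h; fun_prop : Continuous _).aestronglyMeasurable)
    (Eventually.of_forall fun z => ?_)
  rw [Real.norm_of_nonneg (mul_nonneg (by positivity) (heatKernel_nonneg hh z))]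
  have : ‖z‖ ^ k ≤ 1 + ‖z‖ ^ 4 := by
    rcases le_total ‖z‖ 1 with h1 | h1
    · have := pow_le_one₀ (n := k) (norm_nonneg z) h1
      have : 0 ≤ ‖z‖ ^ 4 := by positivity
      linarith
    · have := pow_le_pow_right₀ h1 hk
      linarith
  calc _ ≤ (1 + ‖z‖ ^ 4) * heatKernel d h z :=
        mul_le_mul_of_nonneg_right this (heatKernel_nonneg hh z)
    _ = _ := by simp only [Pi.add_apply]; ring

/-- The kernel `∂ᵢ G_h`. -/
noncomputable def gradKernel (d : ℕ) (h : ℝ) (i : Fin d) (z : Vec d) : ℝ :=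
  fderiv ℝ (heatKernel d h) z (EuclideanSpace.single i 1)

lemma gradKernel_eq {d : ℕ} (h : ℝ) (i : Fin d) (z : Vec d) :
    gradKernel d h i z = -(z i / (2 * h)) * heatKernel d h z := fderiv_heatKernel_single h z i

lemma abs_apply_le_norm {d : ℕ} (z : Vec d) (i : Fin d) : |z i| ≤ ‖z‖ := by
  simpa using PiLp.norm_apply_le z i

lemma integrable_gradKernel {d : ℕ} {h : ℝ} (hh : 0 < h) (i : Fin d) :
    Integrable (gradKernel d h i) := by
  have hc := continuous_heatKernel d h
  refine ((integrable_norm_pow_mul_heatKernel d hh (k := 1) (by norm_num)).const_mul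
    (2 * h)⁻¹).mono' ?_ (Eventually.of_forall fun z => ?_)
  · rw [funext (gradKernel_eq h i)]
    exact (by fun_prop : Continuous _).aestronglyMeasurable
  · rw [gradKernel_eq, norm_mul, Real.norm_of_nonneg (heatKernel_nonneg hh z), norm_neg, norm_div,
      Real.norm_of_nonneg (by positivity : 0 ≤ 2 * h), pow_one, div_eq_inv_mul, mul_assoc]
    have := heatKernel_nonneg hh z
    gcongr
    exact abs_apply_le_norm z i

lemma hasFDerivAt_cexp_inner {d : ℕ} (w z : Vec d) :
    HasFDerivAt (fun z : Vec d => Complex.exp ((inner ℝ w z : ℝ) * Complex.I))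
      (Complex.exp ((inner ℝ w z : ℝ) * Complex.I) •
        ((Complex.ofRealCLM.comp (innerSL ℝ w)).smulRight Complex.I)) z := by
  refine HasFDerivAt.cexp ?_
  exact ((Complex.ofRealCLM.comp (innerSL ℝ w)).hasFDerivAt).mul_const _ |>.congr_fderiv (by
    ext v; simp [mul_comm])

/-- Integration by parts moves the derivative onto the exponential, which reproduces itself. -/
lemma integral_gradKernel_mul_cexp {d : ℕ} {h : ℝ} (hh : 0 < h) (i : Fin d) (w : Vec d) :
    ∫ z, (gradKernel d h i z : ℂ) * Complex.exp ((inner ℝ w z : ℝ) * Complex.I) =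
      -(w i * Complex.I) * Real.exp (-h * ‖w‖ ^ 2) := by
  have hder : ∀ z, fderiv ℝ (fun z => (heatKernel d h z : ℂ)) z (EuclideanSpace.single i 1) =
      gradKernel d h i z := by
    intro z
    have h1 : HasFDerivAt (fun z => (heatKernel d h z : ℂ))
      (Complex.ofRealCLM.comp (fderiv ℝ (heatKernel d h) z)) z :=
      Complex.ofRealCLM.hasFDerivAt.comp z
        ((contDiff_heatKernel d h).differentiable (by simp) z).hasFDerivAt
    rw [h1.fderiv]
    rfl
  have hderc : ∀ z, fderiv ℝ (fun z : Vec d => Complex.exp ((inner ℝ w z : ℝ) * Complex.I)) z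
      (EuclideanSpace.single i 1) = Complex.exp ((inner ℝ w z : ℝ) * Complex.I) *
        (w i * Complex.I) := by
    intro z
    rw [(hasFDerivAt_cexp_inner w z).fderiv]
    simp [EuclideanSpace.inner_single_right]
  have hn : ∀ z : Vec d, ‖Complex.exp ((inner ℝ w z : ℝ) * Complex.I)‖ ≤ 1 := fun z => by
    rw [Complex.norm_exp_ofReal_mul_I]
  have hcont : Continuous fun z : Vec d => Complex.exp ((inner ℝ w z : ℝ) * Complex.I) := by
    fun_prop
  have hG : Integrable fun z => Complex.exp ((inner ℝ w z : ℝ) * Complex.I) *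
      (heatKernel d h z : ℂ) :=
    (integrable_heatKernel d hh).ofReal.bdd_mul hcont.aestronglyMeasurable
      (Eventually.of_forall hn)
  have key := integral_mul_fderiv_eq_neg_fderiv_mul_of_integrable (𝕜 := ℂ)
    (μ := (volume : Measure (Vec d)))
    (f := fun z : Vec d => Complex.exp ((inner ℝ w z : ℝ) * Complex.I))
    (g := fun z => (heatKernel d h z : ℂ)) (v := EuclideanSpace.single i 1) ?_ ?_ hG ?_ ?_
  · simp_rw [hder, hderc] at key
    simp_rw [mul_comm (gradKernel d h i _ : ℂ)]
    rw [key, ← integral_heatKernel_mul_cexp hh w, ← integral_const_mul, ← integral_neg]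
    congr 1
    funext z
    ring
  · simp_rw [hderc]
    convert hG.const_mul (w i * Complex.I) using 2
    ring
  · simp_rw [hder]
    exact (integrable_gradKernel hh i).ofReal.bdd_mul hcont.aestronglyMeasurable
      (Eventually.of_forall hn)
  · exact fun z _ => (hasFDerivAt_cexp_inner w z).differentiableAt
  · exact fun z _ => Complex.ofRealCLM.differentiableAt.comp z
        ((contDiff_heatKernel d h).differentiable (by simp) z)

end HMHF

namespace HMHF

/-! ### Bounded periodic functions and their convolutions -/

/-- Bounded measurable functions on the torus. -/
structure BddPeriodic {d : ℕ} (Λ : ℝ) (f : Vec d → ℝ) : Prop where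
  measurable : Measurable f
  periodic : IsPeriodic Λ f
  bounded : ∃ C, ∀ x, |f x| ≤ C

/-- The scalar convolution `g ∗ f`. -/
noncomputable def sconv {d : ℕ} (g f : Vec d → ℝ) (x : Vec d) : ℝ := ∫ z, g z * f (x - z)

namespace BddPeriodic

variable {d : ℕ} {Λ : ℝ} {f f' g : Vec d → ℝ}

lemma memLp (hΛ : 0 < Λ) (hf : BddPeriodic Λ f) (p : ENNReal) :
    MemLp f p (torusMeasure d Λ) := by
  have := isFiniteMeasure_torusMeasure d hΛ
  obtain ⟨C, hC⟩ := hf.bounded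
  exact MemLp.of_bound hf.measurable.aestronglyMeasurable C (Eventually.of_forall hC)

lemma integrable (hΛ : 0 < Λ) (hf : BddPeriodic Λ f) : Integrable f (torusMeasure d Λ) :=
  memLp_one_iff_integrable.1 (hf.memLp hΛ 1)

lemma add (hf : BddPeriodic Λ f) (hf' : BddPeriodic Λ f') : BddPeriodic Λ fun x => f x + f' x := by
  obtain ⟨C, hC⟩ := hf.bounded
  obtain ⟨C', hC'⟩ := hf'.bounded
  exact ⟨hf.measurable.add hf'.measurable, fun x i => by rw [hf.periodic, hf'.periodic],
    C + C', fun x => (abs_add_le _ _).trans (add_le_add (hC x) (hC' x))⟩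

lemma neg (hf : BddPeriodic Λ f) : BddPeriodic Λ fun x => -f x := by
  obtain ⟨C, hC⟩ := hf.bounded
  exact ⟨hf.measurable.neg, fun x i => by rw [hf.periodic], C, fun x => by simpa using hC x⟩

lemma sub (hf : BddPeriodic Λ f) (hf' : BddPeriodic Λ f') : BddPeriodic Λ fun x => f x - f' x := by
  simpa only [sub_eq_add_neg] using hf.add hf'.neg

lemma mul (hf : BddPeriodic Λ f) (hf' : BddPeriodic Λ f') : BddPeriodic Λ fun x => f x * f' x := by
  obtain ⟨C, hC⟩ := hf.bounded
  obtain ⟨C', hC'⟩ := hf'.bounded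
  refine ⟨hf.measurable.mul hf'.measurable, fun x i => by rw [hf.periodic, hf'.periodic],
    C * C', fun x => ?_⟩
  rw [abs_mul]
  exact mul_le_mul (hC x) (hC' x) (abs_nonneg _) ((abs_nonneg _).trans (hC x))

lemma const (c : ℝ) : BddPeriodic Λ fun _ : Vec d => c :=
  ⟨measurable_const, fun _ _ => rfl, |c|, fun _ => le_rfl⟩

lemma sum {ι : Type} (s : Finset ι) {F : ι → Vec d → ℝ} (hF : ∀ i ∈ s, BddPeriodic Λ (F i)) :
    BddPeriodic Λ fun x => ∑ i ∈ s, F i x := by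
  classical
  induction s using Finset.induction_on with
  | empty => simpa using const 0
  | insert i s hi ih =>
    simp_rw [Finset.sum_insert hi]
    exact (hF i (by simp)).add (ih fun j hj => hF j (by simp [hj]))

lemma comp_add (hf : BddPeriodic Λ f) (z : Vec d) : BddPeriodic Λ fun x => f (x + z) := by
  obtain ⟨C, hC⟩ := hf.bounded
  exact ⟨hf.measurable.comp (measurable_id.add_const z),
    fun x i => by rw [add_right_comm, hf.periodic], C, fun x => hC _⟩

lemma comp_sub (hf : BddPeriodic Λ f) (z : Vec d) : BddPeriodic Λ fun x => f (x - z) := by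
  simpa only [sub_eq_add_neg] using hf.comp_add (-z)

lemma integrable_mul_kernel (hf : BddPeriodic Λ f) (hg : Integrable g) (x : Vec d) :
    Integrable fun z => g z * f (x - z) := by
  obtain ⟨C, hC⟩ := hf.bounded
  exact hg.mul_bdd (c := C)
    (hf.measurable.comp (measurable_id.const_sub x)).aestronglyMeasurable
    (Eventually.of_forall fun z => hC _)

lemma sconv (hf : BddPeriodic Λ f) (hg : Integrable g) (hgm : Measurable g) :
    BddPeriodic Λ (sconv g f) := by
  obtain ⟨C, hC⟩ := hf.bounded
  refine ⟨?_, fun x i => ?_, C * ∫ z, |g z|, fun x => ?_⟩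
  · have : Measurable fun p : Vec d × Vec d => g p.2 * f (p.1 - p.2) :=
      (hgm.comp measurable_snd).mul (hf.measurable.comp (measurable_fst.sub measurable_snd))
    exact this.stronglyMeasurable.integral_prod_right.measurable
  · simp_rw [HMHF.sconv, add_sub_right_comm, hf.periodic _ i]
  · rw [HMHF.sconv, ← integral_const_mul, ← Real.norm_eq_abs]
    refine norm_integral_le_of_norm_le (hg.abs.const_mul C) (Eventually.of_forall fun z => ?_)
    rw [norm_mul, mul_comm]
    exact mul_le_mul_of_nonneg_right (hC _) (norm_nonneg _)

/-- Fubini's theorem for `∫ p (g ∗ f)`. -/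
lemma integral_sconv_smul {E : Type} [NormedAddCommGroup E] [NormedSpace ℝ E]
    [CompleteSpace E] (hΛ : 0 < Λ) (hf : BddPeriodic Λ f) (hg : Integrable g) {p : Vec d → E}
    (hp : Integrable p (torusMeasure d Λ)) :
    ∫ x, HMHF.sconv g f x • p x ∂torusMeasure d Λ =
      ∫ z, g z • ∫ x, f (x - z) • p x ∂torusMeasure d Λ := by
  have := isFiniteMeasure_torusMeasure d hΛ
  obtain ⟨C, hC⟩ := hf.bounded
  have hint : Integrable (Function.uncurry fun (x z : Vec d) => (g z * f (x - z)) • p x)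
      ((torusMeasure d Λ).prod volume) := by
    have h1 : Integrable (fun q : Vec d × Vec d => g q.2 • p q.1)
        ((torusMeasure d Λ).prod volume) := by
      have := (hg.smul_prod hp).swap
      exact this
    have h2 := h1.bdd_smul (φ := fun q : Vec d × Vec d => f (q.1 - q.2)) C
      (hf.measurable.comp (measurable_fst.sub measurable_snd)).aestronglyMeasurable
      (Eventually.of_forall fun q => hC _)
    refine h2.congr (Eventually.of_forall fun q => ?_)
    simp only [Function.uncurry, Pi.smul_apply', smul_smul]
    rw [mul_comm]
  calc ∫ x, HMHF.sconv g f x • p x ∂torusMeasure d Λ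
      = ∫ x, (∫ z, (g z * f (x - z)) • p x) ∂torusMeasure d Λ := by
        congr 1; funext x
        rw [HMHF.sconv, integral_smul_const]
    _ = ∫ z, (∫ x, (g z * f (x - z)) • p x ∂torusMeasure d Λ) := integral_integral_swap hint
    _ = _ := by
        congr 1; funext z
        simp_rw [mul_smul]
        rw [integral_smul]

end BddPeriodic

/-! ### Fourier coefficients of real functions -/

/-- The Fourier coefficients of a real function on the cell. -/
noncomputable def fc {d : ℕ} (Λ : ℝ) (f : Vec d → ℝ) (n : Fin d → ℤ) : ℂ :=
  fourierCoeffCell Λ (fun x => (f x : ℂ)) n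

variable {d : ℕ} {Λ : ℝ} {f g : Vec d → ℝ}

lemma hasSum_fc_mul (hΛ : 0 < Λ) (hf : MemLp f 2 (torusMeasure d Λ))
    (hg : MemLp g 2 (torusMeasure d Λ)) :
    HasSum (fun n => ((starRingEnd ℂ) (fc Λ f n) * fc Λ g n).re)
      (Λ ^ d * ∫ x, f x * g x ∂torusMeasure d Λ) := by
  have := Complex.reCLM.hasSum (hasSum_fourierCoeffCell hΛ hf.ofReal hg.ofReal)
  have e : ((Λ ^ d : ℝ) : ℂ) * ∫ x, (starRingEnd ℂ) (f x : ℂ) * (g x : ℂ) ∂torusMeasure d Λ =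
      ((Λ ^ d * ∫ x, f x * g x ∂torusMeasure d Λ : ℝ) : ℂ) := by
    rw [Complex.ofReal_mul, ← integral_complex_ofReal]
    simp only [Complex.conj_ofReal, Complex.ofReal_mul]
  erw [e] at this
  exact this

lemma hasSum_norm_fc_sq (hΛ : 0 < Λ) (hf : MemLp f 2 (torusMeasure d Λ)) :
    HasSum (fun n => ‖fc Λ f n‖ ^ 2) (Λ ^ d * ∫ x, f x ^ 2 ∂torusMeasure d Λ) := by
  have := hasSum_fc_mul hΛ hf hf
  simp only [← pow_two] at this
  convert this using 2 with n
  rw [← Complex.normSq_eq_conj_mul_self, Complex.ofReal_re, Complex.normSq_eq_norm_sq]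

lemma character_add (n : Fin d → ℤ) (x z : Vec d) :
    character Λ n (x + z) = character Λ n x * character Λ n z := by
  simp only [character, inner_add_right, Complex.ofReal_add, add_mul, Complex.exp_add]

lemma isPeriodic_character (hΛ : 0 < Λ) (n : Fin d → ℤ) :
    IsPeriodic Λ (character Λ n : Vec d → ℂ) := fun x i => by
  rw [character_add]
  convert mul_one _
  rw [character, EuclideanSpace.inner_single_right, Complex.exp_eq_one_iff]
  refine ⟨n i, ?_⟩
  simp only [waveVec, conj_trivial]
  push_cast
  have : (Λ : ℂ) ≠ 0 := by exact_mod_cast hΛ.ne'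
  field_simp

lemma integrable_character_mul (n : Fin d → ℤ)
    (hf : Integrable f (torusMeasure d Λ)) :
    Integrable (fun x => character Λ n x * (f x : ℂ)) (torusMeasure d Λ) :=
  hf.ofReal.bdd_mul (c := 1) (continuous_character Λ n).aestronglyMeasurable
    (Eventually.of_forall fun x => (norm_character Λ n x).le)

lemma integrable_character (hΛ : 0 < Λ) (n : Fin d → ℤ) :
    Integrable (character Λ n) (torusMeasure d Λ) := by
  have := isFiniteMeasure_torusMeasure d hΛ
  exact Integrable.of_bound (continuous_character Λ n).aestronglyMeasurable 1
    (Eventually.of_forall fun x => (norm_character Λ n x).le)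

lemma fc_sub (hf : Integrable f (torusMeasure d Λ))
    (hg : Integrable g (torusMeasure d Λ)) (n : Fin d → ℤ) :
    fc Λ (fun x => f x - g x) n = fc Λ f n - fc Λ g n := by
  rw [fc, fc, fc, fourierCoeffCell, fourierCoeffCell, fourierCoeffCell,
    ← integral_sub (integrable_character_mul _ hf) (integrable_character_mul _ hg)]
  congr 1; funext x
  push_cast; ring

lemma fc_translate (hΛ : 0 < Λ) (hf : IsPeriodic Λ f) (n : Fin d → ℤ) (z : Vec d) :
    fc Λ (fun x => f (x - z)) n = character Λ (-n) z * fc Λ f n := by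
  have h := IsPeriodic.integral_add hΛ (f := fun x => character Λ (-n) x * (f (x - z) : ℂ))
    (fun x i => by
      simp only [isPeriodic_character hΛ (-n) x i, add_sub_right_comm, hf (x - z) i]) z
  rw [fc, fourierCoeffCell, ← h, fc, fourierCoeffCell, ← integral_const_mul]
  congr 1; funext x
  rw [character_add, add_sub_cancel_right]
  ring

/-- Fubini writes the convolution as an average of translates, and a translation multiplies a
Fourier coefficient by a character. So convolution with a kernel on the whole space is a Fourier
multiplier on the torus. -/
lemma fc_sconv (hΛ : 0 < Λ) (hf : BddPeriodic Λ f) (hg : Integrable g) (n : Fin d → ℤ) :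
    fc Λ (sconv g f) n =
      (∫ z, (g z : ℂ) * Complex.exp ((inner ℝ (waveVec Λ (-n)) z : ℝ) * Complex.I)) * fc Λ f n := by
  have h := hf.integral_sconv_smul hΛ hg (integrable_character hΛ (-n))
  rw [fc, fourierCoeffCell]
  simp only [Complex.real_smul] at h
  simp_rw [mul_comm (character Λ (-n) _)]
  rw [h, ← integral_mul_const]
  congr 1; funext z
  have := fc_translate hΛ hf.periodic n z
  rw [fc, fourierCoeffCell] at this
  simp_rw [mul_comm (character Λ (-n) _)] at this
  rw [this, mul_comm (fc Λ f n), mul_assoc]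
  rfl

lemma waveVec_neg (n : Fin d → ℤ) : waveVec Λ (-n) = -waveVec Λ n := by
  ext i
  simp [waveVec, neg_div]

/-- `G_h ∗ f`. -/
noncomputable def heatS {d : ℕ} (h : ℝ) (f : Vec d → ℝ) : Vec d → ℝ := sconv (heatKernel d h) f

/-- `∂ᵢ G_h ∗ f`. -/
noncomputable def gradS {d : ℕ} (h : ℝ) (i : Fin d) (f : Vec d → ℝ) : Vec d → ℝ :=
  sconv (gradKernel d h i) f

lemma continuous_gradKernel (d : ℕ) (h : ℝ) (i : Fin d) : Continuous (gradKernel d h i) := by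
  have hc := continuous_heatKernel d h
  rw [funext (gradKernel_eq h i)]
  fun_prop

lemma BddPeriodic.heatS {h : ℝ} (hh : 0 < h) (hf : BddPeriodic Λ f) : BddPeriodic Λ (heatS h f) :=
  hf.sconv (integrable_heatKernel d hh) (continuous_heatKernel d h).measurable

lemma BddPeriodic.gradS {h : ℝ} (hh : 0 < h) (i : Fin d) (hf : BddPeriodic Λ f) :
    BddPeriodic Λ (gradS h i f) :=
  hf.sconv (integrable_gradKernel hh i) (continuous_gradKernel d h i).measurable

lemma fc_heatS (hΛ : 0 < Λ) {h : ℝ} (hh : 0 < h) (hf : BddPeriodic Λ f) (n : Fin d → ℤ) :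
    fc Λ (heatS h f) n = Real.exp (-h * ‖waveVec Λ n‖ ^ 2) * fc Λ f n := by
  rw [heatS, fc_sconv hΛ hf (integrable_heatKernel d hh), integral_heatKernel_mul_cexp hh,
    waveVec_neg, norm_neg]

lemma fc_gradS (hΛ : 0 < Λ) {h : ℝ} (hh : 0 < h) (i : Fin d) (hf : BddPeriodic Λ f)
    (n : Fin d → ℤ) :
    fc Λ (gradS h i f) n = waveVec Λ n i * Complex.I * fc Λ (heatS h f) n := by
  rw [gradS, fc_sconv hΛ hf (integrable_gradKernel hh i), integral_gradKernel_mul_cexp hh,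
    waveVec_neg, norm_neg, fc_heatS hΛ hh hf]
  simp [mul_assoc]

lemma hasSum_mul_heatS (hΛ : 0 < Λ) {h : ℝ} (hh : 0 < h) (hf : BddPeriodic Λ f) :
    HasSum (fun n => Real.exp (-h * ‖waveVec Λ n‖ ^ 2) * ‖fc Λ f n‖ ^ 2)
      (Λ ^ d * ∫ x, f x * heatS h f x ∂torusMeasure d Λ) := by
  convert hasSum_fc_mul hΛ (hf.memLp hΛ 2) ((hf.heatS hh).memLp hΛ 2) using 2 with n
  rw [fc_heatS hΛ hh hf, mul_left_comm, ← Complex.normSq_eq_conj_mul_self, ← Complex.ofReal_mul,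
    Complex.ofReal_re, Complex.normSq_eq_norm_sq]

/-- The symbol m lies in (0, 1], so m² ≤ m. This converts the quadratic form appearing in the energy
balance into a genuine norm of the smoothed increment. -/
lemma integral_heatS_sq_le (hΛ : 0 < Λ) {h : ℝ} (hh : 0 < h) (hf : BddPeriodic Λ f) :
    ∫ x, heatS h f x ^ 2 ∂torusMeasure d Λ ≤ ∫ x, f x * heatS h f x ∂torusMeasure d Λ := by
  refine le_of_mul_le_mul_left ?_ (pow_pos hΛ d)
  refine hasSum_le (fun n => ?_) (hasSum_norm_fc_sq hΛ ((hf.heatS hh).memLp hΛ 2))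
    (hasSum_mul_heatS hΛ hh hf)
  rw [fc_heatS hΛ hh hf, norm_mul, mul_pow, Complex.norm_real, Real.norm_of_nonneg (Real.exp_pos _).le]
  have : Real.exp (-h * ‖waveVec Λ n‖ ^ 2) ≤ 1 := Real.exp_le_one_iff.2 (by nlinarith [sq_nonneg ‖waveVec Λ n‖])
  have h2 := Real.exp_pos (-h * ‖waveVec Λ n‖ ^ 2)
  refine mul_le_mul_of_nonneg_right ?_ (by positivity)
  nlinarith

/-- `‖f‖² - ⟨f, G_h f⟩`. -/
noncomputable def deficit {d : ℕ} (Λ h : ℝ) (f : Vec d → ℝ) : ℝ :=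
  ∫ x, f x ^ 2 ∂torusMeasure d Λ - ∫ x, f x * heatS h f x ∂torusMeasure d Λ

lemma hasSum_deficit (hΛ : 0 < Λ) {h : ℝ} (hh : 0 < h) (hf : BddPeriodic Λ f) :
    HasSum (fun n => (1 - Real.exp (-h * ‖waveVec Λ n‖ ^ 2)) * ‖fc Λ f n‖ ^ 2)
      (Λ ^ d * deficit Λ h f) := by
  rw [deficit, mul_sub]
  simp_rw [sub_mul, one_mul]
  exact (hasSum_norm_fc_sq hΛ (hf.memLp hΛ 2)).sub (hasSum_mul_heatS hΛ hh hf)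

lemma norm_sq_eq_sum {d : ℕ} (x : Vec d) : ‖x‖ ^ 2 = ∑ i, x i ^ 2 := by
  simp [EuclideanSpace.norm_sq_eq]

/-- With y = |ξ|² the claim for one mode is h y exp(-2hy) ≤ 1 - exp(-hy). -/
lemma sum_integral_gradS_sq_le (hΛ : 0 < Λ) {h : ℝ} (hh : 0 < h) (hf : BddPeriodic Λ f) :
    ∑ i, ∫ x, gradS h i f x ^ 2 ∂torusMeasure d Λ ≤ h⁻¹ * deficit Λ h f := by
  refine le_of_mul_le_mul_left ?_ (pow_pos hΛ d)
  rw [Finset.mul_sum, mul_left_comm]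
  refine hasSum_le (fun n => ?_) (hasSum_sum fun i _ =>
    hasSum_norm_fc_sq hΛ ((hf.gradS hh i).memLp hΛ 2)) ((hasSum_deficit hΛ hh hf).mul_left _)
  simp_rw [fc_gradS hΛ hh _ hf, fc_heatS hΛ hh hf, norm_mul, mul_pow, Complex.norm_I, one_pow,
    Complex.norm_real, Real.norm_of_nonneg (Real.exp_pos _).le, Real.norm_eq_abs, sq_abs, mul_one]
  rw [← Finset.sum_mul, ← norm_sq_eq_sum, ← mul_assoc, ← mul_assoc]
  refine mul_le_mul_of_nonneg_right ?_ (by positivity)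
  set y := ‖waveVec Λ n‖ ^ 2
  have hy : 0 ≤ y := by positivity
  have h1 : Real.exp (-h * y) ≤ 1 := Real.exp_le_one_iff.2 (by nlinarith)
  have h2 := Real.exp_pos (-h * y)
  -- This is 1 + h y ≤ exp(h y), multiplied by exp(-h y).
  have h3 : h * y * Real.exp (-h * y) ≤ 1 - Real.exp (-h * y) := by
    have h4 := Real.add_one_le_exp (h * y)
    have h5 : Real.exp (h * y) * Real.exp (-h * y) = 1 := by
      rw [← Real.exp_add]; simp
    nlinarith
  rw [le_inv_mul_iff₀ hh]
  calc h * (y * Real.exp (-h * y) ^ 2) = (h * y * Real.exp (-h * y)) * Real.exp (-h * y) := by ring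
    _ ≤ (h * y * Real.exp (-h * y)) * 1 := by gcongr
    _ ≤ _ := by linarith

/-- For a symbol m in (0, 1] one has (1 - m)² ≤ 1 - m. So a small deficit forces `f` close to its
smoothing. -/
lemma integral_sub_heatS_sq_le (hΛ : 0 < Λ) {h : ℝ} (hh : 0 < h) (hf : BddPeriodic Λ f) :
    ∫ x, (f x - heatS h f x) ^ 2 ∂torusMeasure d Λ ≤ deficit Λ h f := by
  refine le_of_mul_le_mul_left ?_ (pow_pos hΛ d)
  refine hasSum_le (fun n => ?_) (hasSum_norm_fc_sq hΛ ((hf.sub (hf.heatS hh)).memLp hΛ 2))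
    (hasSum_deficit hΛ hh hf)
  rw [fc_sub (hf.integrable hΛ) ((hf.heatS hh).integrable hΛ), fc_heatS hΛ hh hf]
  set y := ‖waveVec Λ n‖ ^ 2
  have hy : 0 ≤ y := by positivity
  have h1 : Real.exp (-h * y) ≤ 1 := Real.exp_le_one_iff.2 (by nlinarith)
  have h2 := Real.exp_pos (-h * y)
  rw [show fc Λ f n - Real.exp (-h * y) * fc Λ f n = ((1 - Real.exp (-h * y) : ℝ) : ℂ) * fc Λ f n by
    push_cast; ring, norm_mul, mul_pow, Complex.norm_real, Real.norm_eq_abs, sq_abs]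
  refine mul_le_mul_of_nonneg_right ?_ (by positivity)
  nlinarith

lemma deficit_nonneg (hΛ : 0 < Λ) {h : ℝ} (hh : 0 < h) (hf : BddPeriodic Λ f) :
    0 ≤ deficit Λ h f :=
  (integral_nonneg fun _ => sq_nonneg _).trans (integral_sub_heatS_sq_le hΛ hh hf)

/-- The energy bound `‖f‖² - ⟨f, G_h f⟩ ≤ h ‖∇f‖²`, where the gradient is given by its Fourier
coefficients. -/
lemma deficit_le_of_fc (hΛ : 0 < Λ) {h : ℝ} (hh : 0 < h) (hf : BddPeriodic Λ f)
    {Df : Fin d → Vec d → ℝ} (hD : ∀ i, MemLp (Df i) 2 (torusMeasure d Λ))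
    (hfc : ∀ i n, fc Λ (Df i) n = waveVec Λ n i * Complex.I * fc Λ f n) :
    deficit Λ h f ≤ h * ∑ i, ∫ x, Df i x ^ 2 ∂torusMeasure d Λ := by
  refine le_of_mul_le_mul_left ?_ (pow_pos hΛ d)
  rw [mul_left_comm, Finset.mul_sum]
  refine hasSum_le (fun n => ?_) (hasSum_deficit hΛ hh hf)
    ((hasSum_sum fun i _ => hasSum_norm_fc_sq hΛ (hD i)).mul_left _)
  simp_rw [hfc, norm_mul, mul_pow, Complex.norm_I, one_pow, Complex.norm_real, Real.norm_eq_abs,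
    sq_abs, mul_one]
  rw [← Finset.sum_mul, ← norm_sq_eq_sum, ← mul_assoc]
  refine mul_le_mul_of_nonneg_right ?_ (by positivity)
  have := Real.add_one_le_exp (-h * ‖waveVec Λ n‖ ^ 2)
  linarith

lemma finite_waveVec_le (hΛ : 0 < Λ) (M : ℝ) :
    {n : Fin d → ℤ | ‖waveVec Λ n‖ ^ 2 ≤ M}.Finite := by
  obtain ⟨k, hk⟩ := exists_nat_ge (M * Λ ^ 2)
  refine (Set.finite_Icc (fun _ : Fin d => -(k : ℤ)) fun _ => (k : ℤ)).subset fun n hn => ?_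
  have h1 : ∀ i, (n i) ^ 2 ≤ (k : ℤ) := fun i => by
    have h2 : (waveVec Λ n i) ^ 2 ≤ M := by
      refine le_trans ?_ hn
      rw [norm_sq_eq_sum]
      exact Finset.single_le_sum (f := fun i => waveVec Λ n i ^ 2) (fun i _ => sq_nonneg _)
        (Finset.mem_univ i)
    simp only [waveVec] at h2
    rw [div_pow, div_le_iff₀ (by positivity)] at h2
    have h3 : (n i : ℝ) ^ 2 ≤ (2 * Real.pi * n i) ^ 2 := by
      rw [mul_pow]
      have : 1 ≤ (2 * Real.pi) ^ 2 := by nlinarith [Real.pi_gt_three]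
      nlinarith [sq_nonneg (n i : ℝ)]
    exact_mod_cast h3.trans (h2.trans hk)
  -- For an integer n, the bound n² ≤ k already gives |n| ≤ k.
  refine ⟨fun i => ?_, fun i => ?_⟩
  · change -(k : ℤ) ≤ n i
    nlinarith [h1 i]
  · change n i ≤ (k : ℤ)
    nlinarith [h1 i]

/-- Rellich's estimate: the `L²` distance of two functions of bounded Dirichlet energy is
controlled by finitely many Fourier modes. -/
lemma integral_sub_sq_le_of_modes (hΛ : 0 < Λ) {Df Dg : Fin d → Vec d → ℝ}
    (hf : BddPeriodic Λ f) (hg : BddPeriodic Λ g)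
    (hDf : ∀ i, MemLp (Df i) 2 (torusMeasure d Λ)) (hDg : ∀ i, MemLp (Dg i) 2 (torusMeasure d Λ))
    (hfc : ∀ i n, fc Λ (Df i) n = waveVec Λ n i * Complex.I * fc Λ f n)
    (hgc : ∀ i n, fc Λ (Dg i) n = waveVec Λ n i * Complex.I * fc Λ g n) {M : ℝ} (hM : 0 < M) :
    Λ ^ d * ∫ x, (f x - g x) ^ 2 ∂torusMeasure d Λ ≤
      ∑ n ∈ (finite_waveVec_le (d := d) hΛ M).toFinset, ‖fc Λ f n - fc Λ g n‖ ^ 2 +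
        2 / M * (Λ ^ d * ∑ i, ∫ x, Df i x ^ 2 ∂torusMeasure d Λ +
          Λ ^ d * ∑ i, ∫ x, Dg i x ^ 2 ∂torusMeasure d Λ) := by
  classical
  have key : ∀ {f : Vec d → ℝ} {Df : Fin d → Vec d → ℝ},
    (∀ i, MemLp (Df i) 2 (torusMeasure d Λ)) →
    (∀ i n, fc Λ (Df i) n = waveVec Λ n i * Complex.I * fc Λ f n) →
    HasSum (fun n => ‖waveVec Λ n‖ ^ 2 * ‖fc Λ f n‖ ^ 2)
      (Λ ^ d * ∑ i, ∫ x, Df i x ^ 2 ∂torusMeasure d Λ) := by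
    intro f Df hD hfc
    rw [Finset.mul_sum]
    convert hasSum_sum fun i _ => hasSum_norm_fc_sq hΛ (hD i) using 2 with n
    simp_rw [hfc, norm_mul, mul_pow, Complex.norm_I, one_pow, Complex.norm_real, Real.norm_eq_abs,
      sq_abs, mul_one]
    rw [← Finset.sum_mul, ← norm_sq_eq_sum]
  set S := (finite_waveVec_le (d := d) hΛ M).toFinset
  have h1 := hasSum_norm_fc_sq hΛ ((hf.sub hg).memLp hΛ 2)
  have h2 : HasSum (fun n => if n ∈ S then ‖fc Λ f n - fc Λ g n‖ ^ 2 else 0)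
      (∑ n ∈ S, ‖fc Λ f n - fc Λ g n‖ ^ 2) := by
    rw [← Finset.sum_congr rfl fun n (hn : n ∈ S) =>
      if_pos (c := n ∈ S) (t := ‖fc Λ f n - fc Λ g n‖ ^ 2) (e := 0) hn]
    exact hasSum_sum_of_ne_finset_zero fun n hn => if_neg hn
  refine hasSum_le (fun n => ?_) h1 (h2.add (((key hDf hfc).add (key hDg hgc)).mul_left (2 / M)))
  rw [fc_sub (hf.integrable hΛ) (hg.integrable hΛ)]
  by_cases hn : n ∈ S
  · rw [if_pos hn]
    exact le_add_of_nonneg_right (by positivity)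
  · rw [if_neg hn, zero_add]
    -- On the discarded modes |ξ|²/M > 1, so the coefficients are paid for by the Dirichlet
    -- energies.
    have hn' : M < ‖waveVec Λ n‖ ^ 2 := by
      simpa [S] using hn
    have h3 : ‖fc Λ f n - fc Λ g n‖ ^ 2 ≤ 2 * (‖fc Λ f n‖ ^ 2 + ‖fc Λ g n‖ ^ 2) := by
      have := norm_sub_le (fc Λ f n) (fc Λ g n)
      nlinarith [norm_nonneg (fc Λ f n - fc Λ g n), sq_nonneg (‖fc Λ f n‖ - ‖fc Λ g n‖)]
    rw [div_mul_eq_mul_div, le_div_iff₀ hM, ← mul_add]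
    calc _ ≤ 2 * (‖fc Λ f n‖ ^ 2 + ‖fc Λ g n‖ ^ 2) * ‖waveVec Λ n‖ ^ 2 := by gcongr
      _ = _ := by ring

end HMHF

namespace HMHF

/-! ### Real trigonometric functions -/

section Trig

variable {d : ℕ} {Λ : ℝ} {f g : Vec d → ℝ}

/-- `cos (ξ_n · x)`. -/
noncomputable def cosW (Λ : ℝ) (n : Fin d → ℤ) (x : Vec d) : ℝ := Real.cos (inner ℝ (waveVec Λ n) x)

/-- `sin (ξ_n · x)`. -/
noncomputable def sinW (Λ : ℝ) (n : Fin d → ℤ) (x : Vec d) : ℝ := Real.sin (inner ℝ (waveVec Λ n) x)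

lemma character_neg_eq (n : Fin d → ℤ) (x : Vec d) :
    character Λ (-n) x = cosW Λ n x - Complex.I * sinW Λ n x := by
  rw [character, Complex.exp_mul_I, waveVec_neg, inner_neg_left, ← Complex.ofReal_cos,
    ← Complex.ofReal_sin, Real.cos_neg, Real.sin_neg, cosW, sinW]
  push_cast
  ring

lemma character_eq (n : Fin d → ℤ) (x : Vec d) :
    character Λ n x = cosW Λ n x + Complex.I * sinW Λ n x := by
  rw [character, Complex.exp_mul_I, ← Complex.ofReal_cos, ← Complex.ofReal_sin, cosW, sinW]
  ring

lemma cosW_eq_re (n : Fin d → ℤ) (x : Vec d) : cosW Λ n x = (character Λ n x).re := by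
  simp [character_eq]

lemma sinW_eq_im (n : Fin d → ℤ) (x : Vec d) : sinW Λ n x = (character Λ n x).im := by
  simp [character_eq]

lemma contDiff_cosW (n : Fin d → ℤ) : ContDiff ℝ ∞ (cosW Λ n : Vec d → ℝ) :=
  Real.contDiff_cos.comp (innerSL ℝ (waveVec Λ n)).contDiff

lemma contDiff_sinW (n : Fin d → ℤ) : ContDiff ℝ ∞ (sinW Λ n : Vec d → ℝ) :=
  Real.contDiff_sin.comp (innerSL ℝ (waveVec Λ n)).contDiff

lemma bddPeriodic_cosW (hΛ : 0 < Λ) (n : Fin d → ℤ) : BddPeriodic Λ (cosW Λ n) :=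
  ⟨(contDiff_cosW n).continuous.measurable,
    fun x i => by simp only [cosW_eq_re, isPeriodic_character hΛ n x i], 1,
    fun _ => Real.abs_cos_le_one _⟩

lemma bddPeriodic_sinW (hΛ : 0 < Λ) (n : Fin d → ℤ) : BddPeriodic Λ (sinW Λ n) :=
  ⟨(contDiff_sinW n).continuous.measurable,
    fun x i => by simp only [sinW_eq_im, isPeriodic_character hΛ n x i], 1,
    fun _ => Real.abs_sin_le_one _⟩

lemma hasFDerivAt_cosW (n : Fin d → ℤ) (x : Vec d) :
    HasFDerivAt (cosW Λ n) (-sinW Λ n x • innerSL ℝ (waveVec Λ n)) x :=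
  (innerSL ℝ (waveVec Λ n)).hasFDerivAt.cos

lemma hasFDerivAt_sinW (n : Fin d → ℤ) (x : Vec d) :
    HasFDerivAt (sinW Λ n) (cosW Λ n x • innerSL ℝ (waveVec Λ n)) x :=
  (innerSL ℝ (waveVec Λ n)).hasFDerivAt.sin

lemma fderiv_cosW (n : Fin d → ℤ) (x : Vec d) (i : Fin d) :
    fderiv ℝ (cosW Λ n) x (EuclideanSpace.single i 1) = -(waveVec Λ n i * sinW Λ n x) := by
  rw [(hasFDerivAt_cosW n x).fderiv]
  simp [EuclideanSpace.inner_single_right, mul_comm]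

lemma fderiv_sinW (n : Fin d → ℤ) (x : Vec d) (i : Fin d) :
    fderiv ℝ (sinW Λ n) x (EuclideanSpace.single i 1) = waveVec Λ n i * cosW Λ n x := by
  rw [(hasFDerivAt_sinW n x).fderiv]
  simp [EuclideanSpace.inner_single_right, mul_comm]

lemma BddPeriodic.integrable_mul {p : Vec d → ℝ} (hp : BddPeriodic Λ p)
    (hf : Integrable f (torusMeasure d Λ)) :
    Integrable (fun x => p x * f x) (torusMeasure d Λ) := by
  obtain ⟨C, hC⟩ := hp.bounded
  exact hf.bdd_mul hp.measurable.aestronglyMeasurable (Eventually.of_forall hC)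

lemma fc_eq (hΛ : 0 < Λ) (hf : Integrable f (torusMeasure d Λ)) (n : Fin d → ℤ) :
    fc Λ f n = ((∫ x, cosW Λ n x * f x ∂torusMeasure d Λ : ℝ) : ℂ) -
      Complex.I * ((∫ x, sinW Λ n x * f x ∂torusMeasure d Λ : ℝ) : ℂ) := by
  rw [← integral_complex_ofReal, ← integral_complex_ofReal, ← integral_const_mul,
    ← integral_sub ((bddPeriodic_cosW hΛ n).integrable_mul hf).ofReal
      (((bddPeriodic_sinW hΛ n).integrable_mul hf).ofReal.const_mul _), fc, fourierCoeffCell]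
  congr 1; funext x
  rw [character_neg_eq]
  push_cast
  ring

/-- The real and imaginary parts of the character are cosine and sine, so the two real integrations
by parts combine into the complex multiplier identity. -/
lemma fc_of_weak (hΛ : 0 < Λ) {w : Vec d → ℝ} {i : Fin d} (hf : Integrable f (torusMeasure d Λ))
    (hw : Integrable w (torusMeasure d Λ)) {n : Fin d → ℤ}
    (hc : ∫ x, -(waveVec Λ n i * sinW Λ n x) * f x ∂torusMeasure d Λ =
      -∫ x, cosW Λ n x * w x ∂torusMeasure d Λ)
    (hs : ∫ x, waveVec Λ n i * cosW Λ n x * f x ∂torusMeasure d Λ =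
      -∫ x, sinW Λ n x * w x ∂torusMeasure d Λ) :
    fc Λ w n = waveVec Λ n i * Complex.I * fc Λ f n := by
  simp_rw [neg_mul, integral_neg, mul_assoc, integral_const_mul, neg_inj] at hc
  simp_rw [mul_assoc, integral_const_mul] at hs
  have hs' := neg_eq_iff_eq_neg.2 hs
  rw [fc_eq hΛ hf, fc_eq hΛ hw, ← hc, ← hs']
  push_cast
  linear_combination ((waveVec Λ n i : ℂ) *
    ((∫ x, sinW Λ n x * f x ∂torusMeasure d Λ : ℝ) : ℂ)) * Complex.I_sq

end Trig

/-! ### Vector-valued maps, the scheme and its energy -/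

section Components

variable {d N : ℕ}

lemma integral_apply {X : Type} [MeasurableSpace X] {μ : Measure X} {f : X → Vec N}
    (hf : Integrable f μ) (a : Fin N) : (∫ x, f x ∂μ) a = ∫ x, f x a ∂μ :=
  ((EuclideanSpace.proj (𝕜 := ℝ) a).integral_comp_comm hf).symm

lemma memLp_apply {X : Type} [MeasurableSpace X] {μ : Measure X} {f : X → Vec N} {p : ENNReal}
    (hf : MemLp f p μ) (a : Fin N) : MemLp (fun x => f x a) p μ :=
  (EuclideanSpace.proj (𝕜 := ℝ) a).comp_memLp' hf

lemma memLp_vec {X : Type} [MeasurableSpace X] {μ : Measure X} {f : X → Vec N} {p : ENNReal}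
    (hf : ∀ a, MemLp (fun x => f x a) p μ) : MemLp f p μ := by
  have : f = fun x => ∑ a, f x a • (EuclideanSpace.single a (1 : ℝ) : Vec N) := by
    funext x
    ext b
    simp [Finset.sum_apply, Pi.single_apply]
  rw [this]
  refine memLp_finsetSum _ fun a _ => ?_
  exact (ContinuousLinearMap.smulRight (1 : ℝ →L[ℝ] ℝ)
    (EuclideanSpace.single a (1 : ℝ) : Vec N)).comp_memLp' (hf a)

/-- Cosines and sines of the wave vectors are smooth and periodic, hence admissible in the
definition of the weak derivative. This is how the hypothesis on the initial map enters the Fourier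
side. -/
lemma fc_weakPartial {Λ : ℝ} (hΛ : 0 < Λ) {i : Fin d} {u w : Vec d → Vec N}
    (hu : MemLp u 2 (torusMeasure d Λ)) (hw : MemLp w 2 (torusMeasure d Λ))
    (h : HasWeakPartial Λ i u w) (a : Fin N) (n : Fin d → ℤ) :
    fc Λ (fun x => w x a) n = waveVec Λ n i * Complex.I * fc Λ (fun x => u x a) n := by
  have := isFiniteMeasure_torusMeasure d hΛ
  have hui := hu.integrable one_le_two
  have hwi := hw.integrable one_le_two
  have hsm : ∀ {p : Vec d → ℝ} {f : Vec d → Vec N}, BddPeriodic Λ p →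
      Integrable f (torusMeasure d Λ) → Integrable (fun x => p x • f x) (torusMeasure d Λ) := by
    intro p f hp hf
    obtain ⟨C, hC⟩ := hp.bounded
    exact hf.bdd_smul C hp.measurable.aestronglyMeasurable (Eventually.of_forall hC)
  have key : ∀ (φ φ' : Vec d → ℝ), ContDiff ℝ ∞ φ → BddPeriodic Λ φ → BddPeriodic Λ φ' →
      (∀ x, fderiv ℝ φ x (EuclideanSpace.single i 1) = φ' x) →
      ∫ x, φ' x * u x a ∂torusMeasure d Λ = -∫ x, φ x * w x a ∂torusMeasure d Λ := by
    intro φ φ' hφ hb hb' hd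
    have h1 := congrArg (fun v : Vec N => v a) (h φ hφ hb.periodic)
    simp_rw [hd] at h1
    simp only [PiLp.neg_apply] at h1
    rw [integral_apply (hsm hb' hui), integral_apply (hsm hb hwi)] at h1
    simpa using h1
  refine fc_of_weak hΛ (memLp_one_iff_integrable.1 (memLp_apply (memLp_one_iff_integrable.2 hui) a))
    (memLp_one_iff_integrable.1 (memLp_apply (memLp_one_iff_integrable.2 hwi) a)) ?_ ?_
  · exact key _ _ (contDiff_cosW n) (bddPeriodic_cosW hΛ n)
      (((BddPeriodic.const _).mul (bddPeriodic_sinW hΛ n)).neg) (fun x => fderiv_cosW n x i)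
  · exact key _ _ (contDiff_sinW n) (bddPeriodic_sinW hΛ n)
      ((BddPeriodic.const _).mul (bddPeriodic_cosW hΛ n)) (fun x => fderiv_sinW n x i)

/-! ### Maps into the unit ball and the scheme -/

/-- Borel maps from the torus to the closed unit ball. -/
structure BallMap (Λ : ℝ) (u : Vec d → Vec N) : Prop where
  measurable : Measurable u
  periodic : IsPeriodic Λ u
  norm_le : ∀ x, ‖u x‖ ≤ 1

variable {Λ : ℝ} {u : Vec d → Vec N}

lemma BallMap.abs_apply_le (hu : BallMap Λ u) (a : Fin N) (x : Vec d) : |u x a| ≤ 1 :=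
  (abs_apply_le_norm _ a).trans (hu.norm_le x)

lemma BallMap.bddPeriodic (hu : BallMap Λ u) (a : Fin N) : BddPeriodic Λ fun x => u x a :=
  ⟨(EuclideanSpace.proj (𝕜 := ℝ) a).continuous.measurable.comp hu.measurable,
    fun x i => by rw [hu.periodic], 1, hu.abs_apply_le a⟩

lemma BallMap.integrable_smul_kernel (hu : BallMap Λ u) {g : Vec d → ℝ} (hg : Integrable g)
    (x : Vec d) : Integrable fun z => g z • u (x - z) :=
  hg.smul_bdd 1 (hu.measurable.comp (measurable_id.const_sub x)).aestronglyMeasurable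
    (Eventually.of_forall fun _ => hu.norm_le _)

lemma heatConv_apply (hu : BallMap Λ u) {h : ℝ} (hh : 0 < h) (x : Vec d) (a : Fin N) :
    heatConv h u x a = heatS h (fun y => u y a) x := by
  rw [heatConv, convolution_def]
  simp only [ContinuousLinearMap.lsmul_apply]
  rw [integral_apply (hu.integrable_smul_kernel (integrable_heatKernel d hh) x)]
  rfl

lemma gradHeatConv_apply (hu : BallMap Λ u) {h : ℝ} (hh : 0 < h) (i : Fin d) (x : Vec d)
    (a : Fin N) : gradHeatConv h i u x a = gradS h i (fun y => u y a) x := by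
  rw [gradHeatConv, convolution_def]
  simp only [ContinuousLinearMap.lsmul_apply]
  exact integral_apply (hu.integrable_smul_kernel (integrable_gradKernel hh i) x) a

lemma measurable_vec {X : Type} [MeasurableSpace X] {f : X → Vec N}
    (hf : ∀ a, Measurable fun x => f x a) : Measurable f :=
  (PiLp.continuous_toLp 2 (fun _ : Fin N => ℝ)).measurable.comp (measurable_pi_lambda _ hf)

lemma measurable_heatConv (hu : BallMap Λ u) {h : ℝ} (hh : 0 < h) : Measurable (heatConv h u) :=
  measurable_vec fun a => by
    simp_rw [heatConv_apply hu hh]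
    exact ((hu.bddPeriodic a).heatS hh).measurable

/-- One step of the scheme. -/
noncomputable def thresholdStep (h : ℝ) (u : Vec d → Vec N) (x : Vec d) : Vec N :=
  ‖heatConv h u x‖⁻¹ • heatConv h u x

lemma norm_inv_smul_le_one (v : Vec N) : ‖‖v‖⁻¹ • v‖ ≤ 1 := by
  rw [norm_smul, norm_inv, norm_norm]
  exact inv_mul_le_one

/-- Since the inverse of zero is zero, the bound by 1 needs no information on the zeros of the
convolution. The proof never requires the later iterates to have length exactly one: the energy
controls the defect. -/
lemma BallMap.thresholdStep (hu : BallMap Λ u) {h : ℝ} (hh : 0 < h) :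
    BallMap Λ (thresholdStep h u) := by
  have hm := measurable_heatConv hu hh
  refine ⟨hm.norm.inv.smul hm, fun x i => ?_, fun x => norm_inv_smul_le_one _⟩
  have : heatConv h u (x + EuclideanSpace.single i Λ) = heatConv h u x := by
    ext a
    rw [heatConv_apply hu hh, heatConv_apply hu hh, ((hu.bddPeriodic a).heatS hh).periodic]
  rw [HMHF.thresholdStep, this, HMHF.thresholdStep]

lemma iterate_succ (h : ℝ) (u0 : Vec d → Vec N) (n : ℕ) :
    iterate h u0 (n + 1) = thresholdStep h (iterate h u0 n) := rfl

lemma BallMap.iterate (hu : BallMap Λ u) {h : ℝ} (hh : 0 < h) (n : ℕ) :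
    BallMap Λ (iterate h u n) := by
  induction n with
  | zero => exact hu
  | succ n ih => rw [iterate_succ]; exact ih.thresholdStep hh

/-! ### The energy estimate -/

/-- Self-adjointness of the heat operator: its symbol is real. -/
lemma integral_mul_heatS_comm (hΛ : 0 < Λ) {h : ℝ} (hh : 0 < h) {f g : Vec d → ℝ}
    (hf : BddPeriodic Λ f) (hg : BddPeriodic Λ g) :
    ∫ x, f x * heatS h g x ∂torusMeasure d Λ = ∫ x, g x * heatS h f x ∂torusMeasure d Λ := by
  refine mul_left_cancel₀ (pow_pos hΛ d).ne' ?_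
  refine (hasSum_fc_mul hΛ (hf.memLp hΛ 2) ((hg.heatS hh).memLp hΛ 2)).unique ?_
  convert hasSum_fc_mul hΛ (hg.memLp hΛ 2) ((hf.heatS hh).memLp hΛ 2) using 2 with n
  rw [fc_heatS hΛ hh hf, fc_heatS hΛ hh hg, ← Complex.conj_re]
  congr 1
  simp only [map_mul, Complex.conj_conj, Complex.conj_ofReal]
  ring

lemma heatS_sub {h : ℝ} (hh : 0 < h) {f g : Vec d → ℝ} (hf : BddPeriodic Λ f)
    (hg : BddPeriodic Λ g) (x : Vec d) :
    heatS h (fun y => f y - g y) x = heatS h f x - heatS h g x := by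
  simp only [heatS, sconv]
  rw [← integral_sub (hf.integrable_mul_kernel (integrable_heatKernel d hh) x)
    (hg.integrable_mul_kernel (integrable_heatKernel d hh) x)]
  simp_rw [mul_sub]

lemma integral_sub_mul_heatS_sub (hΛ : 0 < Λ) {h : ℝ} (hh : 0 < h) {f g : Vec d → ℝ}
    (hf : BddPeriodic Λ f) (hg : BddPeriodic Λ g) :
    ∫ x, (f x - g x) * heatS h (fun y => f y - g y) x ∂torusMeasure d Λ =
      ∫ x, f x * heatS h f x ∂torusMeasure d Λ - 2 * ∫ x, f x * heatS h g x ∂torusMeasure d Λ +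
        ∫ x, g x * heatS h g x ∂torusMeasure d Λ := by
  have h1 := (hf.mul (hf.heatS hh)).integrable hΛ
  have h2 := (hf.mul (hg.heatS hh)).integrable hΛ
  have h3 := (hg.mul (hf.heatS hh)).integrable hΛ
  have h4 := (hg.mul (hg.heatS hh)).integrable hΛ
  have e : ∀ x, (f x - g x) * heatS h (fun y => f y - g y) x =
      f x * heatS h f x - f x * heatS h g x - g x * heatS h f x + g x * heatS h g x := fun x => by
    rw [heatS_sub hh hf hg]; ring
  simp_rw [e]
  have h12 : Integrable (fun x => f x * heatS h f x - f x * heatS h g x) (torusMeasure d Λ) :=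
    h1.sub h2
  have h123 : Integrable (fun x => f x * heatS h f x - f x * heatS h g x - g x * heatS h f x)
    (torusMeasure d Λ) := h12.sub h3
  rw [integral_add h123 h4, integral_sub h12 h3, integral_sub h1 h2,
    integral_mul_heatS_comm hΛ hh hg hf]
  ring

/-- The thresholding energy `|cell| - ⟨u, G_h u⟩`. -/
noncomputable def energy (Λ h : ℝ) (u : Vec d → Vec N) : ℝ :=
  (torusMeasure d Λ).real Set.univ - ∑ a, ∫ x, u x a * heatS h (fun y => u y a) x ∂torusMeasure d Λ

/-- Expanding ⟨u' - u, G (u' - u)⟩ by self-adjointness gives ⟨u', G u'⟩ - 2⟨u', G u⟩ + ⟨u, G u⟩. The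
new map u' maximises ⟨·, G u⟩, so the middle term is at most -2⟨u, G u⟩, and the left side dominates
the squared norm of the smoothed increment. -/
lemma energy_thresholdStep (hΛ : 0 < Λ) {h : ℝ} (hh : 0 < h) (hu : BallMap Λ u) :
    energy Λ h (thresholdStep h u) +
      ∑ a, ∫ x, heatS h (fun y => thresholdStep h u y a - u y a) x ^ 2 ∂torusMeasure d Λ ≤
        energy Λ h u := by
  have hu' := hu.thresholdStep hh
  have h1 : ∑ a, ∫ x, heatS h (fun y => thresholdStep h u y a - u y a) x ^ 2 ∂torusMeasure d Λ ≤
      ∑ a, (∫ x, thresholdStep h u x a * heatS h (fun y => thresholdStep h u y a) x ∂torusMeasure d Λ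
        - 2 * ∫ x, thresholdStep h u x a * heatS h (fun y => u y a) x ∂torusMeasure d Λ +
        ∫ x, u x a * heatS h (fun y => u y a) x ∂torusMeasure d Λ) :=
    Finset.sum_le_sum fun a _ => by
      rw [← integral_sub_mul_heatS_sub hΛ hh (hu'.bddPeriodic a) (hu.bddPeriodic a)]
      exact integral_heatS_sq_le hΛ hh ((hu'.bddPeriodic a).sub (hu.bddPeriodic a))
  rw [Finset.sum_add_distrib, Finset.sum_sub_distrib, ← Finset.mul_sum] at h1
  have h2 : ∑ a, ∫ x, u x a * heatS h (fun y => u y a) x ∂torusMeasure d Λ ≤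
      ∑ a, ∫ x, thresholdStep h u x a * heatS h (fun y => u y a) x ∂torusMeasure d Λ := by
    rw [← integral_finsetSum _ fun a _ => ((hu.bddPeriodic a).mul
        ((hu.bddPeriodic a).heatS hh)).integrable hΛ,
      ← integral_finsetSum _ fun a _ => ((hu'.bddPeriodic a).mul
        ((hu.bddPeriodic a).heatS hh)).integrable hΛ]
    refine integral_mono (integrable_finsetSum _ fun a _ => ((hu.bddPeriodic a).mul
        ((hu.bddPeriodic a).heatS hh)).integrable hΛ)
      (integrable_finsetSum _ fun a _ => ((hu'.bddPeriodic a).mul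
        ((hu.bddPeriodic a).heatS hh)).integrable hΛ) fun x => ?_
    simp_rw [← heatConv_apply hu hh]
    have e : ∀ w : Vec N, ∑ a, w a * heatConv h u x a = inner ℝ w (heatConv h u x) := fun w => by
      simp [PiLp.inner_apply, mul_comm]
    rw [e, e, thresholdStep, inner_smul_left, real_inner_self_eq_norm_sq]
    refine (real_inner_le_norm _ _).trans ?_
    refine (mul_le_of_le_one_left (norm_nonneg _) (hu.norm_le x)).trans ?_
    rw [conj_trivial, pow_two, ← mul_assoc]
    -- Where the convolution vanishes both sides are zero, so the convention for normalising 0 does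
    -- no harm.
    by_cases h0 : ‖heatConv h u x‖ = 0
    · simp [h0]
    · rw [inv_mul_cancel₀ h0, one_mul]
  simp only [energy]
  linarith

lemma sum_deficit_eq (hΛ : 0 < Λ) (h : ℝ) (hu : BallMap Λ u) :
    ∑ a, deficit Λ h (fun x => u x a) = ∫ x, ‖u x‖ ^ 2 ∂torusMeasure d Λ -
      ∑ a, ∫ x, u x a * heatS h (fun y => u y a) x ∂torusMeasure d Λ := by
  simp_rw [deficit, Finset.sum_sub_distrib, norm_sq_eq_sum]
  rw [integral_finsetSum]
  intro a _
  simpa only [pow_two] using ((hu.bddPeriodic a).mul (hu.bddPeriodic a)).integrable hΛ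

lemma BallMap.integrable_norm_sq (hΛ : 0 < Λ) (hu : BallMap Λ u) :
    Integrable (fun x => ‖u x‖ ^ 2) (torusMeasure d Λ) := by
  have := isFiniteMeasure_torusMeasure d hΛ
  refine Integrable.of_bound (hu.measurable.norm.pow_const 2).aestronglyMeasurable 1
    (Eventually.of_forall fun x => ?_)
  rw [Real.norm_of_nonneg (by positivity)]
  exact pow_le_one₀ (norm_nonneg _) (hu.norm_le x)

lemma integral_norm_sq_le (hΛ : 0 < Λ) (hu : BallMap Λ u) :
    ∫ x, ‖u x‖ ^ 2 ∂torusMeasure d Λ ≤ (torusMeasure d Λ).real Set.univ := by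
  have := isFiniteMeasure_torusMeasure d hΛ
  calc ∫ x, ‖u x‖ ^ 2 ∂torusMeasure d Λ ≤ ∫ _, (1 : ℝ) ∂torusMeasure d Λ :=
        integral_mono (hu.integrable_norm_sq hΛ) (integrable_const _)
          fun x => pow_le_one₀ (norm_nonneg _) (hu.norm_le x)
    _ = _ := by simp

/-- By `sum_deficit_eq` the energy is the total deficit plus `|cell| - ∫ ‖u‖²`, and both parts are
nonnegative on ball maps. Here the second part is dropped, in `sub_integral_norm_sq_le_energy` the
first. -/
lemma sum_deficit_le_energy (hΛ : 0 < Λ) (h : ℝ) (hu : BallMap Λ u) :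
    ∑ a, deficit Λ h (fun x => u x a) ≤ energy Λ h u := by
  rw [sum_deficit_eq hΛ h hu, energy]
  linarith [integral_norm_sq_le hΛ hu]

lemma sub_integral_norm_sq_le_energy (hΛ : 0 < Λ) {h : ℝ} (hh : 0 < h) (hu : BallMap Λ u) :
    (torusMeasure d Λ).real Set.univ - ∫ x, ‖u x‖ ^ 2 ∂torusMeasure d Λ ≤ energy Λ h u := by
  have h1 : 0 ≤ ∑ a, deficit Λ h (fun x => u x a) :=
    Finset.sum_nonneg fun a _ => deficit_nonneg hΛ hh (hu.bddPeriodic a)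
  rw [sum_deficit_eq hΛ h hu] at h1
  rw [energy]
  linarith

lemma energy_nonneg (hΛ : 0 < Λ) {h : ℝ} (hh : 0 < h) (hu : BallMap Λ u) : 0 ≤ energy Λ h u :=
  (Finset.sum_nonneg fun a _ => deficit_nonneg hΛ hh (hu.bddPeriodic a)).trans
    (sum_deficit_le_energy hΛ h hu)

/-- The one-step inequality telescopes. -/
lemma energy_iterate_add (hΛ : 0 < Λ) {h : ℝ} (hh : 0 < h) (hu : BallMap Λ u) (n : ℕ) :
    energy Λ h (iterate h u n) + ∑ j ∈ Finset.range n, ∑ a,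
      ∫ x, heatS h (fun y => iterate h u (j + 1) y a - iterate h u j y a) x ^ 2 ∂torusMeasure d Λ ≤
        energy Λ h u := by
  induction n with
  | zero => simp [iterate]
  | succ n ih =>
    rw [Finset.sum_range_succ]
    have := energy_thresholdStep hΛ hh (hu.iterate hh n)
    rw [iterate_succ h u n]
    linarith

/-- Unit length makes the energy equal to the total deficit, which is bounded by the Dirichlet
integral through 1 - exp(-y) ≤ y. The factor `h` is what makes all later bounds uniform. -/
lemma energy_initial_le (hΛ : 0 < Λ) {h : ℝ} (hh : 0 < h) (hu : BallMap Λ u)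
    (hu1 : ∀ᵐ x ∂torusMeasure d Λ, ‖u x‖ = 1) {Du : Fin d → Vec d → Vec N}
    (hD : ∀ i, MemLp (Du i) 2 (torusMeasure d Λ) ∧ HasWeakPartial Λ i u (Du i)) :
    energy Λ h u ≤ h * ∑ a, ∑ i, ∫ x, Du i x a ^ 2 ∂torusMeasure d Λ := by
  have := isFiniteMeasure_torusMeasure d hΛ
  have h1 : energy Λ h u = ∑ a, deficit Λ h (fun x => u x a) := by
    rw [sum_deficit_eq hΛ h hu, energy]
    congr 1
    rw [integral_congr_ae (g := fun _ => (1 : ℝ)) (hu1.mono fun x hx => by simp [hx])]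
    simp
  rw [h1, Finset.mul_sum]
  refine Finset.sum_le_sum fun a _ => ?_
  have hu2 : MemLp u 2 (torusMeasure d Λ) := memLp_vec fun a => (hu.bddPeriodic a).memLp hΛ 2
  exact deficit_le_of_fc hΛ hh (hu.bddPeriodic a) (fun i => memLp_apply (hD i).1 a)
    fun i n => fc_weakPartial hΛ hu2 (hD i).1 (hD i).2 a n

end Components

end HMHF

namespace HMHF

section Correlation

variable {d : ℕ} {Λ : ℝ} {f g p q : Vec d → ℝ}

/-! ### Correlations on the torus -/

/-- The correlation `∫ f(x - z) p(x) dx`. -/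
noncomputable def corr (Λ : ℝ) (f p : Vec d → ℝ) (z : Vec d) : ℝ :=
  ∫ x, f (x - z) * p x ∂torusMeasure d Λ

/-- A translation of the integration variable. Reflecting `z` exchanges the two functions, which is
the source of the symmetrisation in the commutator estimate. -/
lemma corr_neg (hΛ : 0 < Λ) (hf : BddPeriodic Λ f) (hp : BddPeriodic Λ p) (z : Vec d) :
    corr Λ f p (-z) = corr Λ p f z := by
  rw [corr, ← IsPeriodic.integral_add hΛ ((hf.comp_sub (-z)).mul hp).periodic (-z), corr]
  congr 1; funext x
  rw [sub_neg_eq_add, add_assoc, neg_add_cancel, add_zero, mul_comm, sub_eq_add_neg]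

lemma abs_integral_le (hΛ : 0 < Λ) {C : ℝ} {k : Vec d → ℝ} (hk : ∀ x, |k x| ≤ C) :
    |∫ x, k x ∂torusMeasure d Λ| ≤ C * (torusMeasure d Λ).real Set.univ := by
  have := isFiniteMeasure_torusMeasure d hΛ
  exact norm_integral_le_of_norm_le_const (f := k) (Eventually.of_forall hk)

lemma integral_sconv_mul (hΛ : 0 < Λ) (hf : BddPeriodic Λ f) (hg : Integrable g)
    (hp : BddPeriodic Λ p) :
    ∫ x, p x * sconv g f x ∂torusMeasure d Λ = ∫ z, g z * corr Λ f p z := by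
  have := hf.integral_sconv_smul hΛ hg (hp.integrable hΛ)
  simp only [smul_eq_mul] at this
  simp_rw [mul_comm (p _), this]
  rfl

lemma measurable_corr (hΛ : 0 < Λ) (hf : BddPeriodic Λ f) (hp : BddPeriodic Λ p) :
    Measurable (corr Λ f p) := by
  have := isFiniteMeasure_torusMeasure d hΛ
  have : Measurable fun q : Vec d × Vec d => f (q.2 - q.1) * p q.2 :=
    (hf.measurable.comp (measurable_snd.sub measurable_fst)).mul (hp.measurable.comp measurable_snd)
  exact this.stronglyMeasurable.integral_prod_right.measurable

lemma integrable_mul_corr (hΛ : 0 < Λ) (hf : BddPeriodic Λ f) (hg : Integrable g)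
    (hp : BddPeriodic Λ p) : Integrable fun z => g z * corr Λ f p z := by
  obtain ⟨C, hC⟩ := hf.bounded
  obtain ⟨C', hC'⟩ := hp.bounded
  refine hg.mul_bdd (c := C * C' * (torusMeasure d Λ).real Set.univ)
    (measurable_corr hΛ hf hp).aestronglyMeasurable
    (Eventually.of_forall fun z => abs_integral_le hΛ fun x => ?_)
  rw [abs_mul]
  exact mul_le_mul (hC _) (hC' x) (abs_nonneg _) ((abs_nonneg _).trans (hC x))

/-- Expresses increments by correlations; after integration against the heat kernel these become
twice the deficit. -/
lemma integral_sub_translate_sq (hΛ : 0 < Λ) (hf : BddPeriodic Λ f) (z : Vec d) :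
    ∫ x, (f x - f (x - z)) ^ 2 ∂torusMeasure d Λ =
      2 * ∫ x, f x ^ 2 ∂torusMeasure d Λ - 2 * corr Λ f f z := by
  have h2 : BddPeriodic Λ fun x => f x ^ 2 := by simpa only [pow_two] using hf.mul hf
  have e1 : ∫ x, f (x - z) ^ 2 ∂torusMeasure d Λ = ∫ x, f x ^ 2 ∂torusMeasure d Λ := by
    simpa only [← sub_eq_add_neg] using IsPeriodic.integral_add hΛ h2.periodic (-z)
  have e : ∀ x, (f x - f (x - z)) ^ 2 = f x ^ 2 + f (x - z) ^ 2 - 2 * (f (x - z) * f x) :=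
    fun x => by ring
  simp_rw [e]
  rw [integral_sub ((h2.add (h2.comp_sub z)).integrable hΛ)
    (((hf.comp_sub z).mul hf).integrable hΛ |>.const_mul 2),
    integral_add (h2.integrable hΛ) ((h2.comp_sub z).integrable hΛ), e1, integral_const_mul, corr]
  ring

end Correlation

/-! ### Test functions with a first order Taylor expansion -/

/-- Bounded periodic functions `φ` with bounded gradient `Dφ` such that the Taylor expansion of
first order has a quadratic error. -/
structure Tame {d : ℕ} (Λ C : ℝ) (φ : Vec d → ℝ) (Dφ : Fin d → Vec d → ℝ) : Prop where
  measurable : Measurable φ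
  periodic : IsPeriodic Λ φ
  bound : ∀ x, |φ x| ≤ C
  measurable_grad : ∀ i, Measurable (Dφ i)
  periodic_grad : ∀ i, IsPeriodic Λ (Dφ i)
  bound_grad : ∀ i x, |Dφ i x| ≤ C
  lipschitz : ∀ x z, |φ (x + z) - φ x| ≤ C * ‖z‖
  taylor : ∀ x z, |φ (x + z) - φ x - ∑ i, z i * Dφ i x| ≤ C * ‖z‖ ^ 2

namespace Tame

variable {d : ℕ} {Λ C C' : ℝ} {φ ψ : Vec d → ℝ} {Dφ Dψ : Fin d → Vec d → ℝ}

lemma nonneg (h : Tame Λ C φ Dφ) : 0 ≤ C := (abs_nonneg _).trans (h.bound 0)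

lemma bddPeriodic (h : Tame Λ C φ Dφ) : BddPeriodic Λ φ := ⟨h.measurable, h.periodic, C, h.bound⟩

lemma bddPeriodic_grad (h : Tame Λ C φ Dφ) (i : Fin d) : BddPeriodic Λ (Dφ i) :=
  ⟨h.measurable_grad i, h.periodic_grad i, C, h.bound_grad i⟩

/-- Closure under products is what allows test functions of the form φ times a truncated Fourier
series. -/
lemma mul (h : Tame Λ C φ Dφ) (h' : Tame Λ C' ψ Dψ) :
    Tame Λ (3 * C * C') (fun x => φ x * ψ x) (fun i x => Dφ i x * ψ x + φ x * Dψ i x) := by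
  have hC := h.nonneg
  have hC' := h'.nonneg
  have hCC : 0 ≤ C * C' := mul_nonneg hC hC'
  refine ⟨h.measurable.mul h'.measurable, (h.bddPeriodic.mul h'.bddPeriodic).periodic, fun x => ?_,
    fun i => ((h.measurable_grad i).mul h'.measurable).add (h.measurable.mul (h'.measurable_grad i)),
    fun i => (((h.bddPeriodic_grad i).mul h'.bddPeriodic).add
      (h.bddPeriodic.mul (h'.bddPeriodic_grad i))).periodic, fun i x => ?_, fun x z => ?_,
    fun x z => ?_⟩
  · rw [abs_mul]
    nlinarith [mul_le_mul (h.bound x) (h'.bound x) (abs_nonneg _) hC]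
  · refine (abs_add_le _ _).trans ?_
    rw [abs_mul, abs_mul]
    nlinarith [mul_le_mul (h.bound_grad i x) (h'.bound x) (abs_nonneg _) hC,
      mul_le_mul (h.bound x) (h'.bound_grad i x) (abs_nonneg _) hC]
  · have e : φ (x + z) * ψ (x + z) - φ x * ψ x =
        (φ (x + z) - φ x) * ψ (x + z) + φ x * (ψ (x + z) - ψ x) := by ring
    rw [e]
    refine (abs_add_le _ _).trans ?_
    rw [abs_mul, abs_mul]
    have h1 := mul_le_mul (h.lipschitz x z) (h'.bound (x + z)) (abs_nonneg _)
      (mul_nonneg hC (norm_nonneg z))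
    have h2 := mul_le_mul (h.bound x) (h'.lipschitz x z) (abs_nonneg _) hC
    nlinarith [mul_nonneg hCC (norm_nonneg z)]
  -- The remainder of a product is made of the two remainders and the product of the increments; the
  -- last is quadratic by the Lipschitz bounds. Three terms account for the constant 3.
  · have e : φ (x + z) * ψ (x + z) - φ x * ψ x - ∑ i, z i * (Dφ i x * ψ x + φ x * Dψ i x) =
        (φ (x + z) - φ x - ∑ i, z i * Dφ i x) * ψ x +
          φ x * (ψ (x + z) - ψ x - ∑ i, z i * Dψ i x) +
          (φ (x + z) - φ x) * (ψ (x + z) - ψ x) := by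
      simp_rw [mul_add, Finset.sum_add_distrib]
      rw [sub_mul (φ (x + z) - φ x), Finset.sum_mul, mul_sub (φ x) (ψ (x + z) - ψ x),
        Finset.mul_sum]
      simp_rw [mul_assoc, mul_left_comm (φ x)]
      ring
    rw [e]
    refine (abs_add_three _ _ _).trans ?_
    rw [abs_mul, abs_mul, abs_mul]
    have h1 := mul_le_mul (h.taylor x z) (h'.bound x) (abs_nonneg _)
      (mul_nonneg hC (sq_nonneg ‖z‖))
    have h2 := mul_le_mul (h.bound x) (h'.taylor x z) (abs_nonneg _) hC
    have h3 := mul_le_mul (h.lipschitz x z) (h'.lipschitz x z) (abs_nonneg _)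
      (mul_nonneg hC (norm_nonneg z))
    nlinarith

/-- Differentiable functions with bounded Lipschitz derivative are tame. -/
lemma of_lipschitz_fderiv (hper : IsPeriodic Λ φ) (hb : ∀ x, |φ x| ≤ C)
    (hd : Differentiable ℝ φ) (hd1 : ∀ x, ‖fderiv ℝ φ x‖ ≤ C)
    (hd2 : ∀ x y, ‖fderiv ℝ φ x - fderiv ℝ φ y‖ ≤ C * ‖x - y‖) :
    Tame Λ C φ (fun i x => fderiv ℝ φ x (EuclideanSpace.single i 1)) := by
  have hC : 0 ≤ C := (norm_nonneg _).trans (hd1 0)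
  refine ⟨hd.continuous.measurable, hper, hb, fun i => measurable_fderiv_apply_const ℝ φ _,
    fun i x j => ?_, fun i x => ?_, fun x z => ?_, fun x z => ?_⟩
  · have : (fun y => φ (y + EuclideanSpace.single j Λ)) = φ := funext fun y => hper y j
    rw [← fderiv_comp_add_right, this]
  · refine ((fderiv ℝ φ x).le_opNorm (EuclideanSpace.single i 1)).trans ?_
    simpa using hd1 x
  · have := Convex.norm_image_sub_le_of_norm_fderiv_le (𝕜 := ℝ) (f := φ) (C := C)
      (s := Set.univ) (fun y _ => hd y) (fun y _ => hd1 y) convex_univ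
      (Set.mem_univ x) (Set.mem_univ (x + z))
    simpa using this
  · have hz : (∑ i, z i * fderiv ℝ φ x (EuclideanSpace.single i 1)) = fderiv ℝ φ x z := by
      conv_rhs => rw [show z = ∑ i, z i • EuclideanSpace.single i (1 : ℝ) by
        ext b; simp [Finset.sum_apply, Pi.single_apply]]
      simp [map_sum]
    rw [hz]
    have := (convex_closedBall x ‖z‖).norm_image_sub_le_of_norm_hasFDerivWithin_le' (𝕜 := ℝ)
      (f := φ) (f' := fderiv ℝ φ) (φ := fderiv ℝ φ x) (C := C * ‖z‖)
      (fun y _ => (hd y).hasFDerivAt.hasFDerivWithinAt)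
      (fun y hy => (hd2 y x).trans (mul_le_mul_of_nonneg_left (mem_closedBall_iff_norm.1 hy) hC))
      (Metric.mem_closedBall_self (norm_nonneg z)) (y := x + z) (by simp)
    rw [add_sub_cancel_left] at this
    rw [pow_two, ← mul_assoc]
    exact this

lemma cosW (hΛ : 0 < Λ) (n : Fin d → ℤ) :
    ∃ C, Tame Λ C (cosW Λ n) (fun i x => -(waveVec Λ n i * sinW Λ n x)) := by
  refine ⟨1 + ‖waveVec Λ n‖ + ‖waveVec Λ n‖ ^ 2, ?_⟩
  have h := of_lipschitz_fderiv (Λ := Λ) (C := 1 + ‖waveVec Λ n‖ + ‖waveVec Λ n‖ ^ 2)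
    (φ := HMHF.cosW Λ n) (bddPeriodic_cosW hΛ n).periodic
    (fun x => (Real.abs_cos_le_one _).trans (by nlinarith [norm_nonneg (waveVec Λ n)]))
    (fun x => (hasFDerivAt_cosW n x).differentiableAt) (fun x => ?_) (fun x y => ?_)
  · simpa only [fderiv_cosW] using h
  · rw [(hasFDerivAt_cosW n x).fderiv, norm_smul, norm_neg, innerSL_apply_norm]
    have := mul_le_of_le_one_left (norm_nonneg (waveVec Λ n)) (Real.abs_sin_le_one (inner ℝ (waveVec Λ n) x))
    refine this.trans (by nlinarith [norm_nonneg (waveVec Λ n)])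
  · rw [(hasFDerivAt_cosW n x).fderiv, (hasFDerivAt_cosW n y).fderiv, ← sub_smul, norm_smul,
      innerSL_apply_norm, neg_sub_neg, Real.norm_eq_abs]
    have h1 : |HMHF.sinW Λ n y - HMHF.sinW Λ n x| ≤ ‖waveVec Λ n‖ * ‖x - y‖ := by
      refine (Real.abs_sin_sub_sin_le _ _).trans ?_
      rw [← inner_sub_right, norm_sub_rev x y]
      exact abs_real_inner_le_norm _ _
    nlinarith [mul_le_mul_of_nonneg_right h1 (norm_nonneg (waveVec Λ n)), norm_nonneg (x - y),
      mul_nonneg (norm_nonneg (waveVec Λ n)) (norm_nonneg (x - y))]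

lemma sinW (hΛ : 0 < Λ) (n : Fin d → ℤ) :
    ∃ C, Tame Λ C (sinW Λ n) (fun i x => waveVec Λ n i * HMHF.cosW Λ n x) := by
  refine ⟨1 + ‖waveVec Λ n‖ + ‖waveVec Λ n‖ ^ 2, ?_⟩
  have h := of_lipschitz_fderiv (Λ := Λ) (C := 1 + ‖waveVec Λ n‖ + ‖waveVec Λ n‖ ^ 2)
    (φ := HMHF.sinW Λ n) (bddPeriodic_sinW hΛ n).periodic
    (fun x => (Real.abs_sin_le_one _).trans (by nlinarith [norm_nonneg (waveVec Λ n)]))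
    (fun x => (hasFDerivAt_sinW n x).differentiableAt) (fun x => ?_) (fun x y => ?_)
  · simpa only [fderiv_sinW] using h
  · rw [(hasFDerivAt_sinW n x).fderiv, norm_smul, innerSL_apply_norm]
    have := mul_le_of_le_one_left (norm_nonneg (waveVec Λ n)) (Real.abs_cos_le_one (inner ℝ (waveVec Λ n) x))
    refine this.trans (by nlinarith [norm_nonneg (waveVec Λ n)])
  · rw [(hasFDerivAt_sinW n x).fderiv, (hasFDerivAt_sinW n y).fderiv, ← sub_smul, norm_smul,
      innerSL_apply_norm, Real.norm_eq_abs]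
    have h1 : |HMHF.cosW Λ n x - HMHF.cosW Λ n y| ≤ ‖waveVec Λ n‖ * ‖x - y‖ := by
      refine (Real.abs_cos_sub_cos_le _ _).trans ?_
      rw [← inner_sub_right]
      exact abs_real_inner_le_norm _ _
    nlinarith [mul_le_mul_of_nonneg_right h1 (norm_nonneg (waveVec Λ n)), norm_nonneg (x - y),
      mul_nonneg (norm_nonneg (waveVec Λ n)) (norm_nonneg (x - y))]

/-- Increments of a periodic function integrate to zero, so the Taylor bound with step s gives |∫
Dφ| ≤ s C V for every s > 0. No differentiability is invoked. -/
lemma integral_grad_eq_zero (hΛ : 0 < Λ) (h : Tame Λ C φ Dφ) (i : Fin d) :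
    ∫ x, Dφ i x ∂torusMeasure d Λ = 0 := by
  set V := (torusMeasure d Λ).real Set.univ
  have hV : 0 ≤ V := measureReal_nonneg
  have key : ∀ s : ℝ, 0 < s → |∫ x, Dφ i x ∂torusMeasure d Λ| ≤ s * (C * V) := by
    intro s hs
    have h1 : |∫ x, (φ (x + EuclideanSpace.single i s) - φ x - s * Dφ i x) ∂torusMeasure d Λ| ≤
        C * s ^ 2 * V := abs_integral_le hΛ fun x => by
      have := h.taylor x (EuclideanSpace.single i s)
      simpa [Pi.single_apply] using this
    rw [integral_sub (((h.bddPeriodic.comp_add _).sub h.bddPeriodic).integrable hΛ)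
      ((h.bddPeriodic_grad i).integrable hΛ |>.const_mul s),
      integral_sub ((h.bddPeriodic.comp_add _).integrable hΛ) (h.bddPeriodic.integrable hΛ),
      IsPeriodic.integral_add hΛ h.periodic, sub_self, zero_sub, abs_neg, integral_const_mul,
      abs_mul, abs_of_pos hs] at h1
    refine le_of_mul_le_mul_left ?_ hs
    linarith
  by_contra hne
  have hpos := abs_pos.2 hne
  have hCV : 0 ≤ C * V := mul_nonneg h.nonneg hV
  -- For this step length the bound says that the absolute integral is less than itself; the 1
  -- covers the case C V = 0.
  have := key (|∫ x, Dφ i x ∂torusMeasure d Λ| / (2 * (C * V + 1))) (by positivity)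
  rw [div_mul_eq_mul_div, le_div_iff₀ (by positivity)] at this
  nlinarith

/-- The product of a tame function with a cosine or sine is tame, so its gradient integrates to
zero; this is the integration by parts that identifies the coefficients. -/
lemma fc_grad (hΛ : 0 < Λ) (h : Tame Λ C φ Dφ) (i : Fin d) (n : Fin d → ℤ) :
    fc Λ (Dφ i) n = waveVec Λ n i * Complex.I * fc Λ φ n := by
  have key : ∀ {ψ : Vec d → ℝ} {Dψ : Fin d → Vec d → ℝ}, (∃ C, Tame Λ C ψ Dψ) →
      ∫ x, Dψ i x * φ x ∂torusMeasure d Λ = -∫ x, ψ x * Dφ i x ∂torusMeasure d Λ := by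
    rintro ψ Dψ ⟨C', h'⟩
    have h1 := (h'.mul h).integral_grad_eq_zero hΛ i
    rw [integral_add (((h'.bddPeriodic_grad i).mul h.bddPeriodic).integrable hΛ)
      ((h'.bddPeriodic.mul (h.bddPeriodic_grad i)).integrable hΛ)] at h1
    linarith
  exact fc_of_weak hΛ (h.bddPeriodic.integrable hΛ) ((h.bddPeriodic_grad i).integrable hΛ)
    (key (cosW hΛ n)) (key (sinW hΛ n))

/-- Integration by parts against `G_h ∗ f`. -/
lemma integral_grad_mul_heatS (hΛ : 0 < Λ) (h : Tame Λ C φ Dφ) {s : ℝ} (hs : 0 < s)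
    {f : Vec d → ℝ} (hf : BddPeriodic Λ f) (i : Fin d) :
    ∫ x, Dφ i x * heatS s f x ∂torusMeasure d Λ = -∫ x, φ x * gradS s i f x ∂torusMeasure d Λ := by
  refine mul_left_cancel₀ (pow_pos hΛ d).ne' ?_
  rw [mul_neg]
  refine (hasSum_fc_mul hΛ ((h.bddPeriodic_grad i).memLp hΛ 2) ((hf.heatS hs).memLp hΛ 2)).unique ?_
  have e := (hasSum_fc_mul hΛ (h.bddPeriodic.memLp hΛ 2) ((hf.gradS hs i).memLp hΛ 2)).neg
  refine e.congr_fun fun n => ?_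
  rw [h.fc_grad hΛ, fc_gradS hΛ hs i hf, ← Complex.neg_re]
  congr 1
  simp only [map_mul, Complex.conj_ofReal, Complex.conj_I]
  ring

end Tame

/-! ### The commutator identity -/

section Commutator

variable {d : ℕ} {Λ C h E : ℝ} {φ f g : Vec d → ℝ} {Dφ : Fin d → Vec d → ℝ}

lemma integral_heatKernel_comp_neg (k : Vec d → ℝ) :
    ∫ z, heatKernel d h z * k (-z) = ∫ z, heatKernel d h z * k z := by
  rw [← integral_neg_eq_self]
  simp_rw [neg_neg, heatKernel_neg]

/-- The constant in the commutator estimate. -/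
noncomputable def commConst (d : ℕ) (Λ E : ℝ) : ℝ :=
  (torusMeasure d Λ).real Set.univ * (64 * 2 ^ ((d : ℝ) / 2)) + E

/-- The pointwise-in-`z` core of the commutator estimate. The Taylor remainder of φ is O(|z|²) and
multiplies an antisymmetric expression in f and g that is small where f and g have small increments.
A weighted AM-GM inequality separates |z|⁴ from the squared increments, to be integrated against the
kernel later. -/
lemma abs_corr_taylor_le (hΛ : 0 < Λ) (hh : 0 < h) (hφ : Tame Λ C φ Dφ) (hf : BddPeriodic Λ f)
    (hg : BddPeriodic Λ g) (hf1 : ∀ x, |f x| ≤ 1) (hg1 : ∀ x, |g x| ≤ 1) (z : Vec d) :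
    |(corr Λ g (fun x => φ x * f x) z - corr Λ f (fun x => φ x * g x) z) +
      (corr Λ (fun x => φ x * f x) g z - corr Λ (fun x => φ x * g x) f z) -
      ∑ i, z i * (corr Λ g (fun x => Dφ i x * f x) z - corr Λ f (fun x => Dφ i x * g x) z)| ≤
    C * (‖z‖ ^ 4 * (torusMeasure d Λ).real Set.univ / √h + √h *
      (∫ x, f x ^ 2 ∂torusMeasure d Λ + ∫ x, g x ^ 2 ∂torusMeasure d Λ - corr Λ f f z
        - corr Λ g g z)) := by
  have := isFiniteMeasure_torusMeasure d hΛ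
  have hs : 0 < √h := Real.sqrt_pos.2 hh
  have hφb := hφ.bddPeriodic
  have hDb := hφ.bddPeriodic_grad
  set A : Vec d → ℝ := fun x => f x * g (x - z) - g x * f (x - z) with hA
  have hAb : BddPeriodic Λ A := (hf.mul (hg.comp_sub z)).sub (hg.mul (hf.comp_sub z))
  -- Adding the reflected correlations leaves φ only through the increment φ(x) - φ(x - z).
  have e1 : (corr Λ g (fun x => φ x * f x) z - corr Λ f (fun x => φ x * g x) z) +
      (corr Λ (fun x => φ x * f x) g z - corr Λ (fun x => φ x * g x) f z) =
      ∫ x, (φ x - φ (x - z)) * A x ∂torusMeasure d Λ := by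
    simp only [corr]
    rw [← integral_sub (((hg.comp_sub z).mul (hφb.mul hf)).integrable hΛ)
        (((hf.comp_sub z).mul (hφb.mul hg)).integrable hΛ),
      ← integral_sub ((((hφb.mul hf).comp_sub z).mul hg).integrable hΛ)
        ((((hφb.mul hg).comp_sub z).mul hf).integrable hΛ),
      ← integral_add ((((hg.comp_sub z).mul (hφb.mul hf)).sub
          ((hf.comp_sub z).mul (hφb.mul hg))).integrable hΛ)
        (((((hφb.mul hf).comp_sub z).mul hg).sub
          (((hφb.mul hg).comp_sub z).mul hf)).integrable hΛ)]
    congr 1; funext x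
    simp only [hA]; ring
  have e2 : ∑ i, z i * (corr Λ g (fun x => Dφ i x * f x) z - corr Λ f (fun x => Dφ i x * g x) z) =
      ∫ x, (∑ i, z i * Dφ i x) * A x ∂torusMeasure d Λ := by
    simp_rw [Finset.sum_mul]
    rw [integral_finsetSum _ fun i _ => (((BddPeriodic.const _).mul (hDb i)).mul hAb).integrable hΛ]
    refine Finset.sum_congr rfl fun i _ => ?_
    simp only [corr]
    rw [← integral_sub (((hg.comp_sub z).mul ((hDb i).mul hf)).integrable hΛ)
        (((hf.comp_sub z).mul ((hDb i).mul hg)).integrable hΛ), ← integral_const_mul]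
    congr 1; funext x
    simp only [hA]; ring
  have hsum : BddPeriodic Λ fun x => ∑ i, z i * Dφ i x :=
    BddPeriodic.sum _ fun i _ => (BddPeriodic.const _).mul (hDb i)
  rw [e1, e2, ← integral_sub (((hφb.sub (hφb.comp_sub z)).mul hAb).integrable hΛ)
    ((hsum.mul hAb).integrable hΛ)]
  have hr : ∀ x, |φ x - φ (x - z) - ∑ i, z i * Dφ i x| ≤ C * ‖z‖ ^ 2 := fun x => by
    have := hφ.taylor x (-z)
    rw [← sub_eq_add_neg, norm_neg] at this
    simp only [PiLp.neg_apply, neg_mul, Finset.sum_neg_distrib] at this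
    rw [← abs_neg]
    convert this using 2
    ring
  -- Antisymmetry lets f(x) g(x) be cancelled, so that only increments survive.
  have hAle : ∀ x, |A x| ≤ |f x - f (x - z)| + |g x - g (x - z)| := fun x => by
    have e : A x = g x * (f x - f (x - z)) - f x * (g x - g (x - z)) := by simp only [hA]; ring
    rw [e]
    refine (abs_sub _ _).trans ?_
    rw [abs_mul, abs_mul]
    exact add_le_add (mul_le_of_le_one_left (abs_nonneg _) (hg1 x))
      (mul_le_of_le_one_left (abs_nonneg _) (hf1 x))
  -- The weight √h balances the two contributions: after integration |z|⁴ is of order h² and the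
  -- squared increments are of order h, so both terms become h^(3/2).
  have hamgm : ∀ y : ℝ, ‖z‖ ^ 2 * |y| ≤ ‖z‖ ^ 4 / (2 * √h) + √h / 2 * y ^ 2 := fun y => by
    have h2 : ‖z‖ ^ 4 / (2 * √h) + √h / 2 * y ^ 2 - ‖z‖ ^ 2 * |y| =
        (‖z‖ ^ 2 - √h * |y|) ^ 2 / (2 * √h) := by
      rw [← sq_abs y]
      field_simp
      ring
    have h3 : 0 ≤ (‖z‖ ^ 2 - √h * |y|) ^ 2 / (2 * √h) := by positivity
    linarith
  have hb2 : ∀ {f : Vec d → ℝ}, BddPeriodic Λ f →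
      Integrable (fun x => (f x - f (x - z)) ^ 2) (torusMeasure d Λ) := fun hf => by
    simpa only [pow_two] using
      ((hf.sub (hf.comp_sub z)).mul (hf.sub (hf.comp_sub z))).integrable hΛ
  have hbound : ∀ x, ‖(φ x - φ (x - z)) * A x - (∑ i, z i * Dφ i x) * A x‖ ≤
      C * (‖z‖ ^ 4 / √h + √h / 2 * ((f x - f (x - z)) ^ 2 + (g x - g (x - z)) ^ 2)) := fun x => by
    rw [← sub_mul, norm_mul]
    calc _ ≤ C * ‖z‖ ^ 2 * (|f x - f (x - z)| + |g x - g (x - z)|) :=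
          mul_le_mul (hr x) (hAle x) (abs_nonneg _) (mul_nonneg hφ.nonneg (sq_nonneg _))
      _ = C * (‖z‖ ^ 2 * |f x - f (x - z)| + ‖z‖ ^ 2 * |g x - g (x - z)|) := by ring
      _ ≤ C * ((‖z‖ ^ 4 / (2 * √h) + √h / 2 * (f x - f (x - z)) ^ 2) +
            (‖z‖ ^ 4 / (2 * √h) + √h / 2 * (g x - g (x - z)) ^ 2)) :=
          mul_le_mul_of_nonneg_left (add_le_add (hamgm _) (hamgm _)) hφ.nonneg
      _ = _ := by field_simp; ring
  have hint0 : Integrable (fun x => (f x - f (x - z)) ^ 2 + (g x - g (x - z)) ^ 2)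
    (torusMeasure d Λ) := (hb2 hf).add (hb2 hg)
  have hint := hint0.const_mul (√h / 2)
  have hint2 : Integrable (fun x => ‖z‖ ^ 4 / √h +
      √h / 2 * ((f x - f (x - z)) ^ 2 + (g x - g (x - z)) ^ 2)) (torusMeasure d Λ) :=
    (integrable_const _).add hint
  refine (norm_integral_le_of_norm_le (hint2.const_mul C) (Eventually.of_forall hbound)).trans
    (le_of_eq ?_)
  rw [integral_const_mul, integral_add (integrable_const _) hint, integral_const_mul,
    integral_add (hb2 hf) (hb2 hg), integral_sub_translate_sq hΛ hf, integral_sub_translate_sq hΛ hg]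
  simp only [integral_const, smul_eq_mul]
  ring

/-- Both integrals are written as integrals over `z` of kernel times correlation. Averaging over z
and -z produces an increment of φ, the gradient terms subtract exactly its linear part, and the
remainder is `abs_corr_taylor_le`. Of the resulting h^(3/2), the prefactor 1/(2h) leaves √h. -/
lemma abs_commutator_le (hΛ : 0 < Λ) (hh : 0 < h) (hφ : Tame Λ C φ Dφ) (hf : BddPeriodic Λ f)
    (hg : BddPeriodic Λ g) (hf1 : ∀ x, |f x| ≤ 1) (hg1 : ∀ x, |g x| ≤ 1)
    (hE : deficit Λ h f + deficit Λ h g ≤ h * (2 * E)) :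
    |h⁻¹ * ∫ x, φ x * (f x * heatS h g x - g x * heatS h f x) ∂torusMeasure d Λ +
      ∑ i, ∫ x, Dφ i x * (f x * gradS h i g x - g x * gradS h i f x) ∂torusMeasure d Λ| ≤
    C * commConst d Λ E * √h := by
  have hφb := hφ.bddPeriodic
  have hDb := hφ.bddPeriodic_grad
  have hs : 0 < √h := Real.sqrt_pos.2 hh
  have hG := integrable_heatKernel d hh
  set V := (torusMeasure d Λ).real Set.univ with hV
  set a : Vec d → ℝ := fun z => corr Λ g (fun x => φ x * f x) z - corr Λ f (fun x => φ x * g x) z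
  set b : Vec d → ℝ := fun z => corr Λ (fun x => φ x * f x) g z - corr Λ (fun x => φ x * g x) f z
  set c : Fin d → Vec d → ℝ := fun i z =>
    corr Λ g (fun x => Dφ i x * f x) z - corr Λ f (fun x => Dφ i x * g x) z
  have int2 : ∀ {k : Vec d → ℝ} {p q r s : Vec d → ℝ}, Integrable k → BddPeriodic Λ p →
      BddPeriodic Λ q → BddPeriodic Λ r → BddPeriodic Λ s →
      Integrable fun z => k z * (corr Λ p q z - corr Λ r s z) := by
    intro k p q r s hk hp hq hr hs
    simp_rw [mul_sub]
    exact (integrable_mul_corr hΛ hp hk hq).sub (integrable_mul_corr hΛ hr hk hs)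
  have ia : Integrable fun z => heatKernel d h z * a z := int2 hG hg (hφb.mul hf) hf (hφb.mul hg)
  have ib : Integrable fun z => heatKernel d h z * b z := int2 hG (hφb.mul hf) hg (hφb.mul hg) hf
  have ic : ∀ i, Integrable fun z => gradKernel d h i z * c i z := fun i =>
    int2 (integrable_gradKernel hh i) hg ((hDb i).mul hf) hf ((hDb i).mul hg)
  have ea : ∫ x, φ x * (f x * heatS h g x - g x * heatS h f x) ∂torusMeasure d Λ =
      ∫ z, heatKernel d h z * a z := by
    simp_rw [mul_sub, ← mul_assoc]
    rw [integral_sub (((hφb.mul hf).mul (hg.heatS hh)).integrable hΛ)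
      (((hφb.mul hg).mul (hf.heatS hh)).integrable hΛ), heatS, heatS,
      integral_sconv_mul hΛ hg hG (hφb.mul hf), integral_sconv_mul hΛ hf hG (hφb.mul hg),
      ← integral_sub (integrable_mul_corr hΛ hg hG (hφb.mul hf))
        (integrable_mul_corr hΛ hf hG (hφb.mul hg))]
    simp_rw [← mul_sub]
    rfl
  -- The kernel is even and reflection swaps the two arguments of a correlation.
  have eab : ∫ z, heatKernel d h z * a z = ∫ z, heatKernel d h z * b z := by
    rw [← integral_heatKernel_comp_neg]
    congr 1; funext z
    simp only [a, b]
    rw [corr_neg hΛ hg (hφb.mul hf), corr_neg hΛ hf (hφb.mul hg)]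
  have ec : ∀ i, ∫ x, Dφ i x * (f x * gradS h i g x - g x * gradS h i f x) ∂torusMeasure d Λ =
      ∫ z, gradKernel d h i z * c i z := fun i => by
    have hK := integrable_gradKernel hh i
    simp_rw [mul_sub, ← mul_assoc]
    rw [integral_sub ((((hDb i).mul hf).mul (hg.gradS hh i)).integrable hΛ)
      ((((hDb i).mul hg).mul (hf.gradS hh i)).integrable hΛ), gradS, gradS,
      integral_sconv_mul hΛ hg hK ((hDb i).mul hf), integral_sconv_mul hΛ hf hK ((hDb i).mul hg),
      ← integral_sub (integrable_mul_corr hΛ hg hK ((hDb i).mul hf))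
        (integrable_mul_corr hΛ hf hK ((hDb i).mul hg))]
    simp_rw [← mul_sub]
    rfl
  -- Half of the first term is reflected. As ∂ᵢG_h = -zᵢ/(2h) G_h, the gradient terms carry the same
  -- prefactor and the sign of the subtracted Taylor polynomial.
  have e : h⁻¹ * ∫ x, φ x * (f x * heatS h g x - g x * heatS h f x) ∂torusMeasure d Λ +
      ∑ i, ∫ x, Dφ i x * (f x * gradS h i g x - g x * gradS h i f x) ∂torusMeasure d Λ =
      ∫ z, (2 * h)⁻¹ * (heatKernel d h z * (a z + b z - ∑ i, z i * c i z)) := by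
    have e1 : h⁻¹ * ∫ z, heatKernel d h z * a z =
        (2 * h)⁻¹ * ((∫ z, heatKernel d h z * a z) + ∫ z, heatKernel d h z * b z) := by
      rw [← eab, mul_inv]; ring
    have iab : Integrable fun z => heatKernel d h z * a z + heatKernel d h z * b z := ia.add ib
    rw [ea, e1, Finset.sum_congr rfl fun i _ => ec i, ← integral_finsetSum _ fun i _ => ic i,
      ← integral_add ia ib, ← integral_const_mul, ← integral_add (iab.const_mul _)
        (integrable_finsetSum _ fun i _ => ic i)]
    congr 1; funext z
    simp_rw [gradKernel_eq, mul_sub, Finset.mul_sum, mul_add]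
    rw [sub_eq_add_neg, ← Finset.sum_neg_distrib]
    congr 1
    refine Finset.sum_congr rfl fun i _ => ?_
    rw [div_eq_mul_inv]
    ring
  rw [e]
  set D : Vec d → ℝ := fun z => ∫ x, f x ^ 2 ∂torusMeasure d Λ + ∫ x, g x ^ 2 ∂torusMeasure d Λ -
    corr Λ f f z - corr Λ g g z
  have iff' := integrable_mul_corr hΛ hf hG hf
  have igg := integrable_mul_corr hΛ hg hG hg
  have iD0 : Integrable fun z => heatKernel d h z *
      (∫ x, f x ^ 2 ∂torusMeasure d Λ + ∫ x, g x ^ 2 ∂torusMeasure d Λ) := hG.mul_const _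
  have eD' : ∀ z, heatKernel d h z * D z = heatKernel d h z *
      (∫ x, f x ^ 2 ∂torusMeasure d Λ + ∫ x, g x ^ 2 ∂torusMeasure d Λ) -
      heatKernel d h z * corr Λ f f z - heatKernel d h z * corr Λ g g z := fun z => by
    simp only [D]; ring
  have iD1 : Integrable fun z => heatKernel d h z *
      (∫ x, f x ^ 2 ∂torusMeasure d Λ + ∫ x, g x ^ 2 ∂torusMeasure d Λ) -
      heatKernel d h z * corr Λ f f z := iD0.sub iff'
  have iD : Integrable fun z => heatKernel d h z * D z := by
    simp_rw [eD']
    exact iD1.sub igg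
  have eD : ∫ z, heatKernel d h z * D z = deficit Λ h f + deficit Λ h g := by
    simp_rw [eD']
    rw [integral_sub iD1 igg, integral_sub iD0 iff', integral_mul_const, integral_heatKernel d hh,
      ← integral_sconv_mul hΛ hf hG hf, ← integral_sconv_mul hΛ hg hG hg, deficit, deficit, heatS,
      heatS]
    ring
  have i4 := integrable_norm_pow_four_mul_heatKernel d hh
  have hbd : ∀ z, ‖(2 * h)⁻¹ * (heatKernel d h z * (a z + b z - ∑ i, z i * c i z))‖ ≤
      (2 * h)⁻¹ * C * (V / √h * (‖z‖ ^ 4 * heatKernel d h z) + √h * (heatKernel d h z * D z)) :=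
    fun z => by
      have h1 := abs_corr_taylor_le hΛ hh hφ hf hg hf1 hg1 z
      have h0 := heatKernel_nonneg hh z
      rw [norm_mul, norm_mul, Real.norm_of_nonneg h0, Real.norm_of_nonneg (by positivity), mul_assoc]
      refine mul_le_mul_of_nonneg_left ?_ (by positivity)
      refine (mul_le_mul_of_nonneg_left h1 h0).trans (le_of_eq ?_)
      simp only [D, V]
      ring
  have iR : Integrable fun z => V / √h * (‖z‖ ^ 4 * heatKernel d h z) +
      √h * (heatKernel d h z * D z) := (i4.const_mul _).add (iD.const_mul _)
  refine (norm_integral_le_of_norm_le (iR.const_mul _) (Eventually.of_forall hbd)).trans ?_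
  rw [integral_const_mul, integral_add (i4.const_mul _) (iD.const_mul _), integral_const_mul,
    integral_const_mul, eD]
  have h4 := integral_norm_pow_four_mul_heatKernel_le d hh
  have hsq : √h * √h = h := Real.mul_self_sqrt hh.le
  have hC := hφ.nonneg
  have hV0 : 0 ≤ V := measureReal_nonneg
  calc _ ≤ (2 * h)⁻¹ * C * (V / √h * (128 * 2 ^ ((d : ℝ) / 2) * h ^ 2) + √h * (h * (2 * E))) := by
        gcongr
    _ = C * (V * (64 * 2 ^ ((d : ℝ) / 2)) * (h / √h) + E * √h) := by
        field_simp; ring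
    _ = _ := by
        have : h / √h = √h := by rw [div_eq_iff hs.ne', hsq]
        rw [this, commConst]; ring

end Commutator

end HMHF

namespace HMHF

/-! ### Weak and strong convergence of scalar functions in `L²` -/

section L2

variable {X : Type} [MeasurableSpace X] {μ : Measure X} {f g p : X → ℝ}

lemma integral_sq_eq_norm_sq (hf : MemLp f 2 μ) : ∫ x, f x ^ 2 ∂μ = ‖hf.toLp f‖ ^ 2 := by
  rw [← real_inner_self_eq_norm_sq, L2.inner_def]
  refine integral_congr_ae ?_
  filter_upwards [hf.coeFn_toLp] with x hx
  rw [hx]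
  simp [pow_two]

lemma integral_mul_eq_inner (hf : MemLp f 2 μ) (hg : MemLp g 2 μ) :
    ∫ x, f x * g x ∂μ = inner ℝ (hf.toLp f) (hg.toLp g) := by
  rw [L2.inner_def]
  refine integral_congr_ae ?_
  filter_upwards [hf.coeFn_toLp, hg.coeFn_toLp] with x hx hx'
  rw [hx, hx']
  simp [mul_comm]

lemma abs_integral_mul_le (hf : MemLp f 2 μ) (hg : MemLp g 2 μ) :
    |∫ x, f x * g x ∂μ| ≤ √(∫ x, f x ^ 2 ∂μ) * √(∫ x, g x ^ 2 ∂μ) := by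
  rw [integral_mul_eq_inner hf hg, integral_sq_eq_norm_sq hf, integral_sq_eq_norm_sq hg,
    Real.sqrt_sq (norm_nonneg _), Real.sqrt_sq (norm_nonneg _)]
  exact abs_real_inner_le_norm _ _

lemma integrable_mul_of_memLp (hf : MemLp f 2 μ) (hg : MemLp g 2 μ) :
    Integrable (fun x => f x * g x) μ := hf.integrable_mul hg

lemma memLp_bdd_mul {C : ℝ} (hp : AEStronglyMeasurable p μ) (hC : ∀ᵐ x ∂μ, |p x| ≤ C)
    (hf : MemLp f 2 μ) : MemLp (fun x => p x * f x) 2 μ := by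
  refine (hf.const_mul C).of_le (hp.mul hf.1) (hC.mono fun x hx => ?_)
  rw [norm_mul, norm_mul]
  exact mul_le_mul_of_nonneg_right (hx.trans (le_abs_self C)) (norm_nonneg _)

/-- Strong convergence in `L²` for real functions. -/
structure StrongConv (μ : Measure X) (f : ℕ → X → ℝ) (g : X → ℝ) : Prop where
  memLp : ∀ k, MemLp (f k) 2 μ
  memLp_lim : MemLp g 2 μ
  tendsto : Tendsto (fun k => ∫ x, (f k x - g x) ^ 2 ∂μ) atTop (𝓝 0)

/-- Weak convergence in `L²` of a bounded sequence of real functions. -/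
structure WeakConv (μ : Measure X) (f : ℕ → X → ℝ) (g : X → ℝ) : Prop where
  memLp : ∀ k, MemLp (f k) 2 μ
  memLp_lim : MemLp g 2 μ
  bounded : ∃ B, ∀ k, ∫ x, f k x ^ 2 ∂μ ≤ B
  tendsto : ∀ ψ : X → ℝ, MemLp ψ 2 μ →
    Tendsto (fun k => ∫ x, f k x * ψ x ∂μ) atTop (𝓝 (∫ x, g x * ψ x ∂μ))

variable {F G : ℕ → X → ℝ} {f' g' : X → ℝ}

/-- The part (F k - f) G k is handled by Cauchy–Schwarz with the norm bound stored in `WeakConv`,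
the part f G k by weak convergence. -/
lemma StrongConv.tendsto_integral_mul (hF : StrongConv μ F f) (hG : WeakConv μ G g) :
    Tendsto (fun k => ∫ x, F k x * G k x ∂μ) atTop (𝓝 (∫ x, f x * g x ∂μ)) := by
  obtain ⟨B, hB⟩ := hG.bounded
  have h1 : Tendsto (fun k => ∫ x, (F k x - f x) * G k x ∂μ) atTop (𝓝 0) := by
    have h2 : Tendsto (fun k => √(∫ x, (F k x - f x) ^ 2 ∂μ) * √B) atTop (𝓝 0) := by
      simpa using (hF.tendsto.sqrt).mul_const (√B)
    refine squeeze_zero_norm (fun k => ?_) h2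
    refine (abs_integral_mul_le ((hF.memLp k).sub hF.memLp_lim) (hG.memLp k)).trans ?_
    exact mul_le_mul_of_nonneg_left (Real.sqrt_le_sqrt (hB k)) (Real.sqrt_nonneg _)
  have h2 := h1.add (hG.tendsto f hF.memLp_lim)
  rw [zero_add] at h2
  simp_rw [mul_comm (f _)]
  refine h2.congr fun k => ?_
  have i1 : Integrable (fun x => (F k x - f x) * G k x) μ :=
    integrable_mul_of_memLp ((hF.memLp k).sub hF.memLp_lim) (hG.memLp k)
  have i2 : Integrable (fun x => G k x * f x) μ :=
    integrable_mul_of_memLp (hG.memLp k) hF.memLp_lim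
  rw [← integral_add i1 i2]
  congr 1; funext x; ring

lemma StrongConv.weakConv (hF : StrongConv μ F f) : WeakConv μ F f := by
  refine ⟨hF.memLp, hF.memLp_lim, ?_, fun ψ hψ => ?_⟩
  · obtain ⟨B, hB⟩ := hF.tendsto.bddAbove_range
    refine ⟨2 * B + 2 * ∫ x, f x ^ 2 ∂μ, fun k => ?_⟩
    have i1 := ((hF.memLp k).sub hF.memLp_lim).integrable_sq
    have i2 := hF.memLp_lim.integrable_sq
    have h1 : ∫ x, F k x ^ 2 ∂μ ≤ ∫ x, (2 * (F k x - f x) ^ 2 + 2 * f x ^ 2) ∂μ :=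
      integral_mono (hF.memLp k).integrable_sq ((i1.const_mul 2).add (i2.const_mul 2)) fun x => by
        show F k x ^ 2 ≤ _
        nlinarith [sq_nonneg (F k x - f x - f x)]
    have h2 : ∫ x, (F k x - f x) ^ 2 ∂μ ≤ B := hB ⟨k, rfl⟩
    refine h1.trans ?_
    erw [integral_add (i1.const_mul 2) (i2.const_mul 2), integral_const_mul, integral_const_mul]
    simp only [Pi.sub_apply]
    linarith
  · rw [tendsto_iff_norm_sub_tendsto_zero]
    have h2 : Tendsto (fun k => √(∫ x, (F k x - f x) ^ 2 ∂μ) * √(∫ x, ψ x ^ 2 ∂μ)) atTop (𝓝 0) := by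
      simpa using (hF.tendsto.sqrt).mul_const _
    refine squeeze_zero (fun _ => norm_nonneg _) (fun k => ?_) h2
    rw [← integral_sub (integrable_mul_of_memLp (hF.memLp k) hψ)
      (integrable_mul_of_memLp hF.memLp_lim hψ)]
    simp_rw [← sub_mul]
    exact abs_integral_mul_le ((hF.memLp k).sub hF.memLp_lim) hψ

lemma StrongConv.bdd_mul {C : ℝ} (hF : StrongConv μ F f) (hp : AEStronglyMeasurable p μ)
    (hC : ∀ᵐ x ∂μ, |p x| ≤ C) : StrongConv μ (fun k x => p x * F k x) (fun x => p x * f x) := by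
  refine ⟨fun k => memLp_bdd_mul hp hC (hF.memLp k), memLp_bdd_mul hp hC hF.memLp_lim, ?_⟩
  have h2 : Tendsto (fun k => C ^ 2 * ∫ x, (F k x - f x) ^ 2 ∂μ) atTop (𝓝 0) := by
    simpa using hF.tendsto.const_mul (C ^ 2)
  refine squeeze_zero (fun _ => integral_nonneg fun _ => sq_nonneg _) (fun k => ?_) h2
  rw [← integral_const_mul]
  refine integral_mono_ae ?_ (((hF.memLp k).sub hF.memLp_lim).integrable_sq.const_mul _) ?_
  · exact ((memLp_bdd_mul hp hC (hF.memLp k)).sub (memLp_bdd_mul hp hC hF.memLp_lim)).integrable_sq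
  · filter_upwards [hC] with x hx
    rw [← mul_sub, mul_pow]
    refine mul_le_mul_of_nonneg_right ?_ (sq_nonneg _)
    rw [← sq_abs]
    exact pow_le_pow_left₀ (abs_nonneg _) hx 2

lemma StrongConv.add (hF : StrongConv μ F f) (hG : StrongConv μ G g) :
    StrongConv μ (fun k x => F k x + G k x) (fun x => f x + g x) := by
  refine ⟨fun k => (hF.memLp k).add (hG.memLp k), hF.memLp_lim.add hG.memLp_lim, ?_⟩
  have h2 : Tendsto (fun k => 2 * ∫ x, (F k x - f x) ^ 2 ∂μ + 2 * ∫ x, (G k x - g x) ^ 2 ∂μ)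
      atTop (𝓝 0) := by
    simpa using (hF.tendsto.const_mul 2).add (hG.tendsto.const_mul 2)
  refine squeeze_zero (fun _ => integral_nonneg fun _ => sq_nonneg _) (fun k => ?_) h2
  have i1 : Integrable (fun x => (F k x - f x) ^ 2) μ := ((hF.memLp k).sub hF.memLp_lim).integrable_sq
  have i2 : Integrable (fun x => (G k x - g x) ^ 2) μ := ((hG.memLp k).sub hG.memLp_lim).integrable_sq
  rw [← integral_const_mul, ← integral_const_mul, ← integral_add (i1.const_mul 2) (i2.const_mul 2)]
  refine integral_mono (((hF.memLp k).add (hG.memLp k)).sub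
    (hF.memLp_lim.add hG.memLp_lim)).integrable_sq ((i1.const_mul 2).add (i2.const_mul 2)) fun x => ?_
  show (F k x + G k x - (f x + g x)) ^ 2 ≤ 2 * (F k x - f x) ^ 2 + 2 * (G k x - g x) ^ 2
  nlinarith [sq_nonneg (F k x - f x - (G k x - g x))]

lemma StrongConv.of_sub (hF : StrongConv μ F f) (hG : ∀ k, MemLp (G k) 2 μ)
    (h : Tendsto (fun k => ∫ x, (G k x - F k x) ^ 2 ∂μ) atTop (𝓝 0)) : StrongConv μ G f := by
  have : StrongConv μ (fun k x => G k x - F k x) (fun _ => 0) :=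
    ⟨fun k => (hG k).sub (hF.memLp k), MemLp.zero, by simpa using h⟩
  have h2 := hF.add this
  simpa using h2

lemma WeakConv.subseq {σ : ℕ → ℕ} (hF : WeakConv μ F f) (hσ : StrictMono σ) :
    WeakConv μ (fun k => F (σ k)) f := by
  obtain ⟨B, hB⟩ := hF.bounded
  exact ⟨fun k => hF.memLp _, hF.memLp_lim, ⟨B, fun k => hB _⟩,
    fun ψ hψ => (hF.tendsto ψ hψ).comp hσ.tendsto_atTop⟩

/-- Banach–Alaoglu in sequential form: functions are identified with functionals by Riesz, and
closed balls in the dual of the separable space L² are sequentially compact for the weak-* topology.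
-/
lemma exists_weakConv [IsFiniteMeasure μ] [MeasurableSpace.CountablyGenerated X]
    (hF : ∀ k, MemLp (F k) 2 μ) {B : ℝ} (hB : ∀ k, ∫ x, F k x ^ 2 ∂μ ≤ B) :
    ∃ (σ : ℕ → ℕ) (f : X → ℝ), StrictMono σ ∧ WeakConv μ (fun k => F (σ k)) f := by
  have : Fact ((2 : ENNReal) ≠ ⊤) := ⟨by norm_num⟩
  have : Fact ((1 : ENNReal) ≤ 2) := ⟨by norm_num⟩
  let Φ : ℕ → StrongDual ℝ (Lp ℝ 2 μ) := fun k => innerSL ℝ ((hF k).toLp (F k))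
  have hΦ : ∀ k, StrongDual.toWeakDual (Φ k) ∈
      (WeakDual.toStrongDual ⁻¹' Metric.closedBall (0 : StrongDual ℝ (Lp ℝ 2 μ)) (√B)) := fun k => by
    change Φ k ∈ Metric.closedBall (0 : StrongDual ℝ (Lp ℝ 2 μ)) (√B)
    rw [mem_closedBall_zero_iff, innerSL_apply_norm]
    refine Real.le_sqrt_of_sq_le ?_
    rw [← integral_sq_eq_norm_sq]
    exact hB k
  obtain ⟨Ψ, -, σ, hσ, hlim⟩ := WeakDual.isSeqCompact_closedBall ℝ (Lp ℝ 2 μ)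
    (0 : StrongDual ℝ (Lp ℝ 2 μ)) (√B) hΦ
  let g := (InnerProductSpace.toDual ℝ (Lp ℝ 2 μ)).symm (WeakDual.toStrongDual Ψ)
  refine ⟨σ, g, hσ, fun k => hF _, Lp.memLp g, ⟨B, fun k => hB _⟩, fun ψ hψ => ?_⟩
  have h1 := ((WeakDual.eval_continuous (𝕜 := ℝ) (hψ.toLp ψ)).tendsto Ψ).comp hlim
  have h2 : ∫ x, g x * ψ x ∂μ = Ψ (hψ.toLp ψ) := by
    rw [integral_mul_eq_inner (Lp.memLp g) hψ, Lp.toLp_coeFn]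
    exact InnerProductSpace.toDual_symm_apply
  rw [h2]
  refine h1.congr fun k => ?_
  rw [integral_mul_eq_inner (hF _) hψ]
  rfl

lemma exists_weakConv_finset [IsFiniteMeasure μ] [MeasurableSpace.CountablyGenerated X] {ι : Type}
    {F : ι → ℕ → X → ℝ} (hF : ∀ i k, MemLp (F i k) 2 μ) {B : ℝ}
    (hB : ∀ i k, ∫ x, F i k x ^ 2 ∂μ ≤ B) (s : Finset ι) :
    ∃ (σ : ℕ → ℕ) (f : ι → X → ℝ), StrictMono σ ∧
      ∀ i ∈ s, WeakConv μ (fun k => F i (σ k)) (f i) := by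
  classical
  induction s using Finset.induction_on with
  | empty => exact ⟨id, fun _ _ => 0, strictMono_id, by simp⟩
  | insert i s hi ih =>
    obtain ⟨σ, f, hσ, hf⟩ := ih
    obtain ⟨σ', g, hσ', hg⟩ := exists_weakConv (F := fun k => F i (σ k)) (fun k => hF i _)
      (fun k => hB i _)
    refine ⟨σ ∘ σ', Function.update f i g, hσ.comp hσ', fun j hj => ?_⟩
    by_cases hji : j = i
    · subst hji
      simpa using hg
    · rw [Function.update_of_ne hji]
      exact (hf j ((Finset.mem_insert.1 hj).resolve_left hji)).subseq hσ'

end L2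

end HMHF

namespace HMHF

/-! ### Estimates for the interpolation in time -/

section Scheme

variable {d N : ℕ} {Λ T h E : ℝ} {u0 : Vec d → Vec N}

lemma BallMap.interp (hu : BallMap Λ u0) (hh : 0 < h) (t : ℝ) : BallMap Λ (interp h u0 t) :=
  hu.iterate hh _

/-- The dissipation `‖G_h ∗ (u^{j+1} - u^j)‖²` of a time step. -/
noncomputable def dissipation (Λ h : ℝ) (u0 : Vec d → Vec N) (j : ℕ) : ℝ :=
  ∑ a, ∫ x, heatS h (fun y => iterate h u0 (j + 1) y a - iterate h u0 j y a) x ^ 2 ∂torusMeasure d Λ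

lemma dissipation_nonneg (j : ℕ) : 0 ≤ dissipation Λ h u0 j :=
  Finset.sum_nonneg fun _ _ => integral_nonneg fun _ => sq_nonneg _

lemma sum_dissipation_le (hΛ : 0 < Λ) (hh : 0 < h) (hu : BallMap Λ u0)
    (hE : energy Λ h u0 ≤ h * E) (n : ℕ) :
    ∑ j ∈ Finset.range n, dissipation Λ h u0 j ≤ h * E := by
  have h1 := energy_iterate_add hΛ hh hu n
  have h2 := energy_nonneg hΛ hh (hu.iterate hh n)
  simp only [dissipation]
  linarith

lemma energy_iterate_le (hΛ : 0 < Λ) (hh : 0 < h) (hu : BallMap Λ u0)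
    (hE : energy Λ h u0 ≤ h * E) (n : ℕ) : energy Λ h (iterate h u0 n) ≤ h * E := by
  have h1 := energy_iterate_add hΛ hh hu n
  have h2 : 0 ≤ ∑ j ∈ Finset.range n, dissipation Λ h u0 j :=
    Finset.sum_nonneg fun j _ => dissipation_nonneg j
  simp only [dissipation] at h2
  linarith

lemma sum_deficit_iterate_le (hΛ : 0 < Λ) (hh : 0 < h) (hu : BallMap Λ u0)
    (hE : energy Λ h u0 ≤ h * E) (n : ℕ) :
    ∑ a, deficit Λ h (fun x => iterate h u0 n x a) ≤ h * E :=
  (sum_deficit_le_energy hΛ h (hu.iterate hh n)).trans (energy_iterate_le hΛ hh hu hE n)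

lemma deficit_iterate_le (hΛ : 0 < Λ) (hh : 0 < h) (hu : BallMap Λ u0)
    (hE : energy Λ h u0 ≤ h * E) (n : ℕ) (a : Fin N) :
    deficit Λ h (fun x => iterate h u0 n x a) ≤ h * E :=
  (Finset.single_le_sum (f := fun a => deficit Λ h (fun x => iterate h u0 n x a))
    (fun a _ => deficit_nonneg hΛ hh ((hu.iterate hh n).bddPeriodic a)) (Finset.mem_univ a)).trans
    (sum_deficit_iterate_le hΛ hh hu hE n)

lemma sum_integral_gradS_iterate_le (hΛ : 0 < Λ) (hh : 0 < h) (hu : BallMap Λ u0)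
    (hE : energy Λ h u0 ≤ h * E) (n : ℕ) (a : Fin N) :
    ∑ i, ∫ x, gradS h i (fun x => iterate h u0 n x a) x ^ 2 ∂torusMeasure d Λ ≤ E := by
  refine (sum_integral_gradS_sq_le hΛ hh ((hu.iterate hh n).bddPeriodic a)).trans ?_
  rw [inv_mul_le_iff₀ hh]
  exact deficit_iterate_le hΛ hh hu hE n a

lemma norm_fc_sq_le (hΛ : 0 < Λ) {f : Vec d → ℝ} (hf : MemLp f 2 (torusMeasure d Λ))
    (n : Fin d → ℤ) : ‖fc Λ f n‖ ^ 2 ≤ Λ ^ d * ∫ x, f x ^ 2 ∂torusMeasure d Λ :=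
  le_hasSum (hasSum_norm_fc_sq hΛ hf) n fun _ _ => sq_nonneg _

/-- Cauchy–Schwarz over the q - p intermediate steps, whose squared jumps are bounded by the
dissipation. This is the discrete form of Hölder-1/2 continuity in time. -/
lemma norm_fc_iterate_sub_sq_le (hΛ : 0 < Λ) (hh : 0 < h) (hu : BallMap Λ u0)
    (hE : energy Λ h u0 ≤ h * E) (a : Fin N) (n : Fin d → ℤ) {p q : ℕ} (hpq : p ≤ q) :
    ‖fc Λ (heatS h fun x => iterate h u0 q x a) n - fc Λ (heatS h fun x => iterate h u0 p x a) n‖ ^ 2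
      ≤ (q - p : ℝ) * (Λ ^ d * (h * E)) := by
  set c : ℕ → ℂ := fun j => fc Λ (heatS h fun x => iterate h u0 j x a) n
  have hb := fun j => (hu.iterate hh j).bddPeriodic a
  have h1 : ∀ j, dist (c j) (c (j + 1)) ^ 2 ≤ Λ ^ d * dissipation Λ h u0 j := fun j => by
    have e : c (j + 1) - c j = fc Λ
        (heatS h (fun y => iterate h u0 (j + 1) y a - iterate h u0 j y a)) n := by
      rw [funext (heatS_sub hh (hb (j + 1)) (hb j)), fc_sub (((hb (j + 1)).heatS hh).integrable hΛ)
        (((hb j).heatS hh).integrable hΛ)]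
    rw [dist_comm, dist_eq_norm, e]
    refine (norm_fc_sq_le hΛ ((((hb (j + 1)).sub (hb j)).heatS hh).memLp hΛ 2) n).trans ?_
    refine mul_le_mul_of_nonneg_left ?_ (pow_pos hΛ d).le
    exact Finset.single_le_sum (f := fun a => ∫ x, heatS h
      (fun y => iterate h u0 (j + 1) y a - iterate h u0 j y a) x ^ 2 ∂torusMeasure d Λ)
      (fun a _ => integral_nonneg fun _ => sq_nonneg _) (Finset.mem_univ a)
  have h2 := dist_le_Ico_sum_dist c hpq
  rw [dist_comm, dist_eq_norm] at h2
  have hcard : ((Finset.Ico p q).card : ℝ) = q - p := by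
    rw [Nat.card_Ico, Nat.cast_sub hpq]
  calc ‖c q - c p‖ ^ 2 ≤ (∑ i ∈ Finset.Ico p q, dist (c i) (c (i + 1))) ^ 2 :=
        pow_le_pow_left₀ (norm_nonneg _) h2 2
    _ ≤ (Finset.Ico p q).card * ∑ i ∈ Finset.Ico p q, dist (c i) (c (i + 1)) ^ 2 :=
        sq_sum_le_card_mul_sum_sq
    _ ≤ (Finset.Ico p q).card * (Λ ^ d * (h * E)) := by
        refine mul_le_mul_of_nonneg_left ?_ (Nat.cast_nonneg _)
        calc _ ≤ ∑ i ∈ Finset.Ico p q, Λ ^ d * dissipation Λ h u0 i :=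
              Finset.sum_le_sum fun i _ => h1 i
          _ ≤ ∑ i ∈ Finset.range q, Λ ^ d * dissipation Λ h u0 i :=
              Finset.sum_le_sum_of_subset_of_nonneg
                (fun i hi => Finset.mem_range.2 (Finset.mem_Ico.1 hi).2)
                fun i _ _ => mul_nonneg (pow_pos hΛ d).le (dissipation_nonneg i)
          _ ≤ _ := by
              rw [← Finset.mul_sum]
              exact mul_le_mul_of_nonneg_left (sum_dissipation_le hΛ hh hu hE q) (pow_pos hΛ d).le
    _ = _ := by rw [hcard]

lemma nonneg_of_energy_le (hΛ : 0 < Λ) (hh : 0 < h) (hu : BallMap Λ u0)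
    (hE : energy Λ h u0 ≤ h * E) : 0 ≤ E :=
  nonneg_of_mul_nonneg_right ((energy_nonneg hΛ hh hu).trans hE) hh

/-- Times s and t are separated by at most |t - s|/h + 1 steps. The extra one is the jump of the
piecewise constant interpolation and leaves the error `h`. -/
lemma norm_fc_interp_sub_sq_le (hΛ : 0 < Λ) (hh : 0 < h) (hu : BallMap Λ u0)
    (hE : energy Λ h u0 ≤ h * E) (a : Fin N) (n : Fin d → ℤ) {s t : ℝ} (hs : 0 ≤ s) (ht : 0 ≤ t) :
    ‖fc Λ (heatS h fun x => interp h u0 t x a) n - fc Λ (heatS h fun x => interp h u0 s x a) n‖ ^ 2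
      ≤ Λ ^ d * E * (|t - s| + h) := by
  wlog hst : s ≤ t generalizing s t with H
  · rw [norm_sub_rev, abs_sub_comm]
    exact H ht hs (le_of_not_ge hst)
  have hpq : ⌊s / h⌋₊ ≤ ⌊t / h⌋₊ := Nat.floor_le_floor (by gcongr)
  refine (norm_fc_iterate_sub_sq_le hΛ hh hu hE a n hpq).trans ?_
  have h1 : (⌊t / h⌋₊ : ℝ) ≤ t / h := Nat.floor_le (by positivity)
  have h2 : s / h < ⌊s / h⌋₊ + 1 := Nat.lt_floor_add_one _
  have h3 : ((⌊t / h⌋₊ : ℝ) - ⌊s / h⌋₊) * h ≤ |t - s| + h := by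
    rw [abs_of_nonneg (sub_nonneg.2 hst)]
    rw [le_div_iff₀ hh] at h1
    rw [div_lt_iff₀ hh] at h2
    nlinarith
  have hE0 := nonneg_of_energy_le hΛ hh hu hE
  calc _ = Λ ^ d * E * (((⌊t / h⌋₊ : ℝ) - ⌊s / h⌋₊) * h) := by ring
    _ ≤ _ := mul_le_mul_of_nonneg_left h3 (mul_nonneg (pow_pos hΛ d).le hE0)

end Scheme

/-! ### Compactness -/

/-- A version of the Arzelà–Ascoli theorem for countably many functions whose jumps vanish in the
limit. -/
lemma exists_subseq_cauchySeq {ι : Type} [Countable ι] {c : ℕ → ι → ℝ → ℂ} {B K : ℝ} {h : ℕ → ℝ}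
    (hB : ∀ k i t, ‖c k i t‖ ≤ B) (hK : 0 ≤ K) (hlim : Tendsto h atTop (𝓝 0))
    (hc : ∀ k i s t, 0 ≤ s → 0 ≤ t → ‖c k i t - c k i s‖ ^ 2 ≤ K * (|t - s| + h k)) :
    ∃ σ : ℕ → ℕ, StrictMono σ ∧ ∀ i t, 0 ≤ t → CauchySeq fun k => c (σ k) i t := by
  have hcomp : IsCompact (Set.univ.pi fun _ : ι × ℚ => Metric.closedBall (0 : ℂ) B) :=
    isCompact_univ_pi fun _ => isCompact_closedBall _ _
  -- A countable product of discs is sequentially compact, so this single extraction replaces a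
  -- diagonal argument. Absolute values of rationals provide a countable dense set of nonnegative
  -- times.
  obtain ⟨x, -, σ, hσ, hx⟩ := hcomp.tendsto_subseq
    (x := fun k (j : ι × ℚ) => c k j.1 |(j.2 : ℝ)|)
    (fun k j _ => mem_closedBall_zero_iff.2 (hB k _ _))
  refine ⟨σ, hσ, fun i t ht => Metric.cauchySeq_iff.2 fun ε hε => ?_⟩
  -- Chosen so that (K + 1)(η + η) = (ε/4)²; using K + 1 keeps the denominator positive.
  set η := (ε / 4) ^ 2 / (2 * (K + 1)) with hη
  have hη0 : 0 < η := by positivity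
  obtain ⟨q, hq1, hq2⟩ := exists_rat_btwn (show t < t + η by linarith)
  have hq0 : (0 : ℝ) ≤ q := ht.trans hq1.le
  have hq := (tendsto_pi_nhds.1 hx (i, q)).cauchySeq
  obtain ⟨k1, hk1⟩ := Metric.cauchySeq_iff.1 hq (ε / 4) (by positivity)
  have hk2 : ∀ᶠ k in atTop, h (σ k) < η :=
    (hlim.comp hσ.tendsto_atTop).eventually (gt_mem_nhds hη0)
  obtain ⟨k2, hk2⟩ := eventually_atTop.1 hk2
  have hclose : ∀ k, k2 ≤ k → dist (c (σ k) i t) (c (σ k) i q) ≤ ε / 4 := fun k hk => by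
    rw [dist_eq_norm]
    refine le_of_sq_le_sq ?_ (by positivity)
    refine (hc _ i q t hq0 ht).trans ?_
    have h1 : |t - q| ≤ η := by rw [abs_sub_comm, abs_of_pos (by linarith)]; linarith
    calc K * (|t - q| + h (σ k)) ≤ (K + 1) * (η + η) := by
          have := hk2 k hk
          have h2 : |t - q| + h (σ k) ≤ η + η := by linarith
          nlinarith [abs_nonneg (t - q)]
      _ = (ε / 4) ^ 2 := by rw [hη]; field_simp; norm_num
  refine ⟨max k1 k2, fun k hk l hl => ?_⟩
  have h1 := hclose k ((le_max_right _ _).trans hk)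
  have h2 := hclose l ((le_max_right _ _).trans hl)
  have h3 := hk1 k ((le_max_left _ _).trans hk) l ((le_max_left _ _).trans hl)
  simp only [Function.comp, abs_of_nonneg hq0] at h3
  have h4 := dist_triangle4 (c (σ k) i t) (c (σ k) i q) (c (σ l) i q) (c (σ l) i t)
  rw [dist_comm (c (σ l) i q)] at h4
  linarith

/-- Rellich compactness: the high modes are uniformly small by the gradient bound, and finitely many
low modes are Cauchy. -/
lemma tendsto_integral_sub_sq_of_modes {d : ℕ} {Λ E : ℝ} (hΛ : 0 < Λ) {w : ℕ → Vec d → ℝ}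
    {Dw : ℕ → Fin d → Vec d → ℝ} (hw : ∀ k, BddPeriodic Λ (w k))
    (hD : ∀ k i, MemLp (Dw k i) 2 (torusMeasure d Λ))
    (hfc : ∀ k i n, fc Λ (Dw k i) n = waveVec Λ n i * Complex.I * fc Λ (w k) n)
    (hE : ∀ k, ∑ i, ∫ x, Dw k i x ^ 2 ∂torusMeasure d Λ ≤ E)
    (hc : ∀ n, CauchySeq fun k => fc Λ (w k) n) :
    Tendsto (fun p : ℕ × ℕ => ∫ x, (w p.1 x - w p.2 x) ^ 2 ∂torusMeasure d Λ) atTop (𝓝 0) := by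
  have hE0 : 0 ≤ E := (Finset.sum_nonneg fun _ _ => integral_nonneg fun _ => sq_nonneg _).trans (hE 0)
  refine (Metric.tendsto_nhds).2 fun ε hε => ?_
  -- The tail is at most 4E/M times Λ^d, which this makes at most half of ε; the 1 keeps M positive
  -- when E = 0.
  set M := 8 * E / ε + 1 with hM
  have hM0 : 0 < M := by positivity
  have h1 : Tendsto (fun p : ℕ × ℕ => ∑ n ∈ (finite_waveVec_le (d := d) hΛ M).toFinset,
      ‖fc Λ (w p.1) n - fc Λ (w p.2) n‖ ^ 2) atTop (𝓝 0) := by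
    rw [← Finset.sum_const_zero (s := (finite_waveVec_le (d := d) hΛ M).toFinset)]
    refine tendsto_finsetSum _ fun n _ => ?_
    have := (cauchySeq_iff_tendsto_dist_atTop_0.1 (hc n)).pow 2
    simpa [dist_eq_norm] using this
  have hV : 0 < Λ ^ d := pow_pos hΛ d
  filter_upwards [h1.eventually (gt_mem_nhds (show 0 < Λ ^ d * (ε / 2) by positivity))] with p hp
  rw [Real.dist_0_eq_abs, abs_of_nonneg (integral_nonneg fun _ => sq_nonneg _)]
  have h2 := integral_sub_sq_le_of_modes hΛ (hw p.1) (hw p.2) (hD p.1) (hD p.2) (hfc p.1) (hfc p.2) hM0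
  refine lt_of_mul_lt_mul_left (h2.trans_lt ?_) hV.le
  have h3 : 2 / M * (Λ ^ d * ∑ i, ∫ x, Dw p.1 i x ^ 2 ∂torusMeasure d Λ +
      Λ ^ d * ∑ i, ∫ x, Dw p.2 i x ^ 2 ∂torusMeasure d Λ) ≤ 2 / M * (Λ ^ d * E + Λ ^ d * E) := by
    have := hE p.1
    have := hE p.2
    gcongr
  have h4 : 2 / M * (Λ ^ d * E + Λ ^ d * E) ≤ Λ ^ d * (ε / 2) := by
    rw [div_mul_eq_mul_div, div_le_iff₀ hM0, hM]
    have : Λ ^ d * (ε / 2) * (8 * E / ε + 1) = Λ ^ d * (4 * E) + Λ ^ d * (ε / 2) := by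
      field_simp; ring
    rw [this]
    have : 0 < Λ ^ d * (ε / 2) := by positivity
    linarith
  calc _ < Λ ^ d * (ε / 2) + Λ ^ d * (ε / 2) := add_lt_add_of_lt_of_le hp (h3.trans h4)
    _ = _ := by ring

/-! ### Space-time integration and strong convergence of the interpolations -/

section Cylinder

variable {d N : ℕ} {Λ T : ℝ}

lemma cylinderMeasure_eq_prod (d : ℕ) (Λ T : ℝ) :
    cylinderMeasure d Λ T = (torusMeasure d Λ).prod (volume.restrict (Set.Ioo 0 T)) := by
  rw [torusMeasure, Measure.prod_restrict, cylinderMeasure]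
  rfl

lemma isFiniteMeasure_cylinderMeasure (d : ℕ) (hΛ : 0 < Λ) (T : ℝ) :
    IsFiniteMeasure (cylinderMeasure d Λ T) := by
  have := isFiniteMeasure_torusMeasure d hΛ
  rw [cylinderMeasure_eq_prod]
  infer_instance

lemma integral_cylinder (hΛ : 0 < Λ) {E : Type} [NormedAddCommGroup E] [NormedSpace ℝ E]
    {f : Vec d × ℝ → E} (hf : Integrable f (cylinderMeasure d Λ T)) :
    ∫ p, f p ∂cylinderMeasure d Λ T =
      ∫ t in Set.Ioo 0 T, ∫ x, f (x, t) ∂torusMeasure d Λ := by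
  have := isFiniteMeasure_torusMeasure d hΛ
  rw [cylinderMeasure_eq_prod] at hf ⊢
  exact integral_prod_symm f hf

lemma Integrable.integral_space (hΛ : 0 < Λ) {E : Type} [NormedAddCommGroup E] [NormedSpace ℝ E]
    {f : Vec d × ℝ → E} (hf : Integrable f (cylinderMeasure d Λ T)) :
    IntegrableOn (fun t => ∫ x, f (x, t) ∂torusMeasure d Λ) (Set.Ioo 0 T) := by
  have := isFiniteMeasure_torusMeasure d hΛ
  rw [cylinderMeasure_eq_prod] at hf
  exact hf.integral_prod_right

lemma memLp_cylinder_of_bound (hΛ : 0 < Λ) {E : Type} [NormedAddCommGroup E]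
    {f : Vec d × ℝ → E} (hf : AEStronglyMeasurable f (cylinderMeasure d Λ T)) {C : ℝ}
    (hC : ∀ p, ‖f p‖ ≤ C) (q : ENNReal) : MemLp f q (cylinderMeasure d Λ T) := by
  have := isFiniteMeasure_cylinderMeasure d hΛ T
  exact MemLp.of_bound hf C (Eventually.of_forall hC)

/-- The function factors through the countable index of the time step, so joint measurability
reduces to that of each iterate. -/
lemma measurable_floor_family {α : Type} [MeasurableSpace α] {F : ℕ → Vec d → α}
    (hF : ∀ n, Measurable (F n)) (h : ℝ) :
    Measurable fun p : Vec d × ℝ => F ⌊p.2 / h⌋₊ p.1 := by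
  have h1 : Measurable fun q : Vec d × ℕ => F q.2 q.1 := measurable_from_prod_countable_left hF
  exact h1.comp (measurable_fst.prodMk (Nat.measurable_floor.comp (measurable_snd.div_const h)))

variable {u0 : Vec d → Vec N} {h : ℝ}

lemma measurable_approx (hu : BallMap Λ u0) (hh : 0 < h) : Measurable (approx h u0) :=
  measurable_floor_family (fun n => (hu.iterate hh n).measurable) h

lemma norm_approx_le (hu : BallMap Λ u0) (hh : 0 < h) (p : Vec d × ℝ) : ‖approx h u0 p‖ ≤ 1 :=
  (hu.interp hh p.2).norm_le p.1

lemma memLp_approx (hΛ : 0 < Λ) (hu : BallMap Λ u0) (hh : 0 < h) (q : ENNReal) :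
    MemLp (approx h u0) q (cylinderMeasure d Λ T) :=
  memLp_cylinder_of_bound hΛ (measurable_approx hu hh).aestronglyMeasurable (norm_approx_le hu hh) q

lemma integral_norm_sq_eq_norm_toLp_sq {X : Type} [MeasurableSpace X] {μ : Measure X}
    {f : X → Vec N} (hf : MemLp f 2 μ) : ∫ x, ‖f x‖ ^ 2 ∂μ = ‖hf.toLp f‖ ^ 2 := by
  rw [← real_inner_self_eq_norm_sq, L2.inner_def]
  refine integral_congr_ae ?_
  filter_upwards [hf.coeFn_toLp] with x hx
  rw [hx, real_inner_self_eq_norm_sq]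

lemma integrable_norm_sq {X : Type} [MeasurableSpace X] {μ : Measure X}
    {f : X → Vec N} (hf : MemLp f 2 μ) : Integrable (fun x => ‖f x‖ ^ 2) μ := by
  exact hf.norm.integrable_sq

/-- Cauchy sequences in `L²` of maps to the unit ball, periodic in space, converge to such a map. -/
lemma exists_limit_of_cauchy (hΛ : 0 < Λ) {U : ℕ → Vec d × ℝ → Vec N}
    (hU : ∀ k, MemLp (U k) 2 (cylinderMeasure d Λ T)) (hU1 : ∀ k p, ‖U k p‖ ≤ 1)
    (hc : Tendsto (fun p : ℕ × ℕ => ∫ x, ‖U p.1 x - U p.2 x‖ ^ 2 ∂cylinderMeasure d Λ T)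
      atTop (𝓝 0)) :
    ∃ u : Vec d × ℝ → Vec N, Measurable u ∧ (∀ t, IsPeriodic Λ fun x => u (x, t)) ∧
      (∀ p, ‖u p‖ ≤ 1) ∧ TendstoStronglyL2 (cylinderMeasure d Λ T) U u := by
  have : Fact ((1 : ENNReal) ≤ 2) := ⟨by norm_num⟩
  have hcauchy : CauchySeq fun k => (hU k).toLp (U k) := by
    rw [cauchySeq_iff_tendsto_dist_atTop_0]
    have h1 := hc.sqrt
    rw [Real.sqrt_zero] at h1
    refine h1.congr fun p => ?_
    rw [dist_eq_norm, ← MemLp.toLp_sub, Real.sqrt_eq_iff_mul_self_eq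
      (integral_nonneg fun _ => sq_nonneg _) (norm_nonneg _), ← pow_two,
      ← integral_norm_sq_eq_norm_toLp_sq]
    rfl
  obtain ⟨v, hv⟩ := cauchySeq_tendsto_of_complete hcauchy
  have hvL : MemLp v 2 (cylinderMeasure d Λ T) := Lp.memLp v
  have hconv : Tendsto (fun k => eLpNorm (U k - ⇑v) 2 (cylinderMeasure d Λ T)) atTop (𝓝 0) := by
    have := (Lp.tendsto_Lp_iff_tendsto_eLpNorm'' U hU v hvL).1 (by rwa [Lp.toLp_coeFn])
    exact this
  have hv1 : ∀ᵐ p ∂cylinderMeasure d Λ T, ‖v p‖ ≤ 1 := by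
    obtain ⟨ns, -, hns⟩ := (tendstoInMeasure_of_tendsto_eLpNorm (by norm_num)
      (fun k => (hU k).1) hvL.1 hconv).exists_seq_tendsto_ae
    filter_upwards [hns] with p hp
    exact le_of_tendsto hp.norm (Eventually.of_forall fun k => hU1 _ _)
  let g := hvL.1.mk v
  have hg : Measurable g := hvL.1.stronglyMeasurable_mk.measurable
  -- Clipping and reduction to the cell make the bound and the periodicity hold everywhere, while
  -- changing the L² limit only on a null set.
  let clip : Vec N → Vec N := fun y => if ‖y‖ ≤ 1 then y else 0
  have hclip : Measurable clip :=
    Measurable.ite (measurableSet_le measurable_norm measurable_const) measurable_id measurable_const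
  let u : Vec d × ℝ → Vec N := fun p => clip (g (cellFract Λ p.1, p.2))
  have hum : Measurable u := hclip.comp (hg.comp
    (((measurable_cellFract Λ).comp measurable_fst).prodMk measurable_snd))
  have huv : ∀ᵐ p ∂cylinderMeasure d Λ T, v p = u p := by
    have hcell : ∀ᵐ p ∂cylinderMeasure d Λ T, p ∈ cell d Λ ×ˢ Set.Ioo 0 T :=
      ae_restrict_mem ((measurableSet_cell d hΛ).prod measurableSet_Ioo)
    filter_upwards [hvL.1.ae_eq_mk, hv1, hcell] with p hp hp1 hpc
    have : u p = clip (g p) := by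
      simp only [u]
      rw [cellFract_of_mem hΛ hpc.1]
    rw [this, show g p = v p from hp.symm]
    exact (if_pos hp1).symm
  have hu1 : ∀ p, ‖u p‖ ≤ 1 := fun p => by
    simp only [u, clip]
    split_ifs with hif
    · exact hif
    · simp
  refine ⟨u, hum, fun t => isPeriodic_comp_cellFract hΛ fun y => clip (g (y, t)), hu1, hU,
    memLp_cylinder_of_bound hΛ hum.aestronglyMeasurable hu1 2, ?_⟩
  refine hconv.congr fun k => eLpNorm_congr_ae ?_
  filter_upwards [huv] with p hp
  simp [hp]

/-- Compactness is proved for the smoothed maps at each fixed time, where the gradient bound is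
available, and passed to the maps themselves by ‖u - G u‖² ≤ h E. The subsequence comes from the
coefficients and does not depend on the time. -/
lemma exists_strong_limit (hΛ : 0 < Λ) (hu : BallMap Λ u0) {E : ℝ}
    (hE : ∀ h, 0 < h → energy Λ h u0 ≤ h * E) {h : ℕ → ℝ} (h_pos : ∀ k, 0 < h k)
    (h_lim : Tendsto h atTop (𝓝 0)) :
    ∃ (σ : ℕ → ℕ) (u : Vec d × ℝ → Vec N), StrictMono σ ∧ Measurable u ∧
      (∀ t, IsPeriodic Λ fun x => u (x, t)) ∧ (∀ p, ‖u p‖ ≤ 1) ∧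
      TendstoStronglyL2 (cylinderMeasure d Λ T) (fun k => approx (h (σ k)) u0) u := by
  have hfin := isFiniteMeasure_torusMeasure d hΛ
  have hfinc := isFiniteMeasure_cylinderMeasure d hΛ T
  have hE0 : 0 ≤ E := nonneg_of_energy_le hΛ one_pos hu (hE 1 one_pos)
  set V := (torusMeasure d Λ).real Set.univ
  let c : ℕ → (Fin N × (Fin d → ℤ)) → ℝ → ℂ := fun k j t =>
    fc Λ (heatS (h k) fun x => interp (h k) u0 t x j.1) j.2
  have hb := fun k t a => (hu.interp (h_pos k) t).bddPeriodic a
  have hint1 : ∀ k t a, ∫ x, interp (h k) u0 t x a ^ 2 ∂torusMeasure d Λ ≤ V := fun k t a => by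
    refine (le_abs_self _).trans ((abs_integral_le hΛ (C := 1) fun x => ?_).trans (one_mul V).le)
    rw [abs_pow]
    exact pow_le_one₀ (abs_nonneg _) ((hu.interp (h_pos k) t).abs_apply_le a x)
  have hcb : ∀ k j t, ‖c k j t‖ ≤ √(Λ ^ d * V) := fun k j t => by
    refine Real.le_sqrt_of_sq_le ?_
    simp only [c]
    rw [fc_heatS hΛ (h_pos k) (hb k t j.1), norm_mul, mul_pow]
    have h1 := norm_fc_sq_le hΛ ((hb k t j.1).memLp hΛ 2) j.2
    have h2 : ‖(Real.exp (-h k * ‖waveVec Λ j.2‖ ^ 2) : ℂ)‖ ^ 2 ≤ 1 := by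
      rw [Complex.norm_real, Real.norm_of_nonneg (Real.exp_pos _).le]
      refine pow_le_one₀ (Real.exp_pos _).le (Real.exp_le_one_iff.2 ?_)
      nlinarith [h_pos k, sq_nonneg ‖waveVec Λ j.2‖]
    refine (mul_le_of_le_one_left (sq_nonneg _) h2).trans (h1.trans ?_)
    exact mul_le_mul_of_nonneg_left (hint1 k t j.1) (pow_pos hΛ d).le
  obtain ⟨σ, hσ, hcauchy⟩ := exists_subseq_cauchySeq (c := c) (K := Λ ^ d * E) hcb
    (mul_nonneg (pow_pos hΛ d).le hE0) h_lim
    (fun k j s t hs ht => norm_fc_interp_sub_sq_le hΛ (h_pos k) hu (hE _ (h_pos k)) j.1 j.2 hs ht)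
  have hlimσ : Tendsto (fun k => h (σ k)) atTop (𝓝 0) := h_lim.comp hσ.tendsto_atTop
  have hw : ∀ t, 0 ≤ t → ∀ a, Tendsto (fun p : ℕ × ℕ => ∫ x,
      (heatS (h (σ p.1)) (fun x => interp (h (σ p.1)) u0 t x a) x -
        heatS (h (σ p.2)) (fun x => interp (h (σ p.2)) u0 t x a) x) ^ 2 ∂torusMeasure d Λ)
      atTop (𝓝 0) := fun t ht a =>
    tendsto_integral_sub_sq_of_modes hΛ
      (w := fun k => heatS (h (σ k)) (fun x => interp (h (σ k)) u0 t x a))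
      (Dw := fun k i => gradS (h (σ k)) i (fun x => interp (h (σ k)) u0 t x a))
      (fun k => (hb (σ k) t a).heatS (h_pos _))
      (fun k i => ((hb (σ k) t a).gradS (h_pos _) i).memLp hΛ 2)
      (fun k i n => fc_gradS hΛ (h_pos _) i (hb (σ k) t a) n)
      (fun k => sum_integral_gradS_iterate_le hΛ (h_pos _) hu (hE _ (h_pos _)) _ a)
      (fun n => hcauchy (a, n) t ht)
  -- The difference of two maps is split into two smoothing errors and the difference of the
  -- smoothed maps; the factor 3 comes from (A + B - D)² ≤ 3(A² + B² + D²).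
  have hslice : ∀ t, 0 ≤ t → Tendsto (fun p : ℕ × ℕ => ∫ x,
      ‖interp (h (σ p.1)) u0 t x - interp (h (σ p.2)) u0 t x‖ ^ 2 ∂torusMeasure d Λ)
      atTop (𝓝 0) := fun t ht => by
    have hfst : Tendsto (fun p : ℕ × ℕ => h (σ p.1)) atTop (𝓝 0) := by
      rw [← prod_atTop_atTop_eq]; exact hlimσ.comp tendsto_fst
    have hsnd : Tendsto (fun p : ℕ × ℕ => h (σ p.2)) atTop (𝓝 0) := by
      rw [← prod_atTop_atTop_eq]; exact hlimσ.comp tendsto_snd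
    have hbd : Tendsto (fun p : ℕ × ℕ => ∑ a : Fin N, 3 * (h (σ p.1) * E + ∫ x,
      (heatS (h (σ p.1)) (fun x => interp (h (σ p.1)) u0 t x a) x -
        heatS (h (σ p.2)) (fun x => interp (h (σ p.2)) u0 t x a) x) ^ 2 ∂torusMeasure d Λ +
        h (σ p.2) * E)) atTop (𝓝 0) := by
      rw [← Finset.sum_const_zero (s := (Finset.univ : Finset (Fin N)))]
      refine tendsto_finsetSum _ fun a _ => ?_
      simpa using (((hfst.mul_const E).add (hw t ht a)).add (hsnd.mul_const E)).const_mul 3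
    refine squeeze_zero (fun _ => integral_nonneg fun _ => sq_nonneg _) (fun p => ?_) hbd
    have hsq : ∀ {f : Vec d → ℝ}, BddPeriodic Λ f →
        Integrable (fun x => f x ^ 2) (torusMeasure d Λ) := fun hf => (hf.memLp hΛ 2).integrable_sq
    simp_rw [norm_sq_eq_sum]
    rw [integral_finsetSum _ fun a _ => by
      simpa only [PiLp.sub_apply] using hsq ((hb (σ p.1) t a).sub (hb (σ p.2) t a))]
    refine Finset.sum_le_sum fun a _ => ?_
    set f1 : Vec d → ℝ := fun x => interp (h (σ p.1)) u0 t x a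
    set f2 : Vec d → ℝ := fun x => interp (h (σ p.2)) u0 t x a
    have b1 : BddPeriodic Λ f1 := hb (σ p.1) t a
    have b2 : BddPeriodic Λ f2 := hb (σ p.2) t a
    have w1 := b1.heatS (h_pos (σ p.1))
    have w2 := b2.heatS (h_pos (σ p.2))
    have d1 : ∫ x, (f1 x - heatS (h (σ p.1)) f1 x) ^ 2 ∂torusMeasure d Λ ≤ h (σ p.1) * E :=
      (integral_sub_heatS_sq_le hΛ (h_pos _) b1).trans
        (deficit_iterate_le hΛ (h_pos _) hu (hE _ (h_pos _)) _ a)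
    have d2 : ∫ x, (f2 x - heatS (h (σ p.2)) f2 x) ^ 2 ∂torusMeasure d Λ ≤ h (σ p.2) * E :=
      (integral_sub_heatS_sq_le hΛ (h_pos _) b2).trans
        (deficit_iterate_le hΛ (h_pos _) hu (hE _ (h_pos _)) _ a)
    have i1 := hsq (b1.sub w1)
    have i2 := hsq (b2.sub w2)
    have i3 := hsq (w1.sub w2)
    have i13 : Integrable (fun x => (f1 x - heatS (h (σ p.1)) f1 x) ^ 2 +
      (heatS (h (σ p.1)) f1 x - heatS (h (σ p.2)) f2 x) ^ 2) (torusMeasure d Λ) := i1.add i3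
    calc ∫ x, (interp (h (σ p.1)) u0 t x - interp (h (σ p.2)) u0 t x) a ^ 2 ∂torusMeasure d Λ
        ≤ ∫ x, 3 * ((f1 x - heatS (h (σ p.1)) f1 x) ^ 2 +
            (heatS (h (σ p.1)) f1 x - heatS (h (σ p.2)) f2 x) ^ 2 +
            (f2 x - heatS (h (σ p.2)) f2 x) ^ 2) ∂torusMeasure d Λ := by
          refine integral_mono (by simpa only [PiLp.sub_apply] using hsq (b1.sub b2))
            ((i13.add i2).const_mul 3) fun x => ?_
          simp only [PiLp.sub_apply]
          change (f1 x - f2 x) ^ 2 ≤ _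
          set A := f1 x - heatS (h (σ p.1)) f1 x
          set B := heatS (h (σ p.1)) f1 x - heatS (h (σ p.2)) f2 x
          set D := f2 x - heatS (h (σ p.2)) f2 x
          have : f1 x - f2 x = A + B - D := by simp only [A, B, D]; ring
          rw [this]
          nlinarith [sq_nonneg (A - B), sq_nonneg (A + D), sq_nonneg (B + D)]
      _ = 3 * (∫ x, (f1 x - heatS (h (σ p.1)) f1 x) ^ 2 ∂torusMeasure d Λ +
            ∫ x, (heatS (h (σ p.1)) f1 x - heatS (h (σ p.2)) f2 x) ^ 2 ∂torusMeasure d Λ +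
            ∫ x, (f2 x - heatS (h (σ p.2)) f2 x) ^ 2 ∂torusMeasure d Λ) := by
          rw [integral_const_mul, integral_add i13 i2, integral_add i1 i3]
      _ ≤ _ := by gcongr
  -- Convergence on slices is integrated in time by dominated convergence; the slices are at most 4V
  -- because both maps have length at most 1.
  have hcyl : Tendsto (fun p : ℕ × ℕ => ∫ q,
      ‖approx (h (σ p.1)) u0 q - approx (h (σ p.2)) u0 q‖ ^ 2 ∂cylinderMeasure d Λ T)
      atTop (𝓝 0) := by
    have hi : ∀ p : ℕ × ℕ, Integrable (fun q =>
        ‖approx (h (σ p.1)) u0 q - approx (h (σ p.2)) u0 q‖ ^ 2) (cylinderMeasure d Λ T) := fun p =>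
      integrable_norm_sq ((memLp_approx hΛ hu (h_pos _) 2).sub (memLp_approx hΛ hu (h_pos _) 2))
    have e : ∀ p : ℕ × ℕ, ∫ q,
      ‖approx (h (σ p.1)) u0 q - approx (h (σ p.2)) u0 q‖ ^ 2 ∂cylinderMeasure d Λ T = _ :=
      fun p => integral_cylinder hΛ (hi p)
    simp_rw [e]
    have e0 : ∫ _ in Set.Ioo 0 T, (0 : ℝ) = 0 := by simp
    refine (congrArg (fun y => Tendsto _ atTop (𝓝 y)) e0).mp ?_
    refine tendsto_integral_filter_of_dominated_convergence (l := (atTop : Filter (ℕ × ℕ)))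
      (fun _ => 4 * V)
      (Eventually.of_forall fun p => (Integrable.integral_space hΛ (hi p)).1)
      (Eventually.of_forall fun p => Eventually.of_forall fun t => ?_) (integrable_const _) ?_
    · refine abs_integral_le hΛ fun x => ?_
      rw [abs_pow, abs_norm]
      have h1 := norm_approx_le hu (h_pos (σ p.1)) (x, t)
      have h2 := norm_approx_le hu (h_pos (σ p.2)) (x, t)
      have h3 := norm_sub_le (approx (h (σ p.1)) u0 (x, t)) (approx (h (σ p.2)) u0 (x, t))
      have h4 := norm_nonneg (approx (h (σ p.1)) u0 (x, t) - approx (h (σ p.2)) u0 (x, t))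
      nlinarith
    · filter_upwards [ae_restrict_mem measurableSet_Ioo] with t ht
      exact hslice t ht.1.le
  obtain ⟨u, hum, huper, hu1, huc⟩ := exists_limit_of_cauchy hΛ
    (U := fun k => approx (h (σ k)) u0) (fun k => memLp_approx hΛ hu (h_pos _) 2)
    (fun k p => norm_approx_le hu (h_pos _) p) hcyl
  exact ⟨σ, u, hσ, hum, huper, hu1, huc⟩

end Cylinder

end HMHF

namespace HMHF

/-! ### Components of the approximations on the cylinder -/

section Components

variable {d N : ℕ} {Λ T h E : ℝ} {u0 : Vec d → Vec N}

/-- The components of `u^h`. -/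
noncomputable def uComp (h : ℝ) (u0 : Vec d → Vec N) (a : Fin N) (p : Vec d × ℝ) : ℝ :=
  interp h u0 p.2 p.1 a

/-- The components of `G_h ∗ u^h`. -/
noncomputable def wComp (h : ℝ) (u0 : Vec d → Vec N) (a : Fin N) (p : Vec d × ℝ) : ℝ :=
  heatS h (fun x => interp h u0 p.2 x a) p.1

/-- The components of `∂ᵢ G_h ∗ u^h`. -/
noncomputable def gComp (h : ℝ) (u0 : Vec d → Vec N) (i : Fin d) (a : Fin N) (p : Vec d × ℝ) : ℝ :=
  gradS h i (fun x => interp h u0 p.2 x a) p.1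

/-- The components of `∂ₜ^h (G_h ∗ u^h)`. -/
noncomputable def dComp (h : ℝ) (u0 : Vec d → Vec N) (a : Fin N) (p : Vec d × ℝ) : ℝ :=
  h⁻¹ * (wComp h u0 a p - wComp h u0 a (p.1, p.2 - h))

lemma approxGrad_apply (hu : BallMap Λ u0) (hh : 0 < h) (i : Fin d) (a : Fin N) (p : Vec d × ℝ) :
    approxGrad h u0 i p a = gComp h u0 i a p :=
  gradHeatConv_apply (hu.interp hh _) hh i _ a

lemma approxTimeDeriv_apply (hu : BallMap Λ u0) (hh : 0 < h) (a : Fin N) (p : Vec d × ℝ) :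
    approxTimeDeriv h u0 p a = dComp h u0 a p := by
  simp only [approxTimeDeriv, PiLp.smul_apply, PiLp.sub_apply, smul_eq_mul, dComp, wComp]
  rw [heatConv_apply (hu.interp hh _) hh, heatConv_apply (hu.interp hh _) hh]

lemma measurable_uComp (hu : BallMap Λ u0) (hh : 0 < h) (a : Fin N) : Measurable (uComp h u0 a) :=
  measurable_floor_family (F := fun n x => iterate h u0 n x a)
    (fun n => ((hu.iterate hh n).bddPeriodic a).measurable) h

lemma measurable_wComp (hu : BallMap Λ u0) (hh : 0 < h) (a : Fin N) : Measurable (wComp h u0 a) :=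
  measurable_floor_family (F := fun n => heatS h (fun x => iterate h u0 n x a))
    (fun n => (((hu.iterate hh n).bddPeriodic a).heatS hh).measurable) h

lemma measurable_gComp (hu : BallMap Λ u0) (hh : 0 < h) (i : Fin d) (a : Fin N) :
    Measurable (gComp h u0 i a) :=
  measurable_floor_family (F := fun n => gradS h i (fun x => iterate h u0 n x a))
    (fun n => (((hu.iterate hh n).bddPeriodic a).gradS hh i).measurable) h

lemma measurable_wComp_shift (hu : BallMap Λ u0) (hh : 0 < h) (a : Fin N) :
    Measurable fun p : Vec d × ℝ => wComp h u0 a (p.1, p.2 - h) :=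
  (measurable_wComp hu hh a).comp (measurable_fst.prodMk (measurable_snd.sub_const h))

lemma measurable_dComp (hu : BallMap Λ u0) (hh : 0 < h) (a : Fin N) : Measurable (dComp h u0 a) :=
  ((measurable_wComp hu hh a).sub (measurable_wComp_shift hu hh a)).const_mul _

lemma abs_sconv_le {g f : Vec d → ℝ} (hg : Integrable g) (hf : ∀ x, |f x| ≤ 1) (x : Vec d) :
    |sconv g f x| ≤ ∫ z, |g z| := by
  refine norm_integral_le_of_norm_le (f := fun z => g z * f (x - z)) hg.abs
    (Eventually.of_forall fun z => ?_)
  rw [norm_mul]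
  exact mul_le_of_le_one_right (norm_nonneg _) (hf _)

lemma abs_uComp_le (hu : BallMap Λ u0) (hh : 0 < h) (a : Fin N) (p : Vec d × ℝ) :
    |uComp h u0 a p| ≤ 1 := (hu.interp hh p.2).abs_apply_le a _

lemma abs_wComp_le (hu : BallMap Λ u0) (hh : 0 < h) (a : Fin N) (p : Vec d × ℝ) :
    |wComp h u0 a p| ≤ 1 := by
  refine (abs_sconv_le (integrable_heatKernel d hh)
    (fun x => (hu.interp hh p.2).abs_apply_le a x) _).trans (le_of_eq ?_)
  simp_rw [abs_of_nonneg (heatKernel_nonneg hh _)]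
  exact integral_heatKernel d hh

lemma abs_gComp_le (hu : BallMap Λ u0) (hh : 0 < h) (i : Fin d) (a : Fin N) (p : Vec d × ℝ) :
    |gComp h u0 i a p| ≤ ∫ z, |gradKernel d h i z| :=
  abs_sconv_le (integrable_gradKernel hh i) (fun x => (hu.interp hh p.2).abs_apply_le a x) _

lemma abs_dComp_le (hu : BallMap Λ u0) (hh : 0 < h) (a : Fin N) (p : Vec d × ℝ) :
    |dComp h u0 a p| ≤ h⁻¹ * 2 := by
  rw [dComp, abs_mul, abs_of_pos (inv_pos.2 hh)]
  refine mul_le_mul_of_nonneg_left ?_ (inv_pos.2 hh).le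
  have h1 := abs_wComp_le hu hh a p
  have h2 := abs_wComp_le hu hh a (p.1, p.2 - h)
  exact (abs_sub _ _).trans (by linarith)

lemma memLp_uComp (hΛ : 0 < Λ) (hu : BallMap Λ u0) (hh : 0 < h) (a : Fin N) :
    MemLp (uComp h u0 a) 2 (cylinderMeasure d Λ T) :=
  memLp_cylinder_of_bound hΛ (measurable_uComp hu hh a).aestronglyMeasurable (abs_uComp_le hu hh a) 2

lemma memLp_wComp (hΛ : 0 < Λ) (hu : BallMap Λ u0) (hh : 0 < h) (a : Fin N) :
    MemLp (wComp h u0 a) 2 (cylinderMeasure d Λ T) :=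
  memLp_cylinder_of_bound hΛ (measurable_wComp hu hh a).aestronglyMeasurable (abs_wComp_le hu hh a) 2

lemma memLp_wComp_shift (hΛ : 0 < Λ) (hu : BallMap Λ u0) (hh : 0 < h) (a : Fin N) :
    MemLp (fun p : Vec d × ℝ => wComp h u0 a (p.1, p.2 - h)) 2 (cylinderMeasure d Λ T) :=
  memLp_cylinder_of_bound hΛ (measurable_wComp_shift hu hh a).aestronglyMeasurable
    (fun _ => abs_wComp_le hu hh a _) 2

lemma memLp_gComp (hΛ : 0 < Λ) (hu : BallMap Λ u0) (hh : 0 < h) (i : Fin d) (a : Fin N) :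
    MemLp (gComp h u0 i a) 2 (cylinderMeasure d Λ T) :=
  memLp_cylinder_of_bound hΛ (measurable_gComp hu hh i a).aestronglyMeasurable
    (abs_gComp_le hu hh i a) 2

lemma memLp_dComp (hΛ : 0 < Λ) (hu : BallMap Λ u0) (hh : 0 < h) (a : Fin N) :
    MemLp (dComp h u0 a) 2 (cylinderMeasure d Λ T) :=
  memLp_cylinder_of_bound hΛ (measurable_dComp hu hh a).aestronglyMeasurable
    (abs_dComp_le hu hh a) 2

/-! ### Uniform bounds -/

lemma integral_cylinder_le (hΛ : 0 < Λ) (hT : 0 < T) {f : Vec d × ℝ → ℝ}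
    (hf : Integrable f (cylinderMeasure d Λ T)) {B : ℝ}
    (hB : ∀ t, ∫ x, f (x, t) ∂torusMeasure d Λ ≤ B) :
    ∫ p, f p ∂cylinderMeasure d Λ T ≤ T * B := by
  rw [integral_cylinder hΛ hf]
  calc _ ≤ ∫ _ in Set.Ioo 0 T, B :=
        integral_mono (Integrable.integral_space hΛ hf) (integrable_const _) hB
    _ = _ := by simp [hT.le]

lemma integral_space_gComp_sq_le (hΛ : 0 < Λ) (hh : 0 < h) (hu : BallMap Λ u0)
    (hE : energy Λ h u0 ≤ h * E) (i : Fin d) (a : Fin N) (t : ℝ) :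
    ∫ x, gComp h u0 i a (x, t) ^ 2 ∂torusMeasure d Λ ≤ E :=
  (Finset.single_le_sum
    (f := fun i => ∫ x, gradS h i (fun x => iterate h u0 ⌊t / h⌋₊ x a) x ^ 2 ∂torusMeasure d Λ)
    (fun _ _ => integral_nonneg fun _ => sq_nonneg _) (Finset.mem_univ i)).trans
    (sum_integral_gradS_iterate_le hΛ hh hu hE ⌊t / h⌋₊ a)

lemma integral_gComp_sq_le (hΛ : 0 < Λ) (hT : 0 < T) (hh : 0 < h) (hu : BallMap Λ u0)
    (hE : energy Λ h u0 ≤ h * E) (i : Fin d) (a : Fin N) :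
    ∫ p, gComp h u0 i a p ^ 2 ∂cylinderMeasure d Λ T ≤ T * E :=
  integral_cylinder_le hΛ hT (memLp_gComp hΛ hu hh i a).integrable_sq
    (integral_space_gComp_sq_le hΛ hh hu hE i a)

lemma integral_wComp_sub_uComp_sq_le (hΛ : 0 < Λ) (hT : 0 < T) (hh : 0 < h) (hu : BallMap Λ u0)
    (hE : energy Λ h u0 ≤ h * E) (a : Fin N) :
    ∫ p, (wComp h u0 a p - uComp h u0 a p) ^ 2 ∂cylinderMeasure d Λ T ≤ T * (h * E) := by
  refine integral_cylinder_le hΛ hT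
    ((memLp_wComp hΛ hu hh a).sub (memLp_uComp hΛ hu hh a)).integrable_sq fun t => ?_
  refine le_trans (integral_mono_of_nonneg (Eventually.of_forall fun _ => sq_nonneg _) ?_
    (Eventually.of_forall fun x => (sub_sq_comm _ _).le))
    ((integral_sub_heatS_sq_le hΛ hh ((hu.interp hh t).bddPeriodic a)).trans
    (deficit_iterate_le hΛ hh hu hE _ a))
  exact ((((hu.interp hh t).bddPeriodic a).sub
    (((hu.interp hh t).bddPeriodic a).heatS hh)).memLp hΛ 2).integrable_sq

/-- Each value of the step function is taken on an interval of length h. -/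
lemma integral_floor_le (hh : 0 < h) {D : ℕ → ℝ} (hD : ∀ n, 0 ≤ D n) {S : ℝ}
    (hS : ∀ n, ∑ j ∈ Finset.range n, D j ≤ S) :
    ∫ t in Set.Ioo 0 T, D ⌊t / h⌋₊ ≤ h * S := by
  obtain ⟨M, hM⟩ := exists_nat_gt (T / h)
  have e : ∀ t ∈ Set.Ioo 0 T, D ⌊t / h⌋₊ = ∑ j ∈ Finset.range M,
      (Set.Ico (j * h) ((j + 1) * h)).indicator (fun _ => D j) t := fun t ht => by
    have hlt : ⌊t / h⌋₊ < M := by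
      rw [Nat.floor_lt (div_nonneg ht.1.le hh.le)]
      exact (by gcongr; exact ht.2 : t / h < T / h).trans hM
    rw [Finset.sum_eq_single_of_mem ⌊t / h⌋₊ (Finset.mem_range.2 hlt)]
    · rw [Set.indicator_of_mem]
      exact ⟨(le_div_iff₀ hh).1 (Nat.floor_le (div_nonneg ht.1.le hh.le)),
        (div_lt_iff₀ hh).1 (Nat.lt_floor_add_one _)⟩
    · intro j _ hj
      rw [Set.indicator_of_notMem]
      intro hmem
      refine hj ((Nat.floor_eq_iff (div_nonneg ht.1.le hh.le)).2
        ⟨(le_div_iff₀ hh).2 hmem.1, (div_lt_iff₀ hh).2 hmem.2⟩).symm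
  rw [setIntegral_congr_fun measurableSet_Ioo e, integral_finsetSum]
  · calc _ ≤ ∑ j ∈ Finset.range M, h * D j := Finset.sum_le_sum fun j _ => by
          have hi : Integrable ((Set.Ico (j * h) ((j + 1) * h)).indicator fun _ => D j) := by
            rw [integrable_indicator_iff measurableSet_Ico]
            exact integrableOn_const (by simp)
          calc _ ≤ ∫ t, (Set.Ico (j * h) ((j + 1) * h)).indicator (fun _ => D j) t :=
                setIntegral_le_integral hi
                  (Eventually.of_forall fun t => Set.indicator_nonneg (fun _ _ => hD j) t)
            _ = _ := by
                rw [integral_indicator measurableSet_Ico]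
                simp only [integral_const, MeasurableSet.univ, measureReal_restrict_apply,
                  Set.univ_inter, Real.volume_real_Ico, smul_eq_mul]
                rw [max_eq_left (by nlinarith)]
                ring
      _ ≤ _ := by
          rw [← Finset.mul_sum]
          exact mul_le_mul_of_nonneg_left (hS M) hh.le
  · intro j _
    refine Integrable.integrableOn ?_
    rw [integrable_indicator_iff measurableSet_Ico]
    exact integrableOn_const (by simp)

/-- Truncated subtraction agrees with the extension by the initial map to negative times: for t < h
both sides are the iterate 0. -/
lemma interp_sub_step (hh : 0 < h) (u0 : Vec d → Vec N) (t : ℝ) :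
    interp h u0 (t - h) = iterate h u0 (⌊t / h⌋₊ - 1) := by
  rw [interp, sub_div, div_self hh.ne', Nat.floor_sub_one]

/-- On the n-th time interval the squared quotient integrates to at most h⁻² times the dissipation
of the step that produced u^n. Each interval has length h and the dissipations sum to at most h E,
so all powers of h cancel. -/
lemma integral_dComp_sq_le (hΛ : 0 < Λ) (hh : 0 < h) (hu : BallMap Λ u0)
    (hE : energy Λ h u0 ≤ h * E) (a : Fin N) :
    ∫ p, dComp h u0 a p ^ 2 ∂cylinderMeasure d Λ T ≤ E := by
  have hE0 := nonneg_of_energy_le hΛ hh hu hE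
  have hi := (memLp_dComp (T := T) hΛ hu hh a).integrable_sq
  rw [integral_cylinder hΛ hi]
  -- The dissipation is shifted by one step; on the initial interval the backward difference
  -- vanishes, hence the value 0.
  let D : ℕ → ℝ := fun n => n.casesOn 0 fun j => dissipation Λ h u0 j
  have hD : ∀ n, 0 ≤ D n := fun n => by
    cases n with
    | zero => exact le_rfl
    | succ j => exact dissipation_nonneg j
  have hsum : ∀ n, ∑ j ∈ Finset.range n, D j ≤ h * E := fun n => by
    cases n with
    | zero => simpa using mul_nonneg hh.le hE0
    | succ n =>
      rw [Finset.sum_range_succ']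
      simpa [D] using sum_dissipation_le hΛ hh hu hE n
  have hslice : ∀ t, ∫ x, dComp h u0 a (x, t) ^ 2 ∂torusMeasure d Λ ≤
      (h⁻¹) ^ 2 * D ⌊t / h⌋₊ := fun t => by
    simp only [dComp, wComp, mul_pow]
    rw [integral_const_mul]
    refine mul_le_mul_of_nonneg_left ?_ (sq_nonneg _)
    rw [interp_sub_step hh, interp]
    generalize ⌊t / h⌋₊ = n
    cases n with
    | zero => simp [D]
    | succ n =>
      simp only [Nat.add_sub_cancel, D]
      have hb := fun j => (hu.iterate hh j).bddPeriodic a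
      simp_rw [← heatS_sub hh (hb (n + 1)) (hb n)]
      exact Finset.single_le_sum (f := fun a => ∫ x, heatS h
        (fun y => iterate h u0 (n + 1) y a - iterate h u0 n y a) x ^ 2 ∂torusMeasure d Λ)
        (fun a _ => integral_nonneg fun _ => sq_nonneg _) (Finset.mem_univ a)
  have hDi : IntegrableOn (fun t => (h⁻¹) ^ 2 * D ⌊t / h⌋₊) (Set.Ioo 0 T) := by
    refine Integrable.const_mul (Measure.integrableOn_of_bounded (M := h * E) (by simp)
      ((measurable_of_countable D).comp (Nat.measurable_floor.comp
        (measurable_id.div_const h))).aestronglyMeasurable (Eventually.of_forall fun t => ?_)) _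
    change ‖D ⌊t / h⌋₊‖ ≤ _
    rw [Real.norm_of_nonneg (hD _)]
    exact (Finset.single_le_sum (fun j _ => hD j) (Finset.self_mem_range_succ _)).trans (hsum _)
  calc _ ≤ ∫ t in Set.Ioo 0 T, (h⁻¹) ^ 2 * D ⌊t / h⌋₊ :=
        integral_mono (Integrable.integral_space hΛ hi) hDi hslice
    _ = (h⁻¹) ^ 2 * ∫ t in Set.Ioo 0 T, D ⌊t / h⌋₊ := integral_const_mul _ _
    _ ≤ (h⁻¹) ^ 2 * (h * (h * E)) :=
        mul_le_mul_of_nonneg_left (integral_floor_le hh hD hsum) (sq_nonneg _)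
    _ = E := by field_simp

/-! ### The limit along a subsequence and its components -/

lemma strongConv_apply {X : Type} [MeasurableSpace X] {μ : Measure X} {f : ℕ → X → Vec N}
    {g : X → Vec N} (hf : TendstoStronglyL2 μ f g) (a : Fin N) :
    StrongConv μ (fun k x => f k x a) (fun x => g x a) := by
  obtain ⟨h1, h2, h3⟩ := hf
  refine ⟨fun k => memLp_apply (h1 k) a, memLp_apply h2 a, ?_⟩
  have h4 : Tendsto (fun k => ∫ x, ‖(f k - g) x‖ ^ 2 ∂μ) atTop (𝓝 0) := by
    have h5 : Tendsto (fun k => (eLpNorm (f k - g) 2 μ).toReal ^ 2) atTop (𝓝 0) := by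
      have := ((ENNReal.tendsto_toReal ENNReal.zero_ne_top).comp h3).pow 2
      simpa using this
    refine h5.congr fun k => ?_
    rw [integral_norm_sq_eq_norm_toLp_sq ((h1 k).sub h2), Lp.norm_toLp]
  refine squeeze_zero (fun _ => integral_nonneg fun _ => sq_nonneg _) (fun k => ?_) h4
  refine integral_mono ((memLp_apply (h1 k) a).sub (memLp_apply h2 a)).integrable_sq
    (integrable_norm_sq ((h1 k).sub h2)) fun x => ?_
  change (f k x a - g x a) ^ 2 ≤ ‖f k x - g x‖ ^ 2
  rw [← sq_abs]
  exact pow_le_pow_left₀ (abs_nonneg _) (abs_apply_le_norm (f k x - g x) a) 2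

/-- Convergence of the components of the scheme along a sequence of step sizes. -/
structure SchemeLimit (Λ T E : ℝ) (u0 : Vec d → Vec N) (h : ℕ → ℝ)
    (u : Fin N → Vec d × ℝ → ℝ) (D : Fin d → Fin N → Vec d × ℝ → ℝ)
    (ut : Fin N → Vec d × ℝ → ℝ) : Prop where
  ball : BallMap Λ u0
  energy_le : ∀ k, energy Λ (h k) u0 ≤ h k * E
  h_pos : ∀ k, 0 < h k
  h_lim : Tendsto h atTop (𝓝 0)
  measurable : ∀ a, Measurable (u a)
  abs_le : ∀ a p, |u a p| ≤ 1
  sum_sq_le : ∀ p, ∑ a, u a p ^ 2 ≤ 1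
  conv : ∀ a, StrongConv (cylinderMeasure d Λ T) (fun k => uComp (h k) u0 a) (u a)
  conv_grad : ∀ i a, WeakConv (cylinderMeasure d Λ T) (fun k => gComp (h k) u0 i a) (D i a)
  conv_time : ∀ a, WeakConv (cylinderMeasure d Λ T) (fun k => dComp (h k) u0 a) (ut a)

lemma StrongConv.subseq {X : Type} [MeasurableSpace X] {μ : Measure X} {F : ℕ → X → ℝ} {f : X → ℝ}
    {σ : ℕ → ℕ} (hF : StrongConv μ F f) (hσ : StrictMono σ) : StrongConv μ (fun k => F (σ k)) f :=
  ⟨fun _ => hF.memLp _, hF.memLp_lim, hF.tendsto.comp hσ.tendsto_atTop⟩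

lemma exists_schemeLimit (hΛ : 0 < Λ) (hT : 0 < T) (hu : BallMap Λ u0)
    (hE : ∀ h, 0 < h → energy Λ h u0 ≤ h * E) {h : ℕ → ℝ} (h_pos : ∀ k, 0 < h k)
    (h_lim : Tendsto h atTop (𝓝 0)) :
    ∃ (σ : ℕ → ℕ) (u : Vec d × ℝ → Vec N) (D : Fin d → Fin N → Vec d × ℝ → ℝ)
      (ut : Fin N → Vec d × ℝ → ℝ), StrictMono σ ∧
      (∀ t, IsPeriodic Λ fun x => u (x, t)) ∧ (∀ p, ‖u p‖ ≤ 1) ∧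
      TendstoStronglyL2 (cylinderMeasure d Λ T) (fun k => approx (h (σ k)) u0) u ∧
      SchemeLimit Λ T E u0 (fun k => h (σ k)) (fun a p => u p a) D ut := by
  have := isFiniteMeasure_cylinderMeasure d hΛ T
  have hE0 : 0 ≤ E := nonneg_of_energy_le hΛ one_pos hu (hE 1 one_pos)
  obtain ⟨σ, u, hσ, hum, huper, hu1, huc⟩ := exists_strong_limit (T := T) hΛ hu hE h_pos h_lim
  -- Time quotients (`none`) and spatial derivatives (`some i`) are collected in one finite family,
  -- so that a common subsequence is extracted.
  let F : Option (Fin d) × Fin N → ℕ → Vec d × ℝ → ℝ := fun j k =>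
    j.1.elim (dComp (h (σ k)) u0 j.2) fun i => gComp (h (σ k)) u0 i j.2
  obtain ⟨σ', f, hσ', hf⟩ := exists_weakConv_finset (μ := cylinderMeasure d Λ T) (F := F)
    (fun j k => by
      obtain ⟨j, a⟩ := j
      cases j with
      | none => exact memLp_dComp hΛ hu (h_pos _) a
      | some i => exact memLp_gComp hΛ hu (h_pos _) i a) (B := T * E + E)
    (fun j k => by
      obtain ⟨j, a⟩ := j
      have : 0 ≤ T * E := mul_nonneg hT.le hE0
      cases j with
      | none =>
        exact (integral_dComp_sq_le (T := T) hΛ (h_pos _) hu (hE _ (h_pos _)) a).trans (by linarith)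
      | some i =>
        exact (integral_gComp_sq_le hΛ hT (h_pos _) hu (hE _ (h_pos _)) i a).trans
          (by linarith)) Finset.univ
  refine ⟨σ ∘ σ', u, fun i a => f (some i, a), fun a => f (none, a), hσ.comp hσ', huper, hu1,
    ⟨fun k => huc.1 _, huc.2.1, huc.2.2.comp hσ'.tendsto_atTop⟩,
    ⟨hu, fun k => hE _ (h_pos _), fun k => h_pos _, h_lim.comp (hσ.comp hσ').tendsto_atTop,
    fun a => (EuclideanSpace.proj (𝕜 := ℝ) a).continuous.measurable.comp hum,
    fun a p => (abs_apply_le_norm _ a).trans (hu1 p),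
    fun p => by
      rw [← norm_sq_eq_sum]
      exact pow_le_one₀ (norm_nonneg _) (hu1 p),
    fun a => (strongConv_apply huc a).subseq hσ',
    fun i a => hf (some i, a) (Finset.mem_univ _), fun a => hf (none, a) (Finset.mem_univ _)⟩⟩

namespace SchemeLimit

variable {h : ℕ → ℝ} {u : Fin N → Vec d × ℝ → ℝ} {D : Fin d → Fin N → Vec d × ℝ → ℝ}
  {ut : Fin N → Vec d × ℝ → ℝ}

lemma conv_w (hΛ : 0 < Λ) (hT : 0 < T) (H : SchemeLimit Λ T E u0 h u D ut) (a : Fin N) :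
    StrongConv (cylinderMeasure d Λ T) (fun k => wComp (h k) u0 a) (u a) := by
  refine (H.conv a).of_sub (fun k => memLp_wComp hΛ H.ball (H.h_pos k) a) ?_
  have h1 : Tendsto (fun k => T * (h k * E)) atTop (𝓝 0) := by
    simpa using (H.h_lim.mul_const E).const_mul T
  exact squeeze_zero (fun _ => integral_nonneg fun _ => sq_nonneg _)
    (fun k => integral_wComp_sub_uComp_sq_le hΛ hT (H.h_pos k) H.ball (H.energy_le k) a) h1

/-- The shift costs exactly h times the difference quotient, whose L² norm is bounded. -/
lemma conv_w_shift (hΛ : 0 < Λ) (hT : 0 < T) (H : SchemeLimit Λ T E u0 h u D ut) (a : Fin N) :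
    StrongConv (cylinderMeasure d Λ T) (fun k p => wComp (h k) u0 a (p.1, p.2 - h k)) (u a) := by
  refine (H.conv_w hΛ hT a).of_sub (fun k => memLp_wComp_shift hΛ H.ball (H.h_pos k) a) ?_
  have h1 : Tendsto (fun k => h k ^ 2 * E) atTop (𝓝 0) := by
    simpa using (H.h_lim.pow 2).mul_const E
  refine squeeze_zero (fun _ => integral_nonneg fun _ => sq_nonneg _) (fun k => ?_) h1
  refine le_trans (le_of_eq ?_) (mul_le_mul_of_nonneg_left
    (integral_dComp_sq_le (T := T) hΛ (H.h_pos k) H.ball (H.energy_le k) a) (sq_nonneg (h k)))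
  rw [← integral_const_mul]
  congr 1; funext p
  have := (H.h_pos k).ne'
  simp only [dComp]
  field_simp
  ring

end SchemeLimit

end Components

end HMHF

namespace HMHF

section Truncation

variable {d : ℕ} {Λ : ℝ} {f g w : Vec d → ℝ}

/-! ### Truncated Fourier series -/

/-- The truncation of the Fourier series of `f` to the modes in `S`. -/
noncomputable def trunc (Λ : ℝ) (S : Finset (Fin d → ℤ)) (f : Vec d → ℝ) (x : Vec d) : ℝ :=
  (Λ ^ d)⁻¹ * ∑ n ∈ S, ((fc Λ f n).re * cosW Λ n x - (fc Λ f n).im * sinW Λ n x)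

/-- The partial derivatives of the truncated Fourier series. -/
noncomputable def truncGrad (Λ : ℝ) (S : Finset (Fin d → ℤ)) (f : Vec d → ℝ) (i : Fin d)
    (x : Vec d) : ℝ :=
  (Λ ^ d)⁻¹ * ∑ n ∈ S, ((fc Λ f n).re * -(waveVec Λ n i * sinW Λ n x) -
    (fc Λ f n).im * (waveVec Λ n i * cosW Λ n x))

/-- Truncation commutes with differentiation. Convergence of the gradients of truncations thereby
reduces to L² convergence of the truncations of the weak derivative. -/
lemma truncGrad_eq {i : Fin d} (h : ∀ n, fc Λ w n = waveVec Λ n i * Complex.I * fc Λ f n)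
    (S : Finset (Fin d → ℤ)) (x : Vec d) : truncGrad Λ S f i x = trunc Λ S w x := by
  rw [truncGrad, trunc]
  congr 1
  refine Finset.sum_congr rfl fun n _ => ?_
  rw [h n]
  simp only [Complex.mul_re, Complex.mul_im, Complex.ofReal_re, Complex.ofReal_im, Complex.I_re,
    Complex.I_im]
  ring

lemma bddPeriodic_trunc (hΛ : 0 < Λ) (S : Finset (Fin d → ℤ)) (f : Vec d → ℝ) :
    BddPeriodic Λ (trunc Λ S f) :=
  (BddPeriodic.const _).mul (BddPeriodic.sum _ fun n _ =>
    ((BddPeriodic.const _).mul (bddPeriodic_cosW hΛ n)).sub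
      ((BddPeriodic.const _).mul (bddPeriodic_sinW hΛ n)))

lemma integral_mul_trunc (hΛ : 0 < Λ) (S : Finset (Fin d → ℤ)) (f : Vec d → ℝ)
    (hg : Integrable g (torusMeasure d Λ)) :
    ∫ x, trunc Λ S f x * g x ∂torusMeasure d Λ =
      (Λ ^ d)⁻¹ * ∑ n ∈ S, ((fc Λ f n).re * (fc Λ g n).re + (fc Λ f n).im * (fc Λ g n).im) := by
  have hc := fun n => (bddPeriodic_cosW hΛ n).integrable_mul hg
  have hs := fun n => (bddPeriodic_sinW hΛ n).integrable_mul hg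
  have e : ∀ x, trunc Λ S f x * g x = (Λ ^ d)⁻¹ * ∑ n ∈ S,
      ((fc Λ f n).re * (cosW Λ n x * g x) - (fc Λ f n).im * (sinW Λ n x * g x)) := fun x => by
    rw [trunc, mul_assoc, Finset.sum_mul]
    congr 1
    exact Finset.sum_congr rfl fun n _ => by ring
  simp_rw [e]
  rw [integral_const_mul, integral_finsetSum]
  · congr 1
    refine Finset.sum_congr rfl fun n _ => ?_
    rw [integral_sub ((hc n).const_mul _) ((hs n).const_mul _), integral_const_mul,
      integral_const_mul, fc_eq hΛ hg]
    simp [sub_eq_add_neg]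
  · exact fun n _ => ((hc n).const_mul _).sub ((hs n).const_mul _)

lemma norm_fc_sq_eq (f : Vec d → ℝ) (n : Fin d → ℤ) :
    ‖fc Λ f n‖ ^ 2 = (fc Λ f n).re ^ 2 + (fc Λ f n).im ^ 2 := by
  rw [← Complex.normSq_eq_norm_sq, Complex.normSq_apply]
  ring

lemma sum_norm_fc_sq_le (hΛ : 0 < Λ) (hf : MemLp f 2 (torusMeasure d Λ))
    (S : Finset (Fin d → ℤ)) :
    (Λ ^ d)⁻¹ * ∑ n ∈ S, ‖fc Λ f n‖ ^ 2 ≤ ∫ x, f x ^ 2 ∂torusMeasure d Λ := by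
  rw [inv_mul_le_iff₀ (pow_pos hΛ d)]
  exact sum_le_hasSum S (fun _ _ => sq_nonneg _) (hasSum_norm_fc_sq hΛ hf)

/-- No orthogonality relation is computed. Pairing the truncation with itself, Young's inequality
bounds its squared norm by half the right-hand side plus half of the Bessel sum of the truncation,
and the latter is absorbed. -/
lemma integral_trunc_sq_le (hΛ : 0 < Λ) (S : Finset (Fin d → ℤ)) (f : Vec d → ℝ) :
    ∫ x, trunc Λ S f x ^ 2 ∂torusMeasure d Λ ≤ (Λ ^ d)⁻¹ * ∑ n ∈ S, ‖fc Λ f n‖ ^ 2 := by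
  have hb := bddPeriodic_trunc hΛ S f
  have h1 := integral_mul_trunc hΛ S f (hb.integrable hΛ)
  have h2 := sum_norm_fc_sq_le hΛ (hb.memLp hΛ 2) S
  simp_rw [← pow_two] at h1
  have h3 : (Λ ^ d)⁻¹ * ∑ n ∈ S, ((fc Λ f n).re * (fc Λ (trunc Λ S f) n).re +
      (fc Λ f n).im * (fc Λ (trunc Λ S f) n).im) ≤
      (Λ ^ d)⁻¹ * ∑ n ∈ S, (‖fc Λ f n‖ ^ 2 / 2 + ‖fc Λ (trunc Λ S f) n‖ ^ 2 / 2) := by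
    refine mul_le_mul_of_nonneg_left (Finset.sum_le_sum fun n _ => ?_) (by positivity)
    rw [norm_fc_sq_eq, norm_fc_sq_eq]
    nlinarith [sq_nonneg ((fc Λ f n).re - (fc Λ (trunc Λ S f) n).re),
      sq_nonneg ((fc Λ f n).im - (fc Λ (trunc Λ S f) n).im)]
  have h4 : (Λ ^ d)⁻¹ * ∑ n ∈ S, (‖fc Λ f n‖ ^ 2 / 2 + ‖fc Λ (trunc Λ S f) n‖ ^ 2 / 2) =
      (Λ ^ d)⁻¹ * (∑ n ∈ S, ‖fc Λ f n‖ ^ 2) / 2 +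
        (Λ ^ d)⁻¹ * (∑ n ∈ S, ‖fc Λ (trunc Λ S f) n‖ ^ 2) / 2 := by
    rw [Finset.sum_add_distrib, ← Finset.sum_div, ← Finset.sum_div]
    ring
  linarith

lemma integral_trunc_sub_sq_le (hΛ : 0 < Λ) (hf : MemLp f 2 (torusMeasure d Λ))
    (S : Finset (Fin d → ℤ)) :
    ∫ x, (trunc Λ S f x - f x) ^ 2 ∂torusMeasure d Λ ≤
      ∫ x, f x ^ 2 ∂torusMeasure d Λ - (Λ ^ d)⁻¹ * ∑ n ∈ S, ‖fc Λ f n‖ ^ 2 := by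
  have := isFiniteMeasure_torusMeasure d hΛ
  have ht := (bddPeriodic_trunc hΛ S f).memLp hΛ 2
  have h1 := integral_mul_trunc hΛ S f (hf.integrable one_le_two)
  have h2 := integral_trunc_sq_le hΛ S f
  have e : ∀ x, (trunc Λ S f x - f x) ^ 2 =
      trunc Λ S f x ^ 2 - 2 * (trunc Λ S f x * f x) + f x ^ 2 := fun x => by ring
  have i1 : Integrable (fun x => trunc Λ S f x ^ 2) (torusMeasure d Λ) := ht.integrable_sq
  have i2 : Integrable (fun x => f x ^ 2) (torusMeasure d Λ) := hf.integrable_sq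
  have i3 := (integrable_mul_of_memLp ht hf).const_mul 2
  simp_rw [e]
  rw [integral_add (f := fun x => trunc Λ S f x ^ 2 - 2 * (trunc Λ S f x * f x)) (i1.sub i3) i2,
    integral_sub i1 i3, integral_const_mul, h1]
  simp_rw [← pow_two, ← norm_fc_sq_eq]
  linarith

/-- The modes with `|n_i| ≤ k`. -/
noncomputable def modes (d k : ℕ) : Finset (Fin d → ℤ) := Fintype.piFinset fun _ => Finset.Icc (-(k : ℤ)) k

lemma tendsto_modes (d : ℕ) : Tendsto (modes d) atTop atTop := by
  refine tendsto_atTop_finset_of_monotone (fun k l hkl n hn => ?_) fun n => ?_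
  · simp only [modes, Fintype.mem_piFinset, Finset.mem_Icc] at hn ⊢
    exact fun i => ⟨by have := (hn i).1; omega, by have := (hn i).2; omega⟩
  · refine ⟨∑ i, (n i).natAbs, ?_⟩
    simp only [modes, Fintype.mem_piFinset, Finset.mem_Icc]
    intro i
    have := Finset.single_le_sum (f := fun i => (n i).natAbs) (fun _ _ => Nat.zero_le _)
      (Finset.mem_univ i)
    have h2 := abs_le.1 (Int.natCast_natAbs (n i) ▸ Nat.cast_le (α := ℤ).2 this :
      |n i| ≤ ((∑ i, (n i).natAbs : ℕ) : ℤ))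
    exact h2

lemma tendsto_integral_trunc_sub_sq (hΛ : 0 < Λ) (hf : MemLp f 2 (torusMeasure d Λ)) :
    Tendsto (fun k => ∫ x, (trunc Λ (modes d k) f x - f x) ^ 2 ∂torusMeasure d Λ) atTop (𝓝 0) := by
  have h1 := ((hasSum_norm_fc_sq hΛ hf).mul_left (Λ ^ d)⁻¹).comp (tendsto_modes d)
  rw [inv_mul_cancel_left₀ (pow_pos hΛ d).ne'] at h1
  have h2 := h1.const_sub (∫ x, f x ^ 2 ∂torusMeasure d Λ)
  rw [sub_self] at h2
  refine squeeze_zero (fun _ => integral_nonneg fun _ => sq_nonneg _) (fun k => ?_) h2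
  refine (integral_trunc_sub_sq_le hΛ hf (modes d k)).trans (le_of_eq ?_)
  simp [Finset.mul_sum]

end Truncation

section CylinderTruncation

variable {d : ℕ} {Λ T : ℝ} {F G : Vec d × ℝ → ℝ}

lemma ae_memLp_slice (hΛ : 0 < Λ) (hG : MemLp G 2 (cylinderMeasure d Λ T)) :
    ∀ᵐ t ∂volume.restrict (Set.Ioo 0 T), MemLp (fun x => G (x, t)) 2 (torusMeasure d Λ) := by
  have := isFiniteMeasure_torusMeasure d hΛ
  have h1 := hG.integrable_sq
  have h2 := hG.1
  rw [cylinderMeasure_eq_prod] at h1 h2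
  filter_upwards [h1.prod_left_ae, h2.prodMk_right] with t ht ht'
  exact (memLp_two_iff_integrable_sq ht').2 ht

lemma aestronglyMeasurable_fc_slice (hΛ : 0 < Λ)
    (hG : AEStronglyMeasurable G (cylinderMeasure d Λ T)) (n : Fin d → ℤ) :
    AEStronglyMeasurable (fun t => fc Λ (fun x => G (x, t)) n) (volume.restrict (Set.Ioo 0 T)) := by
  have := isFiniteMeasure_torusMeasure d hΛ
  rw [cylinderMeasure_eq_prod] at hG
  have h1 : AEStronglyMeasurable (fun p : Vec d × ℝ => character Λ (-n) p.1 * (G p : ℂ))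
      ((torusMeasure d Λ).prod (volume.restrict (Set.Ioo 0 T))) :=
    ((continuous_character Λ (-n)).comp continuous_fst).aestronglyMeasurable.mul
      (Complex.continuous_ofReal.comp_aestronglyMeasurable hG)
  exact h1.prod_swap.integral_prod_right'

/-- The truncation in space of the Fourier series of a function on the cylinder. -/
noncomputable def cylTrunc (Λ : ℝ) (S : Finset (Fin d → ℤ)) (G : Vec d × ℝ → ℝ)
    (p : Vec d × ℝ) : ℝ := trunc Λ S (fun x => G (x, p.2)) p.1

lemma aestronglyMeasurable_cylTrunc (hΛ : 0 < Λ)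
    (hG : AEStronglyMeasurable G (cylinderMeasure d Λ T)) (S : Finset (Fin d → ℤ)) :
    AEStronglyMeasurable (cylTrunc Λ S G) (cylinderMeasure d Λ T) := by
  have := isFiniteMeasure_torusMeasure d hΛ
  have hfc := aestronglyMeasurable_fc_slice hΛ hG
  have h1 : ∀ n, AEStronglyMeasurable (fun p : Vec d × ℝ => fc Λ (fun x => G (x, p.2)) n)
      (cylinderMeasure d Λ T) := fun n => by
    rw [cylinderMeasure_eq_prod]
    exact (hfc n).comp_snd
  refine AEStronglyMeasurable.const_mul (Finset.aestronglyMeasurable_fun_sum _ fun n _ => ?_) _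
  exact ((Complex.continuous_re.comp_aestronglyMeasurable (h1 n)).mul
    ((contDiff_cosW n).continuous.comp continuous_fst).aestronglyMeasurable).sub
    ((Complex.continuous_im.comp_aestronglyMeasurable (h1 n)).mul
    ((contDiff_sinW n).continuous.comp continuous_fst).aestronglyMeasurable)

lemma integral_trunc_sq_le_integral_sq (hΛ : 0 < Λ) {f : Vec d → ℝ}
    (hf : MemLp f 2 (torusMeasure d Λ)) (S : Finset (Fin d → ℤ)) :
    ∫ x, trunc Λ S f x ^ 2 ∂torusMeasure d Λ ≤ ∫ x, f x ^ 2 ∂torusMeasure d Λ :=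
  (integral_trunc_sq_le hΛ S f).trans (sum_norm_fc_sq_le hΛ hf S)

lemma memLp_cylTrunc (hΛ : 0 < Λ) (hG : MemLp G 2 (cylinderMeasure d Λ T))
    (S : Finset (Fin d → ℤ)) : MemLp (cylTrunc Λ S G) 2 (cylinderMeasure d Λ T) := by
  have := isFiniteMeasure_torusMeasure d hΛ
  have hm := aestronglyMeasurable_cylTrunc hΛ hG.1 S
  refine (memLp_two_iff_integrable_sq hm).2 ?_
  have hm2 : AEStronglyMeasurable (fun p => cylTrunc Λ S G p ^ 2) (cylinderMeasure d Λ T) := hm.pow 2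
  have hi := Integrable.integral_space hΛ hG.integrable_sq
  rw [cylinderMeasure_eq_prod] at hm2 ⊢
  rw [integrable_prod_iff' hm2]
  have hb := fun t : ℝ => ((bddPeriodic_trunc hΛ S fun x => G (x, t)).memLp hΛ 2).integrable_sq
  refine ⟨Eventually.of_forall hb, hi.mono' hm2.norm.prod_swap.integral_prod_right' ?_⟩
  filter_upwards [ae_memLp_slice hΛ hG] with t ht
  rw [Real.norm_of_nonneg (integral_nonneg fun _ => norm_nonneg _)]
  simp only [norm_pow, Real.norm_eq_abs, sq_abs]
  exact integral_trunc_sq_le_integral_sq hΛ ht S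

/-- Parseval gives convergence on almost every time slice, and the error on a slice is at most the
squared norm of that slice, which is integrable in time. -/
lemma strongConv_cylTrunc (hΛ : 0 < Λ) (hG : MemLp G 2 (cylinderMeasure d Λ T)) :
    StrongConv (cylinderMeasure d Λ T) (fun k => cylTrunc Λ (modes d k) G) G := by
  have hi := fun k => ((memLp_cylTrunc hΛ hG (modes d k)).sub hG).integrable_sq
  refine ⟨fun k => memLp_cylTrunc hΛ hG _, hG, ?_⟩
  have h1 : ∀ k, ∫ p, (cylTrunc Λ (modes d k) G p - G p) ^ 2 ∂cylinderMeasure d Λ T =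
      ∫ t in Set.Ioo 0 T, ∫ x, (trunc Λ (modes d k) (fun x => G (x, t)) x - G (x, t)) ^ 2
        ∂torusMeasure d Λ := fun k => integral_cylinder hΛ (hi k)
  simp_rw [h1]
  have h0 : (0 : ℝ) = ∫ t in Set.Ioo (0 : ℝ) T, (0 : ℝ) := by simp
  rw [h0]
  nth_rw 1 [← h0]
  refine tendsto_integral_of_dominated_convergence
    (fun t => ∫ x, G (x, t) ^ 2 ∂torusMeasure d Λ)
    (fun k => (Integrable.integral_space hΛ (hi k)).aestronglyMeasurable)
    (Integrable.integral_space hΛ hG.integrable_sq) (fun k => ?_) ?_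
  · filter_upwards [ae_memLp_slice hΛ hG] with t ht
    rw [Real.norm_of_nonneg (integral_nonneg fun _ => sq_nonneg _)]
    refine (integral_trunc_sub_sq_le hΛ ht _).trans (sub_le_self _ ?_)
    positivity
  · filter_upwards [ae_memLp_slice hΛ hG] with t ht
    exact tendsto_integral_trunc_sub_sq hΛ ht

/-! ### Time dependent test functions -/

/-- Test functions which are tame in space, uniformly and measurably in time. -/
structure TameFam (Λ T : ℝ) (φ : Vec d × ℝ → ℝ) (Dφ : Fin d → Vec d × ℝ → ℝ) : Prop where
  measurable : Measurable φ
  measurable_grad : ∀ i, Measurable (Dφ i)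
  tame : ∃ C, ∀ t ∈ Set.Ioo 0 T, Tame Λ C (fun x => φ (x, t)) (fun i x => Dφ i (x, t))

lemma Tame.add {C C' : ℝ} {φ ψ : Vec d → ℝ} {Dφ Dψ : Fin d → Vec d → ℝ} (h : Tame Λ C φ Dφ)
    (h' : Tame Λ C' ψ Dψ) :
    Tame Λ (C + C') (fun x => φ x + ψ x) (fun i x => Dφ i x + Dψ i x) := by
  refine ⟨h.measurable.add h'.measurable, (h.bddPeriodic.add h'.bddPeriodic).periodic, fun x => ?_,
    fun i => (h.measurable_grad i).add (h'.measurable_grad i),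
    fun i => ((h.bddPeriodic_grad i).add (h'.bddPeriodic_grad i)).periodic, fun i x => ?_,
    fun x z => ?_, fun x z => ?_⟩
  · exact (abs_add_le _ _).trans (add_le_add (h.bound x) (h'.bound x))
  · exact (abs_add_le _ _).trans (add_le_add (h.bound_grad i x) (h'.bound_grad i x))
  · rw [add_mul, add_sub_add_comm]
    exact (abs_add_le _ _).trans (add_le_add (h.lipschitz x z) (h'.lipschitz x z))
  · rw [add_mul]
    refine le_trans (le_of_eq ?_) ((abs_add_le _ _).trans (add_le_add (h.taylor x z) (h'.taylor x z)))
    simp_rw [mul_add, Finset.sum_add_distrib]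
    congr 1; ring

lemma Tame.zero : Tame (d := d) Λ 0 (fun _ => 0) (fun _ _ => 0) := by
  constructor <;> intros <;> simp [IsPeriodic, measurable_const]

lemma Tame.const_mul {C B b : ℝ} {φ : Vec d → ℝ} {Dφ : Fin d → Vec d → ℝ} (h : Tame Λ C φ Dφ)
    (hb : |b| ≤ B) : Tame Λ (B * C) (fun x => b * φ x) (fun i x => b * Dφ i x) := by
  have key : ∀ {y D : ℝ}, |y| ≤ C * D → |b * y| ≤ B * C * D := fun {y D} hy => by
    rw [abs_mul, mul_assoc]
    exact mul_le_mul hb hy (abs_nonneg _) ((abs_nonneg _).trans hb)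
  have key' : ∀ {y : ℝ}, |y| ≤ C → |b * y| ≤ B * C := fun {y} hy => by
    simpa using key (D := 1) (by simpa using hy)
  refine ⟨h.measurable.const_mul b, fun x i => ?_, fun x => key' (h.bound x),
    fun i => (h.measurable_grad i).const_mul b, fun i x j => ?_, fun i x => key' (h.bound_grad i x),
    fun x z => ?_, fun x z => ?_⟩
  · rw [h.periodic x i]
  · rw [h.periodic_grad i x j]
  · rw [← mul_sub]
    exact key (h.lipschitz x z)
  · convert key (h.taylor x z) using 2
    rw [mul_sub, mul_sub, Finset.mul_sum]
    congr 1
    exact Finset.sum_congr rfl fun i _ => by ring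

namespace TameFam

variable {φ ψ : Vec d × ℝ → ℝ} {Dφ Dψ : Fin d → Vec d × ℝ → ℝ}

lemma add (h : TameFam Λ T φ Dφ) (h' : TameFam Λ T ψ Dψ) :
    TameFam Λ T (fun p => φ p + ψ p) (fun i p => Dφ i p + Dψ i p) := by
  obtain ⟨C, hC⟩ := h.tame
  obtain ⟨C', hC'⟩ := h'.tame
  exact ⟨h.measurable.add h'.measurable,
    fun i => (h.measurable_grad i).add (h'.measurable_grad i), C + C',
    fun t ht => (hC t ht).add (hC' t ht)⟩

lemma mul (h : TameFam Λ T φ Dφ) (h' : TameFam Λ T ψ Dψ) :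
    TameFam Λ T (fun p => φ p * ψ p) (fun i p => Dφ i p * ψ p + φ p * Dψ i p) := by
  obtain ⟨C, hC⟩ := h.tame
  obtain ⟨C', hC'⟩ := h'.tame
  exact ⟨h.measurable.mul h'.measurable, fun i =>
    ((h.measurable_grad i).mul h'.measurable).add (h.measurable.mul (h'.measurable_grad i)),
    3 * C * C', fun t ht => (hC t ht).mul (hC' t ht)⟩

lemma zero : TameFam (d := d) Λ T (fun _ => 0) (fun _ _ => 0) :=
  ⟨measurable_const, fun _ => measurable_const, 0, fun _ _ => Tame.zero⟩

lemma sum {ι : Type} (s : Finset ι) {φ : ι → Vec d × ℝ → ℝ} {Dφ : ι → Fin d → Vec d × ℝ → ℝ}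
    (h : ∀ j ∈ s, TameFam Λ T (φ j) (Dφ j)) :
    TameFam Λ T (fun p => ∑ j ∈ s, φ j p) (fun i p => ∑ j ∈ s, Dφ j i p) := by
  classical
  induction s using Finset.induction_on with
  | empty => simpa using zero
  | insert j s hj ih =>
    simp_rw [Finset.sum_insert hj]
    exact (h j (Finset.mem_insert_self j s)).add
      (ih fun l hl => h l (Finset.mem_insert_of_mem hl))

/-- Products of a bounded function of time and a tame function of space. -/
lemma smul_tame {C B : ℝ} {φ : Vec d → ℝ} {Dφ : Fin d → Vec d → ℝ} (h : Tame Λ C φ Dφ)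
    {b : ℝ → ℝ} (hb : Measurable b) (hB : ∀ t ∈ Set.Ioo 0 T, |b t| ≤ B) :
    TameFam Λ T (fun p => b p.2 * φ p.1) (fun i p => b p.2 * Dφ i p.1) :=
  ⟨(hb.comp measurable_snd).mul (h.measurable.comp measurable_fst),
    fun i => (hb.comp measurable_snd).mul ((h.measurable_grad i).comp measurable_fst),
    B * C, fun t ht => h.const_mul (hB t ht)⟩

lemma bound (h : TameFam Λ T φ Dφ) (hΛ : 0 < Λ) :
    ∃ C, (∀ᵐ p ∂cylinderMeasure d Λ T, |φ p| ≤ C) ∧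
      ∀ i, ∀ᵐ p ∂cylinderMeasure d Λ T, |Dφ i p| ≤ C := by
  obtain ⟨C, hC⟩ := h.tame
  have hm : MeasurableSet (cell d Λ ×ˢ Set.Ioo 0 T) := (measurableSet_cell d hΛ).prod measurableSet_Ioo
  exact ⟨C, ae_restrict_of_forall_mem hm fun p hp => (hC p.2 hp.2).bound p.1,
    fun i => ae_restrict_of_forall_mem hm fun p hp => (hC p.2 hp.2).bound_grad i p.1⟩

end TameFam

lemma measurable_fc_slice (hΛ : 0 < Λ) (hG : Measurable G) (n : Fin d → ℤ) :
    Measurable fun t => fc Λ (fun x => G (x, t)) n := by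
  have := isFiniteMeasure_torusMeasure d hΛ
  have h1 : Measurable fun p : Vec d × ℝ => character Λ (-n) p.1 * (G p : ℂ) :=
    ((continuous_character Λ (-n)).comp continuous_fst).measurable.mul
      (Complex.measurable_ofReal.comp hG)
  exact h1.stronglyMeasurable.integral_prod_left'.measurable

lemma norm_fc_le (hΛ : 0 < Λ) {f : Vec d → ℝ} {M : ℝ} (hf : ∀ x, |f x| ≤ M) (n : Fin d → ℤ) :
    ‖fc Λ f n‖ ≤ M * (torusMeasure d Λ).real Set.univ := by
  have := isFiniteMeasure_torusMeasure d hΛ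
  refine norm_integral_le_of_norm_le_const (Eventually.of_forall fun x => ?_)
  rw [norm_mul, norm_character, one_mul, Complex.norm_real]
  exact hf x

/-- A bounded function has Fourier coefficients bounded uniformly in time. Mere measurability in
time suffices, since test families carry no time regularity; this is what makes truncations of the
limit admissible. -/
lemma tameFam_cylTrunc (hΛ : 0 < Λ) (hG : Measurable G) {M : ℝ} (hM : ∀ p, |G p| ≤ M)
    (S : Finset (Fin d → ℤ)) :
    TameFam Λ T (cylTrunc Λ S G) (fun i p => truncGrad Λ S (fun x => G (x, p.2)) i p.1) := by
  have hB := fun n t => norm_fc_le hΛ (f := fun x => G (x, t)) (fun x => hM _) n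
  have h1 := TameFam.sum (Λ := Λ) (T := T) S
    (φ := fun n p => (Λ ^ d)⁻¹ * (fc Λ (fun x => G (x, p.2)) n).re * cosW Λ n p.1 +
      -((Λ ^ d)⁻¹ * (fc Λ (fun x => G (x, p.2)) n).im) * sinW Λ n p.1)
    (Dφ := fun n i p => (Λ ^ d)⁻¹ * (fc Λ (fun x => G (x, p.2)) n).re *
        -(waveVec Λ n i * sinW Λ n p.1) +
      -((Λ ^ d)⁻¹ * (fc Λ (fun x => G (x, p.2)) n).im) * (waveVec Λ n i * cosW Λ n p.1))
    fun n _ => by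
      obtain ⟨C, hC⟩ := Tame.cosW hΛ n
      obtain ⟨C', hC'⟩ := Tame.sinW hΛ n
      have hm := measurable_fc_slice hΛ hG n
      have hV : 0 ≤ (Λ ^ d)⁻¹ := by positivity
      refine (TameFam.smul_tame (b := fun t => (Λ ^ d)⁻¹ * (fc Λ (fun x => G (x, t)) n).re)
        (B := (Λ ^ d)⁻¹ * (M * (torusMeasure d Λ).real Set.univ)) hC
        ((Complex.measurable_re.comp hm).const_mul _) fun t _ => ?_).add
        (TameFam.smul_tame (b := fun t => -((Λ ^ d)⁻¹ * (fc Λ (fun x => G (x, t)) n).im))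
        (B := (Λ ^ d)⁻¹ * (M * (torusMeasure d Λ).real Set.univ)) hC'
        ((Complex.measurable_im.comp hm).const_mul _).neg fun t _ => ?_)
      · rw [abs_mul, abs_of_nonneg hV]
        exact mul_le_mul_of_nonneg_left ((Complex.abs_re_le_norm _).trans (hB n t)) hV
      · rw [abs_neg, abs_mul, abs_of_nonneg hV]
        exact mul_le_mul_of_nonneg_left ((Complex.abs_im_le_norm _).trans (hB n t)) hV
  convert h1 using 2 with p i
  · rw [cylTrunc, trunc, Finset.mul_sum]
    exact Finset.sum_congr rfl fun n _ => by ring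
  · funext p
    rw [truncGrad, Finset.mul_sum]
    exact Finset.sum_congr rfl fun n _ => by ring

/-! ### Density of the test functions -/

lemma ae_eq_zero_of_integral_bdd_mul {X : Type} [MeasurableSpace X] {μ : Measure X} {f : X → ℝ}
    (hf : Integrable f μ)
    (h : ∀ b : X → ℝ, Measurable b → (∀ x, |b x| ≤ 1) → ∫ x, b x * f x ∂μ = 0) : f =ᵐ[μ] 0 := by
  refine hf.ae_eq_zero_of_forall_setIntegral_eq_zero fun s hs _ => ?_
  have := h (s.indicator 1) (measurable_one.indicator hs) fun x => by
    by_cases hx : x ∈ s <;> simp [hx]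
  rw [← integral_indicator hs, ← this]
  congr 1; funext x
  by_cases hx : x ∈ s <;> simp [hx]

/-- With countably many modes the exceptional times form one null set, outside of which all
coefficients of the slice vanish and Parseval applies. -/
lemma ae_eq_zero_of_modes (hΛ : 0 < Λ) (hF : MemLp F 2 (cylinderMeasure d Λ T))
    (hc : ∀ n : Fin d → ℤ, ∀ᵐ t ∂volume.restrict (Set.Ioo 0 T),
      ∫ x, cosW Λ n x * F (x, t) ∂torusMeasure d Λ = 0)
    (hs : ∀ n : Fin d → ℤ, ∀ᵐ t ∂volume.restrict (Set.Ioo 0 T),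
      ∫ x, sinW Λ n x * F (x, t) ∂torusMeasure d Λ = 0) : F =ᵐ[cylinderMeasure d Λ T] 0 := by
  have := isFiniteMeasure_torusMeasure d hΛ
  have h0 : ∫ p, F p ^ 2 ∂cylinderMeasure d Λ T = 0 := by
    rw [integral_cylinder hΛ hF.integrable_sq]
    refine integral_eq_zero_of_ae ?_
    filter_upwards [ae_all_iff.2 hc, ae_all_iff.2 hs, ae_memLp_slice hΛ hF] with t h1 h2 ht
    have h3 := hasSum_norm_fc_sq hΛ ht
    simp_rw [fc_eq hΛ (ht.integrable one_le_two), h1, h2] at h3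
    simp only [Complex.ofReal_zero, mul_zero, sub_zero, norm_zero, ne_eq, OfNat.ofNat_ne_zero,
      not_false_eq_true, zero_pow] at h3
    exact (mul_eq_zero.1 (hasSum_zero.unique h3).symm).resolve_left (pow_pos hΛ d).ne'
  have h1 := (integral_eq_zero_iff_of_nonneg (fun _ => sq_nonneg _) hF.integrable_sq).1 h0
  filter_upwards [h1] with p hp
  simpa using hp

lemma integrable_mode_mul (hF : Integrable F (cylinderMeasure d Λ T)) {e : Vec d → ℝ}
    (he : BddPeriodic Λ e) : Integrable (fun p => e p.1 * F p) (cylinderMeasure d Λ T) := by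
  obtain ⟨C, hC⟩ := he.bounded
  exact hF.bdd_mul (he.measurable.comp measurable_fst).aestronglyMeasurable
    (Eventually.of_forall fun p => hC p.1)

lemma integral_time_mul (hΛ : 0 < Λ) (hF : Integrable F (cylinderMeasure d Λ T)) {b : ℝ → ℝ}
    {C : ℝ} (hb : Measurable b) (hC : ∀ t, |b t| ≤ C) :
    ∫ p, b p.2 * F p ∂cylinderMeasure d Λ T =
      ∫ t in Set.Ioo 0 T, b t * ∫ x, F (x, t) ∂torusMeasure d Λ := by
  have hi : Integrable (fun p => b p.2 * F p) (cylinderMeasure d Λ T) := hF.bdd_mul (c := C)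
    (hb.comp measurable_snd).aestronglyMeasurable (Eventually.of_forall fun p => hC p.2)
  rw [integral_cylinder hΛ hi]
  simp_rw [integral_const_mul]

lemma ae_slice_eq_zero_of_bdd (hΛ : 0 < Λ) (hF : Integrable F (cylinderMeasure d Λ T))
    (h : ∀ b : ℝ → ℝ, Measurable b → (∀ t, |b t| ≤ 1) →
      ∫ p, b p.2 * F p ∂cylinderMeasure d Λ T = 0) :
    ∀ᵐ t ∂volume.restrict (Set.Ioo 0 T), ∫ x, F (x, t) ∂torusMeasure d Λ = 0 := by
  refine ae_eq_zero_of_integral_bdd_mul (Integrable.integral_space hΛ hF) fun b hb hb1 => ?_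
  rw [← integral_time_mul hΛ hF hb hb1, h b hb hb1]

/-- Needed for identities obtained by integrating by parts in time, where a merely bounded factor of
time is not admissible. -/
lemma ae_slice_eq_zero_of_smooth (hΛ : 0 < Λ) (hF : Integrable F (cylinderMeasure d Λ T))
    (h : ∀ η : ℝ → ℝ, ContDiff ℝ ∞ η → HasCompactSupport η → tsupport η ⊆ Set.Ioo 0 T →
      ∫ p, η p.2 * F p ∂cylinderMeasure d Λ T = 0) :
    ∀ᵐ t ∂volume.restrict (Set.Ioo 0 T), ∫ x, F (x, t) ∂torusMeasure d Λ = 0 := by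
  have hi := Integrable.integral_space hΛ hF
  rw [ae_restrict_iff' measurableSet_Ioo]
  refine isOpen_Ioo.ae_eq_zero_of_integral_contDiff_smul_eq_zero hi.locallyIntegrableOn
    fun η h1 h2 h3 => ?_
  obtain ⟨C, hC⟩ := h1.continuous.bounded_above_of_compact_support h2
  have h4 := h η h1 h2 h3
  rw [integral_time_mul hΛ hF h1.continuous.measurable hC] at h4
  rw [← h4]
  refine (setIntegral_eq_integral_of_forall_compl_eq_zero fun t ht => ?_).symm
  rw [image_eq_zero_of_notMem_tsupport fun h' => ht (h3 h'), zero_smul]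

end CylinderTruncation

end HMHF

namespace HMHF

/-! ### Spatial derivatives and length of the limit -/

section Space

variable {d N : ℕ} {Λ T E : ℝ} {u0 : Vec d → Vec N} {φ : Vec d × ℝ → ℝ}
  {Dφ : Fin d → Vec d × ℝ → ℝ}

lemma TameFam.memLp (hφ : TameFam Λ T φ Dφ) (hΛ : 0 < Λ) :
    MemLp φ 2 (cylinderMeasure d Λ T) := by
  have := isFiniteMeasure_cylinderMeasure d hΛ T
  obtain ⟨C, hC, -⟩ := hφ.bound hΛ
  exact MemLp.of_bound hφ.measurable.aestronglyMeasurable C hC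

lemma TameFam.memLp_grad (hφ : TameFam Λ T φ Dφ) (hΛ : 0 < Λ) (i : Fin d) :
    MemLp (Dφ i) 2 (cylinderMeasure d Λ T) := by
  have := isFiniteMeasure_cylinderMeasure d hΛ T
  obtain ⟨C, -, hC⟩ := hφ.bound hΛ
  exact MemLp.of_bound (hφ.measurable_grad i).aestronglyMeasurable C (hC i)

lemma TameFam.memLp_mul (hφ : TameFam Λ T φ Dφ) (hΛ : 0 < Λ) {f : Vec d × ℝ → ℝ}
    (hf : MemLp f 2 (cylinderMeasure d Λ T)) :
    MemLp (fun p => φ p * f p) 2 (cylinderMeasure d Λ T) := by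
  obtain ⟨C, hC, -⟩ := hφ.bound hΛ
  exact memLp_bdd_mul hφ.measurable.aestronglyMeasurable hC hf

lemma TameFam.memLp_grad_mul (hφ : TameFam Λ T φ Dφ) (hΛ : 0 < Λ) (i : Fin d)
    {f : Vec d × ℝ → ℝ} (hf : MemLp f 2 (cylinderMeasure d Λ T)) :
    MemLp (fun p => Dφ i p * f p) 2 (cylinderMeasure d Λ T) := by
  obtain ⟨C, -, hC⟩ := hφ.bound hΛ
  exact memLp_bdd_mul (hφ.measurable_grad i).aestronglyMeasurable (hC i) hf

lemma integral_cylinder_congr (hΛ : 0 < Λ) {f g : Vec d × ℝ → ℝ}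
    (hf : Integrable f (cylinderMeasure d Λ T)) (hg : Integrable g (cylinderMeasure d Λ T))
    (h : ∀ t ∈ Set.Ioo 0 T, ∫ x, f (x, t) ∂torusMeasure d Λ = ∫ x, g (x, t) ∂torusMeasure d Λ) :
    ∫ p, f p ∂cylinderMeasure d Λ T = ∫ p, g p ∂cylinderMeasure d Λ T := by
  rw [integral_cylinder hΛ hf, integral_cylinder hΛ hg]
  exact setIntegral_congr_fun measurableSet_Ioo h

lemma TameFam.integral_grad_eq_zero (hφ : TameFam Λ T φ Dφ) (hΛ : 0 < Λ) (i : Fin d) :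
    ∫ p, Dφ i p ∂cylinderMeasure d Λ T = 0 := by
  have := isFiniteMeasure_cylinderMeasure d hΛ T
  obtain ⟨C, hC⟩ := hφ.tame
  rw [integral_cylinder_congr (g := fun _ => 0) hΛ ((hφ.memLp_grad hΛ i).integrable one_le_two)
    (integrable_zero _ _ _) fun t ht => by simpa using (hC t ht).integral_grad_eq_zero hΛ i]
  simp

lemma TameFam.integral_grad_mul_wComp (hφ : TameFam Λ T φ Dφ) (hΛ : 0 < Λ) {h : ℝ} (hh : 0 < h)
    (hu : BallMap Λ u0) (i : Fin d) (a : Fin N) :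
    ∫ p, Dφ i p * wComp h u0 a p ∂cylinderMeasure d Λ T =
      -∫ p, φ p * gComp h u0 i a p ∂cylinderMeasure d Λ T := by
  obtain ⟨C, hC⟩ := hφ.tame
  rw [← integral_neg]
  refine integral_cylinder_congr hΛ
    (integrable_mul_of_memLp (hφ.memLp_grad hΛ i) (memLp_wComp hΛ hu hh a))
    (integrable_mul_of_memLp (hφ.memLp hΛ) (memLp_gComp hΛ hu hh i a)).neg fun t ht => ?_
  rw [integral_neg]
  exact (hC t ht).integral_grad_mul_heatS hΛ hh ((hu.interp hh t).bddPeriodic a) i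

lemma ae_cylinder_of_ae_time {P : ℝ → Prop} (hΛ : 0 < Λ)
    (h : ∀ᵐ t ∂volume.restrict (Set.Ioo 0 T), P t) : ∀ᵐ p ∂cylinderMeasure d Λ T, P p.2 := by
  have := isFiniteMeasure_torusMeasure d hΛ
  rw [cylinderMeasure_eq_prod]
  exact Measure.quasiMeasurePreserving_snd.ae h

lemma StrongConv.congr {X : Type} [MeasurableSpace X] {μ : Measure X} {F F' : ℕ → X → ℝ}
    {f : X → ℝ} (hF : StrongConv μ F f) (h : ∀ k, F k =ᵐ[μ] F' k) : StrongConv μ F' f := by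
  refine ⟨fun k => (memLp_congr_ae (h k)).1 (hF.memLp k), hF.memLp_lim, hF.tendsto.congr fun k => ?_⟩
  refine integral_congr_ae ?_
  filter_upwards [h k] with x hx
  rw [hx]

namespace SchemeLimit

variable {h : ℕ → ℝ} {u : Fin N → Vec d × ℝ → ℝ} {D : Fin d → Fin N → Vec d × ℝ → ℝ}
  {ut : Fin N → Vec d × ℝ → ℝ}

lemma memLp (H : SchemeLimit Λ T E u0 h u D ut) (a : Fin N) :
    MemLp (u a) 2 (cylinderMeasure d Λ T) := (H.conv a).memLp_lim

lemma memLp_grad (H : SchemeLimit Λ T E u0 h u D ut) (i : Fin d) (a : Fin N) :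
    MemLp (D i a) 2 (cylinderMeasure d Λ T) := (H.conv_grad i a).memLp_lim

lemma memLp_time (H : SchemeLimit Λ T E u0 h u D ut) (a : Fin N) :
    MemLp (ut a) 2 (cylinderMeasure d Λ T) := (H.conv_time a).memLp_lim

lemma memLp_mul (H : SchemeLimit Λ T E u0 h u D ut) (a : Fin N) {f : Vec d × ℝ → ℝ}
    (hf : MemLp f 2 (cylinderMeasure d Λ T)) :
    MemLp (fun p => u a p * f p) 2 (cylinderMeasure d Λ T) :=
  memLp_bdd_mul (H.measurable a).aestronglyMeasurable (Eventually.of_forall (H.abs_le a)) hf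

/-! ### Spatial derivatives of the limit -/

/-- The integration by parts for the smoothed maps passes to the limit: they converge to the same
limit as the maps themselves, and their gradients converge weakly. -/
lemma integral_grad_mul (hΛ : 0 < Λ) (hT : 0 < T) (H : SchemeLimit Λ T E u0 h u D ut)
    (hφ : TameFam Λ T φ Dφ) (i : Fin d) (a : Fin N) :
    ∫ p, Dφ i p * u a p ∂cylinderMeasure d Λ T = -∫ p, φ p * D i a p ∂cylinderMeasure d Λ T := by
  have h1 := (H.conv_w hΛ hT a).weakConv.tendsto _ (hφ.memLp_grad hΛ i)
  have h2 := ((H.conv_grad i a).tendsto _ (hφ.memLp hΛ)).neg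
  simp only [mul_comm _ (Dφ i _)] at h1
  simp only [mul_comm _ (φ _)] at h2
  refine tendsto_nhds_unique h1 (h2.congr fun k => ?_)
  exact (hφ.integral_grad_mul_wComp hΛ (H.h_pos k) H.ball i a).symm

/-- Testing with an arbitrary bounded function of time times a cosine or sine localises the weak
derivative to almost every time. -/
lemma ae_fc_grad (hΛ : 0 < Λ) (hT : 0 < T) (H : SchemeLimit Λ T E u0 h u D ut) (i : Fin d)
    (a : Fin N) : ∀ᵐ t ∂volume.restrict (Set.Ioo 0 T), ∀ n,
      fc Λ (fun x => D i a (x, t)) n =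
        waveVec Λ n i * Complex.I * fc Λ (fun x => u a (x, t)) n := by
  have := isFiniteMeasure_cylinderMeasure d hΛ T
  have := isFiniteMeasure_torusMeasure d hΛ
  have hu := (H.memLp a).integrable one_le_two
  have hD := (H.memLp_grad i a).integrable one_le_two
  have key : ∀ {e : Vec d → ℝ} {De : Fin d → Vec d → ℝ}, (∃ C, Tame Λ C e De) →
      ∀ᵐ t ∂volume.restrict (Set.Ioo 0 T),
        ∫ x, (De i x * u a (x, t) + e x * D i a (x, t)) ∂torusMeasure d Λ = 0 := by
    rintro e De ⟨C, he⟩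
    have i1 := integrable_mode_mul hu (he.bddPeriodic_grad i)
    have i2 := integrable_mode_mul hD he.bddPeriodic
    refine ae_slice_eq_zero_of_bdd (F := fun p => De i p.1 * u a p + e p.1 * D i a p) hΛ
      (i1.add i2) fun b hb hb1 => ?_
    have h1 := H.integral_grad_mul hΛ hT
      (TameFam.smul_tame (T := T) he hb fun t _ => hb1 t) i a
    have i3 : Integrable (fun p => b p.2 * De i p.1 * u a p) (cylinderMeasure d Λ T) := by
      simp_rw [mul_assoc]
      exact i1.bdd_mul (c := 1) (hb.comp measurable_snd).aestronglyMeasurable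
        (Eventually.of_forall fun p => hb1 p.2)
    have i4 : Integrable (fun p => b p.2 * e p.1 * D i a p) (cylinderMeasure d Λ T) := by
      simp_rw [mul_assoc]
      exact i2.bdd_mul (c := 1) (hb.comp measurable_snd).aestronglyMeasurable
        (Eventually.of_forall fun p => hb1 p.2)
    simp_rw [mul_add, ← mul_assoc]
    rw [integral_add i3 i4, h1, neg_add_cancel]
  filter_upwards [ae_all_iff.2 fun n => key (Tame.cosW hΛ n), ae_all_iff.2 fun n =>
    key (Tame.sinW hΛ n), ae_memLp_slice hΛ (H.memLp a), ae_memLp_slice hΛ (H.memLp_grad i a)]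
    with t hc hs hut hDt n
  have iu := hut.integrable one_le_two
  have iD := hDt.integrable one_le_two
  have bc := bddPeriodic_cosW hΛ n
  have bs := bddPeriodic_sinW hΛ n
  have split : ∀ {e e' : Vec d → ℝ}, BddPeriodic Λ e → BddPeriodic Λ e' →
      ∫ x, (e' x * u a (x, t) + e x * D i a (x, t)) ∂torusMeasure d Λ = 0 →
      ∫ x, e' x * u a (x, t) ∂torusMeasure d Λ = -∫ x, e x * D i a (x, t) ∂torusMeasure d Λ := by
    intro e e' he he' h
    rw [integral_add (he'.integrable_mul iu) (he.integrable_mul iD)] at h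
    linarith
  refine fc_of_weak hΛ iu iD (split bc ?_ (hc n)) (split bs ?_ (hs n))
  · exact ((BddPeriodic.const _).mul bs).neg
  · exact (BddPeriodic.const _).mul bc

lemma strongConv_trunc (hΛ : 0 < Λ) (H : SchemeLimit Λ T E u0 h u D ut) (a : Fin N) :
    StrongConv (cylinderMeasure d Λ T) (fun k => cylTrunc Λ (modes d k) (u a)) (u a) :=
  strongConv_cylTrunc hΛ (H.memLp a)

lemma strongConv_truncGrad (hΛ : 0 < Λ) (hT : 0 < T) (H : SchemeLimit Λ T E u0 h u D ut)
    (i : Fin d) (a : Fin N) :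
    StrongConv (cylinderMeasure d Λ T)
      (fun k p => truncGrad Λ (modes d k) (fun x => u a (x, p.2)) i p.1) (D i a) := by
  refine (strongConv_cylTrunc hΛ (H.memLp_grad i a)).congr fun k => ?_
  filter_upwards [ae_cylinder_of_ae_time hΛ (H.ae_fc_grad hΛ hT i a)] with p hp
  exact (truncGrad_eq hp _ _).symm

lemma tameFam_trunc (hΛ : 0 < Λ) (H : SchemeLimit Λ T E u0 h u D ut) (a : Fin N) (k : ℕ) :
    TameFam Λ T (cylTrunc Λ (modes d k) (u a))
      (fun i p => truncGrad Λ (modes d k) (fun x => u a (x, p.2)) i p.1) :=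
  tameFam_cylTrunc hΛ (H.measurable a) (H.abs_le a) _

/-- The chain rule for u_a². The function φ u_a is not an admissible test function, so φ times a
truncation of u_a is used; L² convergence suffices because the remaining factors, among them φ u_a
and φ ∂ᵢu_a, lie in L². -/
lemma integral_grad_mul_sq (hΛ : 0 < Λ) (hT : 0 < T) (H : SchemeLimit Λ T E u0 h u D ut)
    (hφ : TameFam Λ T φ Dφ) (i : Fin d) (a : Fin N) :
    ∫ p, Dφ i p * u a p ^ 2 ∂cylinderMeasure d Λ T =
      -(2 * ∫ p, φ p * (u a p * D i a p) ∂cylinderMeasure d Λ T) := by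
  have m1 := hφ.memLp_grad_mul hΛ i (H.memLp a)
  have m2 := hφ.memLp_mul hΛ (H.memLp a)
  have m3 := hφ.memLp_mul hΛ (H.memLp_grad i a)
  have t1 := (H.strongConv_trunc hΛ a).weakConv.tendsto _ m1
  have t2 := (H.strongConv_truncGrad hΛ hT i a).weakConv.tendsto _ m2
  have t3 := ((H.strongConv_trunc hΛ a).weakConv.tendsto _ m3).neg
  have e := tendsto_nhds_unique (t1.add t2) (t3.congr fun k => ?_)
  · have e1 : ∫ p, u a p * (Dφ i p * u a p) ∂cylinderMeasure d Λ T =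
        ∫ p, Dφ i p * u a p ^ 2 ∂cylinderMeasure d Λ T := by
      congr 1; funext p; ring
    have e2 : ∫ p, D i a p * (φ p * u a p) ∂cylinderMeasure d Λ T =
        ∫ p, φ p * (u a p * D i a p) ∂cylinderMeasure d Λ T := by
      congr 1; funext p; ring
    have e3 : ∫ p, u a p * (φ p * D i a p) ∂cylinderMeasure d Λ T =
        ∫ p, φ p * (u a p * D i a p) ∂cylinderMeasure d Λ T := by
      congr 1; funext p; ring
    rw [e1, e2, e3] at e
    linarith
  · have h1 := H.integral_grad_mul hΛ hT (hφ.mul (H.tameFam_trunc hΛ a k)) i a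
    rw [← integral_add (integrable_mul_of_memLp ((H.strongConv_trunc hΛ a).memLp k) m1)
      (integrable_mul_of_memLp ((H.strongConv_truncGrad hΛ hT i a).memLp k) m2), neg_eq_iff_eq_neg]
    rw [eq_neg_iff_add_eq_zero, ← sub_eq_zero.2 h1]
    rw [sub_neg_eq_add, add_comm]
    congr 1
    · congr 1; funext p; ring
    · congr 1; funext p; ring

/-! ### The limit is a unit vector field -/

/-- On each slice the integral of 1 - |u^h|² is at most the energy, hence at most h E, and strong
convergence passes this to the limit. As |u| ≤ 1, the vanishing integral gives a pointwise identity.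
-/
lemma sum_sq_eq_one (hΛ : 0 < Λ) (hT : 0 < T) (H : SchemeLimit Λ T E u0 h u D ut) :
    ∀ᵐ p ∂cylinderMeasure d Λ T, ∑ a, u a p ^ 2 = 1 := by
  have := isFiniteMeasure_cylinderMeasure d hΛ T
  have := isFiniteMeasure_torusMeasure d hΛ
  have iu : ∀ a, Integrable (fun p => u a p ^ 2) (cylinderMeasure d Λ T) :=
    fun a => (H.memLp a).integrable_sq
  have is : Integrable (fun p => ∑ a, u a p ^ 2) (cylinderMeasure d Λ T) :=
    integrable_finsetSum _ fun a _ => iu a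
  have ik : ∀ k a, Integrable (fun p => uComp (h k) u0 a p ^ 2) (cylinderMeasure d Λ T) :=
    fun k a => ((H.conv a).memLp k).integrable_sq
  have isk : ∀ k, Integrable (fun p => ∑ a, uComp (h k) u0 a p ^ 2) (cylinderMeasure d Λ T) :=
    fun k => integrable_finsetSum _ fun a _ => ik k a
  have t1 : Tendsto (fun k => ∫ p, (1 - ∑ a, uComp (h k) u0 a p ^ 2) ∂cylinderMeasure d Λ T)
      atTop (𝓝 (∫ p, (1 - ∑ a, u a p ^ 2) ∂cylinderMeasure d Λ T)) := by
    simp_rw [fun k => integral_sub (integrable_const (1 : ℝ)) (isk k),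
      integral_sub (integrable_const (1 : ℝ)) is, fun k => integral_finsetSum Finset.univ
        fun a _ => ik k a, integral_finsetSum Finset.univ fun a _ => iu a]
    refine tendsto_const_nhds.sub (tendsto_finsetSum _ fun a _ => ?_)
    simpa only [pow_two] using (H.conv a).tendsto_integral_mul (H.conv a).weakConv
  have t2 : Tendsto (fun k => T * (h k * E)) atTop (𝓝 0) := by
    simpa using (H.h_lim.mul_const E).const_mul T
  have h0 : ∫ p, (1 - ∑ a, u a p ^ 2) ∂cylinderMeasure d Λ T ≤ 0 := by
    refine le_of_tendsto_of_tendsto' t1 t2 fun k => ?_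
    refine integral_cylinder_le hΛ hT ((integrable_const _).sub (isk k)) fun t => ?_
    have hb := H.ball.interp (H.h_pos k) t
    have h1 := (sub_integral_norm_sq_le_energy hΛ (H.h_pos k) hb).trans
      (energy_iterate_le hΛ (H.h_pos k) H.ball (H.energy_le k) ⌊t / h k⌋₊)
    refine le_trans (le_of_eq ?_) h1
    have h2 : ∀ x, ∑ a, uComp (h k) u0 a (x, t) ^ 2 = ‖interp (h k) u0 t x‖ ^ 2 := fun x =>
      (norm_sq_eq_sum _).symm
    change ∫ x, (1 - ∑ a, uComp (h k) u0 a (x, t) ^ 2) ∂torusMeasure d Λ = _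
    simp_rw [h2]
    rw [integral_sub (integrable_const _) (hb.integrable_norm_sq hΛ)]
    simp
  have hnn : ∀ p, 0 ≤ 1 - ∑ a, u a p ^ 2 := fun p => sub_nonneg.2 (H.sum_sq_le p)
  have h3 := (integral_eq_zero_iff_of_nonneg hnn ((integrable_const _).sub is)).1
    (le_antisymm h0 (integral_nonneg hnn))
  filter_upwards [h3] with p hp
  have : 1 - ∑ a, u a p ^ 2 = 0 := hp
  linarith

/-- Summing the chain rule over the components differentiates the constant |u|². -/
lemma sum_mul_grad_eq_zero (hΛ : 0 < Λ) (hT : 0 < T) (H : SchemeLimit Λ T E u0 h u D ut)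
    (i : Fin d) : ∀ᵐ p ∂cylinderMeasure d Λ T, ∑ a, u a p * D i a p = 0 := by
  have := isFiniteMeasure_cylinderMeasure d hΛ T
  have hm : MemLp (fun p => ∑ a, u a p * D i a p) 2 (cylinderMeasure d Λ T) :=
    memLp_finsetSum _ fun a _ => H.memLp_mul a (H.memLp_grad i a)
  have key : ∀ {φ : Vec d × ℝ → ℝ} {Dφ : Fin d → Vec d × ℝ → ℝ}, TameFam Λ T φ Dφ →
      ∫ p, φ p * ∑ a, u a p * D i a p ∂cylinderMeasure d Λ T = 0 := by
    intro φ Dφ hφ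
    have h1 : ∑ a, ∫ p, Dφ i p * u a p ^ 2 ∂cylinderMeasure d Λ T = 0 := by
      rw [← integral_finsetSum]
      · rw [← hφ.integral_grad_eq_zero hΛ i]
        refine integral_congr_ae ?_
        filter_upwards [H.sum_sq_eq_one hΛ hT] with p hp
        rw [← Finset.mul_sum, hp, mul_one]
      · intro a _
        simp_rw [pow_two]
        exact integrable_mul_of_memLp (hφ.memLp_grad hΛ i) (H.memLp_mul a (H.memLp a))
    simp_rw [H.integral_grad_mul_sq hΛ hT hφ, Finset.sum_neg_distrib, ← Finset.mul_sum] at h1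
    rw [← integral_finsetSum] at h1
    · simp_rw [Finset.mul_sum]
      linarith
    · exact fun a _ => integrable_mul_of_memLp (hφ.memLp hΛ) (H.memLp_mul a (H.memLp_grad i a))
  have key2 : ∀ {e : Vec d → ℝ} {De : Fin d → Vec d → ℝ}, (∃ C, Tame Λ C e De) →
      ∀ᵐ t ∂volume.restrict (Set.Ioo 0 T),
        ∫ x, e x * ∑ a, u a (x, t) * D i a (x, t) ∂torusMeasure d Λ = 0 := by
    rintro e De ⟨C, he⟩
    refine ae_slice_eq_zero_of_bdd (F := fun p => e p.1 * ∑ a, u a p * D i a p) hΛ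
      (integrable_mode_mul (hm.integrable one_le_two) he.bddPeriodic) fun b hb hb1 => ?_
    simp_rw [← mul_assoc]
    exact key (TameFam.smul_tame he hb fun t _ => hb1 t)
  exact ae_eq_zero_of_modes hΛ hm (fun n => key2 (Tame.cosW hΛ n)) fun n => key2 (Tame.sinW hΛ n)

end SchemeLimit

end Space

end HMHF

namespace HMHF

section Wedge

variable {d N : ℕ} {Λ T E h : ℝ} {u0 : Vec d → Vec N}

/-! ### The wedge equation -/

/-- The new map is parallel to the convolution. This is the only place where the precise form of the
projection step enters the equation. -/
lemma mul_heatS_thresholdStep {u : Vec d → Vec N} (hu : BallMap Λ u) (hh : 0 < h) (a b : Fin N)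
    (x : Vec d) : thresholdStep h u x a * heatS h (fun y => u y b) x =
      thresholdStep h u x b * heatS h (fun y => u y a) x := by
  simp only [thresholdStep, PiLp.smul_apply, smul_eq_mul]
  rw [heatConv_apply hu hh, heatConv_apply hu hh]
  ring

/-- The integrand of the wedge equation. -/
noncomputable def wedgeIntegrand (h : ℝ) (u0 : Vec d → Vec N) (a b : Fin N) (φ : Vec d × ℝ → ℝ)
    (Dφ : Fin d → Vec d × ℝ → ℝ) (p : Vec d × ℝ) : ℝ :=
  φ p * (uComp h u0 a p * dComp h u0 b p - uComp h u0 b p * dComp h u0 a p) +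
    ∑ i, Dφ i p * (uComp h u0 a p * gComp h u0 i b p - uComp h u0 b p * gComp h u0 i a p)

/-- From |y| ≤ 1 + y². Such a crude bound is used only on the initial time interval, whose length h
makes its contribution vanish. -/
lemma integral_gradS_abs_le (hΛ : 0 < Λ) (hh : 0 < h) (hu : BallMap Λ u0)
    (hE : energy Λ h u0 ≤ h * E) (n : ℕ) (i : Fin d) (a : Fin N) :
    ∫ x, |gradS h i (fun x => iterate h u0 n x a) x| ∂torusMeasure d Λ ≤
      (torusMeasure d Λ).real Set.univ + E := by
  have := isFiniteMeasure_torusMeasure d hΛ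
  have hm := (((hu.iterate hh n).bddPeriodic a).gradS hh i).memLp hΛ 2
  have h2 : ∫ x, gradS h i (fun x => iterate h u0 n x a) x ^ 2 ∂torusMeasure d Λ ≤ E :=
    (Finset.single_le_sum
      (f := fun i => ∫ x, gradS h i (fun x => iterate h u0 n x a) x ^ 2 ∂torusMeasure d Λ)
      (fun _ _ => integral_nonneg fun _ => sq_nonneg _) (Finset.mem_univ i)).trans
      (sum_integral_gradS_iterate_le hΛ hh hu hE n a)
  calc _ ≤ ∫ x, (1 + gradS h i (fun x => iterate h u0 n x a) x ^ 2) ∂torusMeasure d Λ := by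
        refine integral_mono (hm.integrable one_le_two).abs
          ((integrable_const _).add hm.integrable_sq) fun x => ?_
        have := sq_abs (gradS h i (fun x => iterate h u0 n x a) x)
        change |gradS h i (fun x => iterate h u0 n x a) x| ≤
          1 + gradS h i (fun x => iterate h u0 n x a) x ^ 2
        nlinarith [sq_nonneg (|gradS h i (fun x => iterate h u0 n x a) x| - 1)]
    _ ≤ _ := by
        rw [integral_add (integrable_const _) hm.integrable_sq]
        simpa using h2

lemma abs_integral_grad_wedge_le (hΛ : 0 < Λ) (hh : 0 < h) (hu : BallMap Λ u0)
    (hE : energy Λ h u0 ≤ h * E) (n : ℕ) (a b : Fin N) {C : ℝ} {k : Vec d → ℝ}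
    (hk : ∀ x, |k x| ≤ C) (i : Fin d) :
    |∫ x, k x * (iterate h u0 n x a * gradS h i (fun x => iterate h u0 n x b) x -
      iterate h u0 n x b * gradS h i (fun x => iterate h u0 n x a) x) ∂torusMeasure d Λ| ≤
      C * (2 * ((torusMeasure d Λ).real Set.univ + E)) := by
  have hb := fun a => (((hu.iterate hh n).bddPeriodic a).gradS hh i).integrable hΛ
  have hC : 0 ≤ C := (abs_nonneg _).trans (hk 0)
  have h1 := integral_gradS_abs_le hΛ hh hu hE n i a
  have h2 := integral_gradS_abs_le hΛ hh hu hE n i b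
  calc _ ≤ ∫ x, C * (|gradS h i (fun x => iterate h u0 n x b) x| +
        |gradS h i (fun x => iterate h u0 n x a) x|) ∂torusMeasure d Λ := by
        refine norm_integral_le_of_norm_le (f := fun x => k x *
          (iterate h u0 n x a * gradS h i (fun x => iterate h u0 n x b) x -
            iterate h u0 n x b * gradS h i (fun x => iterate h u0 n x a) x)) (((hb b).abs.add (hb a).abs).const_mul C)
          (Eventually.of_forall fun x => ?_)
        rw [norm_mul]
        refine mul_le_mul (hk x) ((norm_sub_le _ _).trans ?_) (norm_nonneg _) hC
        rw [norm_mul, norm_mul]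
        exact add_le_add
          (mul_le_of_le_one_left (norm_nonneg _) ((hu.iterate hh n).abs_apply_le a x))
          (mul_le_of_le_one_left (norm_nonneg _) ((hu.iterate hh n).abs_apply_le b x))
    _ ≤ _ := by
        rw [integral_const_mul, integral_add (hb b).abs (hb a).abs]
        exact mul_le_mul_of_nonneg_left (by linarith) hC

lemma dComp_eq (hh : 0 < h) (a : Fin N) (x : Vec d) (t : ℝ) :
    dComp h u0 a (x, t) = h⁻¹ * (heatS h (fun x => iterate h u0 ⌊t / h⌋₊ x a) x -
      heatS h (fun x => iterate h u0 (⌊t / h⌋₊ - 1) x a) x) := by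
  rw [dComp, wComp, wComp, interp_sub_step hh, interp]

/-- For t ≥ h there is a preceding step, whose convolution is parallel to the present map and drops
out of the wedge; what remains is the commutator. For t < h the time quotient is zero and only the
bounded gradient terms are left. -/
lemma abs_integral_wedgeIntegrand_le (hΛ : 0 < Λ) (hh : 0 < h) (hu : BallMap Λ u0)
    (hE : energy Λ h u0 ≤ h * E) (a b : Fin N) {C t : ℝ} {φ : Vec d × ℝ → ℝ}
    {Dφ : Fin d → Vec d × ℝ → ℝ}
    (hφ : Tame Λ C (fun x => φ (x, t)) fun i x => Dφ i (x, t)) :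
    |∫ x, wedgeIntegrand h u0 a b φ Dφ (x, t) ∂torusMeasure d Λ| ≤
      C * commConst d Λ E * √h + (Set.Iio h).indicator
        (fun _ => d * (C * (2 * ((torusMeasure d Λ).real Set.univ + E)))) t := by
  have := isFiniteMeasure_torusMeasure d hΛ
  have hE0 := nonneg_of_energy_le hΛ hh hu hE
  have hV : 0 ≤ (torusMeasure d Λ).real Set.univ := measureReal_nonneg
  set n := ⌊t / h⌋₊ with hn
  have hb := fun a => (hu.iterate hh n).bddPeriodic a
  have iD : ∀ i, Integrable (fun x => Dφ i (x, t) *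
      (iterate h u0 n x a * gradS h i (fun x => iterate h u0 n x b) x -
        iterate h u0 n x b * gradS h i (fun x => iterate h u0 n x a) x)) (torusMeasure d Λ) :=
    fun i => ((hφ.bddPeriodic_grad i).mul (((hb a).mul ((hb b).gradS hh i)).sub
      ((hb b).mul ((hb a).gradS hh i)))).integrable hΛ
  have iφ : Integrable (fun x => φ (x, t) *
      (iterate h u0 n x a * heatS h (fun x => iterate h u0 n x b) x -
        iterate h u0 n x b * heatS h (fun x => iterate h u0 n x a) x)) (torusMeasure d Λ) :=
    (hφ.bddPeriodic.mul (((hb a).mul ((hb b).heatS hh)).sub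
      ((hb b).mul ((hb a).heatS hh)))).integrable hΛ
  have hcc : 0 ≤ C * commConst d Λ E * √h := by
    have h1 : 0 ≤ commConst d Λ E := by
      rw [commConst]
      positivity
    have := hφ.nonneg
    positivity
  by_cases hth : t < h
  · have hn0 : n = 0 := by
      rw [hn, Nat.floor_eq_zero, div_lt_one hh]
      exact hth
    have e : ∀ x, wedgeIntegrand h u0 a b φ Dφ (x, t) = ∑ i, Dφ i (x, t) *
        (iterate h u0 n x a * gradS h i (fun x => iterate h u0 n x b) x -
          iterate h u0 n x b * gradS h i (fun x => iterate h u0 n x a) x) := fun x => by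
      rw [wedgeIntegrand, dComp_eq hh, dComp_eq hh, ← hn, hn0]
      simp [uComp, gComp, interp, ← hn, hn0]
    simp_rw [e]
    rw [integral_finsetSum _ fun i _ => iD i, Set.indicator_of_mem (Set.mem_Iio.2 hth)]
    refine le_add_of_nonneg_of_le hcc ((Finset.abs_sum_le_sum_abs _ _).trans ?_)
    refine (Finset.sum_le_sum fun i _ => abs_integral_grad_wedge_le hΛ hh hu hE n a b
      (hφ.bound_grad i) i).trans (le_of_eq ?_)
    simp
  · have hn1 : n = (n - 1) + 1 := by
      have : 1 ≤ n := by
        rw [hn, Nat.one_le_floor_iff, one_le_div hh]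
        exact not_lt.1 hth
      omega
    have e : ∀ x, wedgeIntegrand h u0 a b φ Dφ (x, t) =
        h⁻¹ * (φ (x, t) * (iterate h u0 n x a * heatS h (fun x => iterate h u0 n x b) x -
          iterate h u0 n x b * heatS h (fun x => iterate h u0 n x a) x)) + ∑ i, Dφ i (x, t) *
        (iterate h u0 n x a * gradS h i (fun x => iterate h u0 n x b) x -
          iterate h u0 n x b * gradS h i (fun x => iterate h u0 n x a) x) := fun x => by
      have h1 : iterate h u0 n x a * heatS h (fun x => iterate h u0 (n - 1) x b) x =
          iterate h u0 n x b * heatS h (fun x => iterate h u0 (n - 1) x a) x := by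
        have := mul_heatS_thresholdStep (hu.iterate hh (n - 1)) hh a b x
        rwa [← iterate_succ, ← hn1] at this
      rw [wedgeIntegrand, dComp_eq hh, dComp_eq hh, ← hn]
      simp only [uComp, gComp, interp, ← hn]
      linear_combination (-φ (x, t) * h⁻¹) * h1
    simp_rw [e]
    rw [integral_add (iφ.const_mul _) (integrable_finsetSum _ fun i _ => iD i), integral_const_mul,
      integral_finsetSum _ fun i _ => iD i, Set.indicator_of_notMem (by simpa using hth), add_zero]
    refine abs_commutator_le hΛ hh hφ (hb a) (hb b) ((hu.iterate hh n).abs_apply_le a)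
      ((hu.iterate hh n).abs_apply_le b) ?_
    linarith [deficit_iterate_le hΛ hh hu hE n a, deficit_iterate_le hΛ hh hu hE n b]

namespace SchemeLimit

variable {h : ℕ → ℝ} {u : Fin N → Vec d × ℝ → ℝ} {D : Fin d → Fin N → Vec d × ℝ → ℝ}
  {ut : Fin N → Vec d × ℝ → ℝ} {φ : Vec d × ℝ → ℝ} {Dφ : Fin d → Vec d × ℝ → ℝ}

lemma integrable_wedgeIntegrand (hΛ : 0 < Λ) (H : SchemeLimit Λ T E u0 h u D ut)
    (hφ : TameFam Λ T φ Dφ) (a b : Fin N) (k : ℕ) :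
    Integrable (wedgeIntegrand (h k) u0 a b φ Dφ) (cylinderMeasure d Λ T) := by
  have key : ∀ a {f : Vec d × ℝ → ℝ}, MemLp f 2 (cylinderMeasure d Λ T) →
      MemLp (fun p => uComp (h k) u0 a p * f p) 2 (cylinderMeasure d Λ T) := fun a f hf =>
    memLp_bdd_mul (measurable_uComp H.ball (H.h_pos k) a).aestronglyMeasurable
      (Eventually.of_forall (abs_uComp_le H.ball (H.h_pos k) a)) hf
  refine (integrable_mul_of_memLp (hφ.memLp hΛ) ((key a ((H.conv_time b).memLp k)).sub
    (key b ((H.conv_time a).memLp k)))).add (integrable_finsetSum _ fun i _ =>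
    integrable_mul_of_memLp (hφ.memLp_grad hΛ i) ((key a ((H.conv_grad i b).memLp k)).sub
    (key b ((H.conv_grad i a).memLp k))))

lemma tendsto_integral_wedgeIntegrand (hΛ : 0 < Λ) (hT : 0 < T)
    (H : SchemeLimit Λ T E u0 h u D ut) (hφ : TameFam Λ T φ Dφ) (a b : Fin N) :
    Tendsto (fun k => ∫ p, wedgeIntegrand (h k) u0 a b φ Dφ p ∂cylinderMeasure d Λ T)
      atTop (𝓝 0) := by
  obtain ⟨C, hC⟩ := hφ.tame
  -- Any time in the open interval would do.
  have hC0 : 0 ≤ C := (hC (T / 2) ⟨by linarith, by linarith⟩).nonneg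
  have hE0 : 0 ≤ E := nonneg_of_energy_le hΛ (H.h_pos 0) H.ball (H.energy_le 0)
  set K : ℝ := d * (C * (2 * ((torusMeasure d Λ).real Set.univ + E))) with hK
  have hK0 : 0 ≤ K := by
    have : 0 ≤ (torusMeasure d Λ).real Set.univ := measureReal_nonneg
    positivity
  have h1 : Tendsto (fun k => T * (C * commConst d Λ E * √(h k)) + h k * K) atTop (𝓝 0) := by
    have := ((H.h_lim.sqrt.const_mul (C * commConst d Λ E)).const_mul T).add (H.h_lim.mul_const K)
    simpa using this
  refine squeeze_zero_norm (fun k => ?_) h1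
  have hh := H.h_pos k
  rw [integral_cylinder hΛ (H.integrable_wedgeIntegrand hΛ hφ a b k)]
  have i1 : Integrable ((Set.Iio (h k)).indicator fun _ : ℝ => K)
      (volume.restrict (Set.Ioo 0 T)) := (integrable_const K).indicator measurableSet_Iio
  calc _ ≤ ∫ t in Set.Ioo 0 T, (C * commConst d Λ E * √(h k) +
        (Set.Iio (h k)).indicator (fun _ => K) t) := by
        refine norm_integral_le_of_norm_le ((integrable_const _).add i1) ?_
        exact ae_restrict_of_forall_mem measurableSet_Ioo fun t ht =>
          abs_integral_wedgeIntegrand_le hΛ hh H.ball (H.energy_le k) a b (hC t ht)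
    _ ≤ _ := by
        rw [integral_add (integrable_const _) i1, integral_indicator measurableSet_Iio,
          Measure.restrict_restrict measurableSet_Iio]
        refine add_le_add (by simp [hT.le]) ?_
        rw [integral_const, smul_eq_mul]
        refine mul_le_mul_of_nonneg_right ?_ hK0
        rw [measureReal_restrict_apply_univ]
        refine (measureReal_mono (s₂ := Set.Ioo 0 (h k)) (fun t ht => ⟨ht.2.1, ht.1⟩) (by simp)).trans ?_
        simp [hh.le]

/-- The limit satisfies the wedge form of the harmonic map heat flow. -/
lemma wedge_equation (hΛ : 0 < Λ) (hT : 0 < T)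
    (H : SchemeLimit Λ T E u0 h u D ut) (hφ : TameFam Λ T φ Dφ) (a b : Fin N) :
    ∫ p, φ p * (u a p * ut b p - u b p * ut a p) ∂cylinderMeasure d Λ T +
      ∑ i, ∫ p, Dφ i p * (u a p * D i b p - u b p * D i a p) ∂cylinderMeasure d Λ T = 0 := by
  obtain ⟨C, hC, hCD⟩ := hφ.bound hΛ
  have key : ∀ {b : Vec d × ℝ → ℝ}, Measurable b →
      (∀ᵐ p ∂cylinderMeasure d Λ T, |b p| ≤ C) → ∀ {a a' : Fin N} {F F' : ℕ → Vec d × ℝ → ℝ}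
      {f f' : Vec d × ℝ → ℝ}, WeakConv (cylinderMeasure d Λ T) F f →
      WeakConv (cylinderMeasure d Λ T) F' f' →
      Tendsto (fun k => ∫ p, b p * (uComp (h k) u0 a p * F k p - uComp (h k) u0 a' p * F' k p)
        ∂cylinderMeasure d Λ T) atTop
        (𝓝 (∫ p, b p * (u a p * f p - u a' p * f' p) ∂cylinderMeasure d Λ T)) := by
    intro b hb hbC a a' F F' f f' hF hF'
    have s1 := (H.conv a).bdd_mul hb.aestronglyMeasurable hbC
    have s2 := (H.conv a').bdd_mul hb.aestronglyMeasurable hbC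
    have := (s1.tendsto_integral_mul hF).sub (s2.tendsto_integral_mul hF')
    rw [← integral_sub (integrable_mul_of_memLp s1.memLp_lim hF.memLp_lim)
      (integrable_mul_of_memLp s2.memLp_lim hF'.memLp_lim)] at this
    simp_rw [mul_sub, ← mul_assoc]
    refine this.congr fun k => ?_
    rw [← integral_sub (integrable_mul_of_memLp (s1.memLp k) (hF.memLp k))
      (integrable_mul_of_memLp (s2.memLp k) (hF'.memLp k))]
  have t1 := (key hφ.measurable hC (a := a) (a' := b) (H.conv_time b) (H.conv_time a)).add
    (tendsto_finsetSum Finset.univ fun i _ => key (hφ.measurable_grad i) (hCD i) (a := a) (a' := b)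
      (H.conv_grad i b) (H.conv_grad i a))
  refine tendsto_nhds_unique t1 ((H.tendsto_integral_wedgeIntegrand hΛ hT hφ a b).congr fun k => ?_)
  have mu : ∀ a {f : Vec d × ℝ → ℝ}, MemLp f 2 (cylinderMeasure d Λ T) →
      MemLp (fun p => uComp (h k) u0 a p * f p) 2 (cylinderMeasure d Λ T) := fun a f hf =>
    memLp_bdd_mul (measurable_uComp H.ball (H.h_pos k) a).aestronglyMeasurable
      (Eventually.of_forall (abs_uComp_le H.ball (H.h_pos k) a)) hf
  have i2 : ∀ i, Integrable (fun p => Dφ i p * (uComp (h k) u0 a p * gComp (h k) u0 i b p -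
      uComp (h k) u0 b p * gComp (h k) u0 i a p)) (cylinderMeasure d Λ T) := fun i =>
    integrable_mul_of_memLp (hφ.memLp_grad hΛ i) ((mu a ((H.conv_grad i b).memLp k)).sub
      (mu b ((H.conv_grad i a).memLp k)))
  have i1 : Integrable (fun p => φ p * (uComp (h k) u0 a p * dComp (h k) u0 b p -
      uComp (h k) u0 b p * dComp (h k) u0 a p)) (cylinderMeasure d Λ T) :=
    integrable_mul_of_memLp (hφ.memLp hΛ) ((mu a ((H.conv_time b).memLp k)).sub
      (mu b ((H.conv_time a).memLp k)))
  rw [← integral_finsetSum _ fun i _ => i2 i, ← integral_add i1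
    (integrable_finsetSum _ fun i _ => i2 i)]
  rfl

end SchemeLimit

end Wedge

end HMHF

namespace HMHF

section SmoothPeriodic

variable {d : ℕ} {Λ T : ℝ}

/-! ### Smooth functions, periodic in space -/

lemma exists_mem_cell (hΛ : 0 < Λ) (x : Vec d) :
    ∃ y ∈ cell d Λ, ∀ {α : Type} {f : Vec d → α}, IsPeriodic Λ f → f y = f x := by
  obtain ⟨v, hv, -⟩ := ZSpan.exist_unique_vadd_mem_fundamentalDomain (cellBasis d hΛ) x
  refine ⟨v +ᵥ x, fundamentalDomain_cellBasis (d := d) hΛ ▸ hv, fun {α f} hf => ?_⟩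
  rw [Submodule.vadd_def, vadd_eq_add, add_comm]
  exact hf.add_lattice hΛ v.2 x

/-- By periodicity the supremum is attained over the closure of the cell, which is compact. -/
lemma exists_bound_of_periodic (hΛ : 0 < Λ) {F : Type} [NormedAddCommGroup F]
    {ψ : Vec d × ℝ → F} (hψ : Continuous ψ) (hper : ∀ t, IsPeriodic Λ fun x => ψ (x, t)) (A B : ℝ) :
    ∃ C, ∀ x, ∀ t ∈ Set.Icc A B, ‖ψ (x, t)‖ ≤ C := by
  have hc : IsCompact (closure (cell d Λ) ×ˢ Set.Icc A B) :=
    (isBounded_cell d hΛ).isCompact_closure.prod isCompact_Icc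
  obtain ⟨C, hC⟩ := hc.exists_bound_of_continuousOn hψ.continuousOn
  refine ⟨C, fun x t ht => ?_⟩
  obtain ⟨y, hy, h⟩ := exists_mem_cell hΛ x
  rw [← h (hper t)]
  exact hC (y, t) ⟨subset_closure hy, ht⟩

lemma isPeriodic_fderiv {F : Type} [NormedAddCommGroup F] [NormedSpace ℝ F]
    {φ : Vec d × ℝ → F} (hper : ∀ t, IsPeriodic Λ fun x => φ (x, t)) (t : ℝ) :
    IsPeriodic Λ fun x => fderiv ℝ φ (x, t) := fun x i => by
  have h1 : (fun p : Vec d × ℝ => φ (p + (EuclideanSpace.single i Λ, 0))) = φ := by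
    funext p
    obtain ⟨y, s⟩ := p
    simpa using hper s y i
  have h2 := fderiv_comp_add_right (𝕜 := ℝ) (f := φ) (x := (x, t))
    (EuclideanSpace.single i Λ, (0 : ℝ))
  rw [h1] at h2
  simpa using h2.symm

/-- Test functions for weak derivatives on the cylinder. -/
structure IsTest (Λ T : ℝ) (φ : Vec d × ℝ → ℝ) : Prop where
  contDiff : ContDiff ℝ ∞ φ
  periodic : ∀ t, IsPeriodic Λ fun x => φ (x, t)
  support : ∃ a b, 0 < a ∧ b < T ∧ ∀ x t, φ (x, t) ≠ 0 → t ∈ Set.Icc a b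

namespace IsTest

variable {φ : Vec d × ℝ → ℝ}

lemma continuous_fderiv (hφ : IsTest Λ T φ) (e : Vec d × ℝ) :
    Continuous fun p => fderiv ℝ φ p e :=
  (hφ.contDiff.continuous_fderiv (by simp)).clm_apply continuous_const

lemma hasDerivAt (hφ : IsTest Λ T φ) (x : Vec d) (t : ℝ) :
    HasDerivAt (fun s => φ (x, s)) (fderiv ℝ φ (x, t) (timeDir d)) t := by
  have h1 := (hφ.contDiff.differentiable (by simp) (x, t)).hasFDerivAt
  have h2 : HasDerivAt (fun s : ℝ => (x, s)) (timeDir d) t :=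
    (hasDerivAt_const t x).prodMk (hasDerivAt_id t)
  exact h1.comp_hasDerivAt t h2

/-- The function itself is bounded at all times by its support. Its time derivative is bounded up to
T + 1 so that the mean value inequality applies between t and t + h for h ≤ 1. -/
lemma bound (hφ : IsTest Λ T φ) (hΛ : 0 < Λ) (hT : 0 < T) :
    ∃ C, (∀ p, |φ p| ≤ C) ∧
      ∀ x, ∀ t ∈ Set.Icc 0 (T + 1), |fderiv ℝ φ (x, t) (timeDir d)| ≤ C := by
  obtain ⟨C, hC⟩ := exists_bound_of_periodic hΛ hφ.contDiff.continuous hφ.periodic 0 T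
  obtain ⟨C', hC'⟩ := exists_bound_of_periodic hΛ (hφ.continuous_fderiv (timeDir d))
    (fun t x i => by
      have := isPeriodic_fderiv hφ.periodic t x i
      simp only at this ⊢
      rw [this]) 0 (T + 1)
  obtain ⟨a, b, ha, hb, hs⟩ := hφ.support
  refine ⟨max C C', fun p => ?_, fun x t ht => (hC' x t ht).trans (le_max_right _ _)⟩
  by_cases hp : φ p = 0
  · rw [hp, abs_zero]
    exact ((norm_nonneg _).trans (hC 0 0 ⟨le_rfl, hT.le⟩)).trans (le_max_left _ _)
  · have := hs p.1 p.2 hp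
    exact (hC p.1 p.2 ⟨ha.le.trans this.1, this.2.trans hb.le⟩).trans (le_max_left _ _)

lemma memLp (hφ : IsTest Λ T φ) (hΛ : 0 < Λ) (hT : 0 < T) :
    MemLp φ 2 (cylinderMeasure d Λ T) := by
  obtain ⟨C, hC, -⟩ := hφ.bound hΛ hT
  exact memLp_cylinder_of_bound hΛ hφ.contDiff.continuous.aestronglyMeasurable hC 2

lemma ae_bound_time (hφ : IsTest Λ T φ) (hΛ : 0 < Λ) (hT : 0 < T) :
    ∃ C, ∀ᵐ p ∂cylinderMeasure d Λ T, |fderiv ℝ φ p (timeDir d)| ≤ C := by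
  obtain ⟨C, -, hC⟩ := hφ.bound hΛ hT
  refine ⟨C, ae_restrict_of_forall_mem ((measurableSet_cell d hΛ).prod measurableSet_Ioo)
    fun p hp => hC p.1 p.2 ⟨hp.2.1.le, by linarith [hp.2.2]⟩⟩

lemma memLp_time (hφ : IsTest Λ T φ) (hΛ : 0 < Λ) (hT : 0 < T) :
    MemLp (fun p => fderiv ℝ φ p (timeDir d)) 2 (cylinderMeasure d Λ T) := by
  have := isFiniteMeasure_cylinderMeasure d hΛ T
  obtain ⟨C, hC⟩ := hφ.ae_bound_time hΛ hT
  exact MemLp.of_bound (hφ.continuous_fderiv _).aestronglyMeasurable C hC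

/-- Summation by parts in time. -/
lemma integral_mul_shift (hφ : IsTest Λ T φ) (hΛ : 0 < Λ) (hT : 0 < T) {g : Vec d × ℝ → ℝ} {M : ℝ}
    (hg : Measurable g) (hM : ∀ p, |g p| ≤ M) {h : ℝ} (hh : 0 ≤ h)
    (hs : ∀ x t, φ (x, t) ≠ 0 → t ∈ Set.Ioo h T) :
    ∫ p, φ p * g (p.1, p.2 - h) ∂cylinderMeasure d Λ T =
      ∫ p, φ (p.1, p.2 + h) * g p ∂cylinderMeasure d Λ T := by
  have := isFiniteMeasure_cylinderMeasure d hΛ T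
  have := isFiniteMeasure_torusMeasure d hΛ
  obtain ⟨C, hC, -⟩ := hφ.bound hΛ hT
  have key : ∀ {f g : Vec d × ℝ → ℝ}, Measurable f → (∀ p, |f p| ≤ C) → Measurable g →
      (∀ p, |g p| ≤ M) → Integrable (fun p => f p * g p) (cylinderMeasure d Λ T) := by
    intro f g hf hfC hg hgM
    exact integrable_mul_of_memLp (memLp_cylinder_of_bound hΛ hf.aestronglyMeasurable hfC 2)
      (memLp_cylinder_of_bound hΛ hg.aestronglyMeasurable hgM 2)
  have hφm := hφ.contDiff.continuous.measurable
  have i1 : Integrable (fun p => φ p * g (p.1, p.2 - h)) (cylinderMeasure d Λ T) :=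
    key hφm hC (hg.comp (measurable_fst.prodMk (measurable_snd.sub_const h))) fun _ => hM _
  have i2 : Integrable (fun p => φ (p.1, p.2 + h) * g p) (cylinderMeasure d Λ T) :=
    key (hφm.comp (measurable_fst.prodMk (measurable_snd.add_const h))) (fun _ => hC _) hg hM
  rw [cylinderMeasure_eq_prod] at i1 i2 ⊢
  rw [integral_prod _ i1, integral_prod _ i2]
  congr 1; funext x
  -- Since φ lives on times in (h, T), both integrands vanish outside (0, T) and the translation can
  -- be made on the whole line.
  rw [setIntegral_eq_integral_of_forall_compl_eq_zero fun t ht => ?_,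
    setIntegral_eq_integral_of_forall_compl_eq_zero fun t ht => ?_]
  · rw [← integral_sub_right_eq_self (fun t => φ (x, t + h) * g (x, t)) h]
    simp only [sub_add_cancel]
  · by_contra hne
    have h1 := hs x (t + h) (left_ne_zero_of_mul hne)
    exact ht ⟨by linarith [h1.1], by linarith [h1.2]⟩
  · by_contra hne
    have h1 := hs x t (left_ne_zero_of_mul hne)
    exact ht ⟨by linarith [h1.1], h1.2⟩

/-- The difference quotients of a test function. -/
lemma tendsto_integral_quotient_sub (hφ : IsTest Λ T φ) (hΛ : 0 < Λ) (hT : 0 < T) {h : ℕ → ℝ}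
    (h_pos : ∀ k, 0 < h k) (h_lim : Tendsto h atTop (𝓝 0)) :
    Tendsto (fun k => ∫ p, |(h k)⁻¹ * (φ (p.1, p.2 + h k) - φ p) - fderiv ℝ φ p (timeDir d)|
      ∂cylinderMeasure d Λ T) atTop (𝓝 0) := by
  have := isFiniteMeasure_cylinderMeasure d hΛ T
  obtain ⟨C, hC, hCt⟩ := hφ.bound hΛ hT
  have hφc := hφ.contDiff.continuous
  have h0 : (0 : ℝ) = ∫ _, (0 : ℝ) ∂cylinderMeasure d Λ T := by simp
  conv => enter [3]; rw [h0]
  have hm : MeasurableSet (cell d Λ ×ˢ Set.Ioo 0 T) :=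
    (measurableSet_cell d hΛ).prod measurableSet_Ioo
  refine tendsto_integral_filter_of_dominated_convergence (fun _ => C + C)
    (Eventually.of_forall fun k => ?_) ?_ (integrable_const _) ?_
  · refine Continuous.aestronglyMeasurable ?_
    have := hφ.continuous_fderiv (timeDir d)
    fun_prop
  · filter_upwards [h_lim.eventually_le_const one_pos] with k hk
    refine ae_restrict_of_forall_mem hm fun p hp => ?_
    obtain ⟨x, t⟩ := p
    have ht : t ∈ Set.Ioo 0 T := hp.2
    rw [Real.norm_eq_abs, abs_abs]
    refine (abs_sub _ _).trans (add_le_add ?_ (hCt x t ⟨ht.1.le, by linarith [ht.2]⟩))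
    have h1 := (convex_Icc (0 : ℝ) (T + 1)).norm_image_sub_le_of_norm_hasDerivWithin_le
      (f := fun s => φ (x, s)) (fun s _ => (hφ.hasDerivAt x s).hasDerivWithinAt) (hCt x)
      (⟨ht.1.le, by linarith [ht.2]⟩ : t ∈ Set.Icc (0 : ℝ) (T + 1))
      (⟨by linarith [ht.1, h_pos k], by linarith [ht.2]⟩ : t + h k ∈ Set.Icc (0 : ℝ) (T + 1))
    rw [abs_mul, abs_of_pos (inv_pos.2 (h_pos k)), inv_mul_le_iff₀ (h_pos k), mul_comm]
    simpa [abs_of_pos (h_pos k)] using h1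
  · refine Eventually.of_forall fun p => ?_
    obtain ⟨x, t⟩ := p
    have h1 := (hφ.hasDerivAt x t).tendsto_slope_zero
    have h2 : Tendsto h atTop (𝓝[≠] 0) := tendsto_nhdsWithin_iff.2
      ⟨h_lim, Eventually.of_forall fun k => (h_pos k).ne'⟩
    have h3 := ((h1.comp h2).sub_const (fderiv ℝ φ (x, t) (timeDir d))).abs
    simpa using h3

/-- Difference quotients in time converge weakly to the derivative. -/
lemma tendsto_integral_mul_quotient (hφ : IsTest Λ T φ) (hΛ : 0 < Λ) (hT : 0 < T) {h : ℕ → ℝ}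
    (h_pos : ∀ k, 0 < h k) (h_lim : Tendsto h atTop (𝓝 0)) {g : ℕ → Vec d × ℝ → ℝ} {M L : ℝ}
    (hg : ∀ k, Measurable (g k)) (hM : ∀ k p, |g k p| ≤ M)
    (hL : Tendsto (fun k => ∫ p, fderiv ℝ φ p (timeDir d) * g k p ∂cylinderMeasure d Λ T)
      atTop (𝓝 L)) :
    Tendsto (fun k => ∫ p, φ p * ((h k)⁻¹ * (g k p - g k (p.1, p.2 - h k)))
      ∂cylinderMeasure d Λ T) atTop (𝓝 (-L)) := by
  have := isFiniteMeasure_cylinderMeasure d hΛ T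
  obtain ⟨C, hC, -⟩ := hφ.bound hΛ hT
  obtain ⟨a, b, ha, hb, hs⟩ := hφ.support
  have hφm := hφ.contDiff.continuous
  have gL : ∀ k, MemLp (g k) 2 (cylinderMeasure d Λ T) := fun k =>
    memLp_cylinder_of_bound hΛ (hg k).aestronglyMeasurable (hM k) 2
  have gsL : ∀ k, MemLp (fun p => g k (p.1, p.2 - h k)) 2 (cylinderMeasure d Λ T) := fun k =>
    memLp_cylinder_of_bound hΛ ((hg k).comp
      (measurable_fst.prodMk (measurable_snd.sub_const _))).aestronglyMeasurable (fun _ => hM k _) 2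
  have φL := hφ.memLp hΛ hT
  have φsL : ∀ k, MemLp (fun p : Vec d × ℝ => φ (p.1, p.2 + h k)) 2 (cylinderMeasure d Λ T) :=
    fun k => memLp_cylinder_of_bound hΛ (by fun_prop : Continuous fun p : Vec d × ℝ =>
      φ (p.1, p.2 + h k)).aestronglyMeasurable (fun _ => hC _) 2
  have φtL := hφ.memLp_time hΛ hT
  have QL : ∀ k, MemLp (fun p : Vec d × ℝ => (h k)⁻¹ * (φ (p.1, p.2 + h k) - φ p) -
      fderiv ℝ φ p (timeDir d)) 2 (cylinderMeasure d Λ T) := fun k =>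
    (((φsL k).sub φL).const_mul _).sub φtL
  have h1 : Tendsto (fun k => ∫ p, ((h k)⁻¹ * (φ (p.1, p.2 + h k) - φ p) -
      fderiv ℝ φ p (timeDir d)) * g k p ∂cylinderMeasure d Λ T) atTop (𝓝 0) := by
    have h2 := (hφ.tendsto_integral_quotient_sub hΛ hT h_pos h_lim).mul_const M
    rw [zero_mul] at h2
    refine squeeze_zero_norm (fun k => ?_) h2
    rw [← integral_mul_const]
    refine norm_integral_le_of_norm_le (((QL k).integrable one_le_two).abs.mul_const M)
      (Eventually.of_forall fun p => ?_)
    rw [norm_mul]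
    exact mul_le_mul_of_nonneg_left (hM k p) (norm_nonneg _)
  have h3 := (h1.add hL).neg
  rw [zero_add] at h3
  refine h3.congr' ?_
  filter_upwards [h_lim.eventually_lt_const ha] with k hk
  have e1 := hφ.integral_mul_shift hΛ hT (hg k) (hM k) (h_pos k).le fun x t hne =>
    ⟨hk.trans_le (hs x t hne).1, (hs x t hne).2.trans_lt hb⟩
  have i1 := integrable_mul_of_memLp φL (gL k)
  have i2 := integrable_mul_of_memLp φL (gsL k)
  have i3 := integrable_mul_of_memLp (φsL k) (gL k)
  rw [← integral_add (integrable_mul_of_memLp (QL k) (gL k))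
    (integrable_mul_of_memLp φtL (gL k))]
  have e2 : ∀ p : Vec d × ℝ, ((h k)⁻¹ * (φ (p.1, p.2 + h k) - φ p) - fderiv ℝ φ p (timeDir d)) *
      g k p + fderiv ℝ φ p (timeDir d) * g k p =
      (h k)⁻¹ * (φ (p.1, p.2 + h k) * g k p - φ p * g k p) := fun p => by ring
  have e3 : ∀ p : Vec d × ℝ, φ p * ((h k)⁻¹ * (g k p - g k (p.1, p.2 - h k))) =
      (h k)⁻¹ * (φ p * g k p - φ p * g k (p.1, p.2 - h k)) := fun p => by ring
  simp_rw [e2, e3]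
  rw [integral_const_mul, integral_const_mul, integral_sub i3 i1, integral_sub i1 i2, e1]
  ring

/-- The difference quotients of the constant 1 vanish. -/
lemma integral_time_eq_zero (hφ : IsTest Λ T φ) (hΛ : 0 < Λ) (hT : 0 < T) :
    ∫ p, fderiv ℝ φ p (timeDir d) ∂cylinderMeasure d Λ T = 0 := by
  have h1 := hφ.tendsto_integral_mul_quotient hΛ hT (h := fun k => 1 / ((k : ℝ) + 1))
    (fun k => by positivity) tendsto_one_div_add_atTop_nhds_zero_nat (g := fun _ _ => 1) (M := 1)
    (fun _ => measurable_const) (fun _ _ => by simp) tendsto_const_nhds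
  simp only [sub_self, mul_zero, integral_zero, mul_one] at h1
  exact neg_eq_zero.1 (tendsto_nhds_unique h1 tendsto_const_nhds)

end IsTest

end SmoothPeriodic

namespace SchemeLimit

variable {d N : ℕ} {Λ T E : ℝ} {u0 : Vec d → Vec N} {φ : Vec d × ℝ → ℝ}
  {Dφ : Fin d → Vec d × ℝ → ℝ} {h : ℕ → ℝ} {u : Fin N → Vec d × ℝ → ℝ}
  {D : Fin d → Fin N → Vec d × ℝ → ℝ} {ut : Fin N → Vec d × ℝ → ℝ}

/-! ### The time derivative of the limit -/

lemma integral_time_mul (hΛ : 0 < Λ) (hT : 0 < T) (H : SchemeLimit Λ T E u0 h u D ut)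
    (hφ : IsTest Λ T φ) (a : Fin N) :
    ∫ p, fderiv ℝ φ p (timeDir d) * u a p ∂cylinderMeasure d Λ T =
      -∫ p, φ p * ut a p ∂cylinderMeasure d Λ T := by
  have h1 := (H.conv_w hΛ hT a).weakConv.tendsto _ (hφ.memLp_time hΛ hT)
  simp only [mul_comm _ (fderiv ℝ φ _ _)] at h1
  have h2 := hφ.tendsto_integral_mul_quotient hΛ hT H.h_pos H.h_lim
    (fun k => measurable_wComp H.ball (H.h_pos k) a)
    (fun k => abs_wComp_le H.ball (H.h_pos k) a) h1
  have h3 := (H.conv_time a).tendsto _ (hφ.memLp hΛ hT)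
  simp only [mul_comm _ (φ _)] at h3
  rw [← tendsto_nhds_unique h2 h3, neg_neg]

/-- Let w be a component of the smoothed map. The quotient of w² factors as (w(t) + w(t - h)) times
the quotient of w. Summed over components and tested with φ, the factorised form tends to 2 ∫ φ u ·
∂ₜu by strong times weak convergence, while summation by parts gives -∫ ∂ₜφ |u|² = -∫ ∂ₜφ = 0. -/
lemma integral_mul_sum_mul_time (hΛ : 0 < Λ) (hT : 0 < T) (H : SchemeLimit Λ T E u0 h u D ut)
    (hφ : IsTest Λ T φ) : ∫ p, φ p * ∑ a, u a p * ut a p ∂cylinderMeasure d Λ T = 0 := by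
  obtain ⟨C, hC, -⟩ := hφ.bound hΛ hT
  obtain ⟨C', hC'⟩ := hφ.ae_bound_time hΛ hT
  have hφm := hφ.contDiff.continuous.aestronglyMeasurable (μ := cylinderMeasure d Λ T)
  have hφtm := (hφ.continuous_fderiv (timeDir d)).aestronglyMeasurable (μ := cylinderMeasure d Λ T)
  have isq : ∀ a, Integrable (fun p => fderiv ℝ φ p (timeDir d) * u a p * u a p)
      (cylinderMeasure d Λ T) := fun a =>
    integrable_mul_of_memLp (memLp_bdd_mul hφtm hC' (H.memLp a)) (H.memLp a)
  have h1 : Tendsto (fun k => ∫ p, fderiv ℝ φ p (timeDir d) * ∑ a, wComp (h k) u0 a p ^ 2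
      ∂cylinderMeasure d Λ T) atTop (𝓝 0) := by
    have h2 := tendsto_finsetSum (Finset.univ : Finset (Fin N)) fun a _ =>
      ((H.conv_w hΛ hT a).bdd_mul hφtm hC').tendsto_integral_mul (H.conv_w hΛ hT a).weakConv
    rw [← integral_finsetSum _ fun a _ => isq a] at h2
    have e : ∫ p, ∑ a, fderiv ℝ φ p (timeDir d) * u a p * u a p ∂cylinderMeasure d Λ T = 0 := by
      rw [← hφ.integral_time_eq_zero hΛ hT]
      refine integral_congr_ae ?_
      filter_upwards [H.sum_sq_eq_one hΛ hT] with p hp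
      simp_rw [mul_assoc, ← Finset.mul_sum, ← pow_two, hp, mul_one]
    rw [e] at h2
    refine h2.congr fun k => ?_
    rw [← integral_finsetSum]
    · congr 1; funext p
      simp_rw [mul_assoc, ← Finset.mul_sum, ← pow_two]
    · exact fun a _ => integrable_mul_of_memLp
        (memLp_bdd_mul hφtm hC' (memLp_wComp hΛ H.ball (H.h_pos k) a))
        (memLp_wComp hΛ H.ball (H.h_pos k) a)
  have h2 := hφ.tendsto_integral_mul_quotient hΛ hT H.h_pos H.h_lim (M := N)
    (fun k => Finset.measurable_fun_sum _ fun a _ =>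
      (measurable_wComp H.ball (H.h_pos k) a).pow_const 2)
    (fun k p => by
      refine (Finset.abs_sum_le_sum_abs _ _).trans ((Finset.sum_le_card_nsmul _ _ 1 fun a _ => ?_).trans
        (by simp))
      rw [abs_pow]
      exact pow_le_one₀ (abs_nonneg _) (abs_wComp_le H.ball (H.h_pos k) a p)) h1
  have h3 := tendsto_finsetSum (Finset.univ : Finset (Fin N)) fun a _ =>
    (((H.conv_w hΛ hT a).add (H.conv_w_shift hΛ hT a)).bdd_mul hφm
      (Eventually.of_forall hC)).tendsto_integral_mul (H.conv_time a)
  have h4 := tendsto_nhds_unique h2 (h3.congr fun k => ?_)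
  · have i1 : ∀ a, Integrable (fun p => φ p * (u a p + u a p) * ut a p) (cylinderMeasure d Λ T) :=
      fun a => integrable_mul_of_memLp (memLp_bdd_mul hφm (Eventually.of_forall hC)
        ((H.memLp a).add (H.memLp a))) (H.memLp_time a)
    rw [← integral_finsetSum _ fun a _ => i1 a] at h4
    have e : ∀ p, ∑ a, φ p * (u a p + u a p) * ut a p = 2 * (φ p * ∑ a, u a p * ut a p) := by
      intro p
      simp_rw [Finset.mul_sum]
      exact Finset.sum_congr rfl fun a _ => by ring
    simp_rw [e] at h4
    rw [integral_const_mul] at h4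
    linarith
  · rw [← integral_finsetSum]
    · congr 1; funext p
      rw [← Finset.sum_sub_distrib, Finset.mul_sum, Finset.mul_sum]
      exact Finset.sum_congr rfl fun a _ => by rw [dComp]; ring
    · exact fun a _ => integrable_mul_of_memLp (memLp_bdd_mul hφm (Eventually.of_forall hC)
        ((memLp_wComp hΛ H.ball (H.h_pos k) a).add (memLp_wComp_shift hΛ H.ball (H.h_pos k) a)))
        (memLp_dComp hΛ H.ball (H.h_pos k) a)

lemma isTest_mul {e : Vec d → ℝ} {η : ℝ → ℝ} (he : ContDiff ℝ ∞ e) (hp : IsPeriodic Λ e)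
    (hη : ContDiff ℝ ∞ η) (hc : HasCompactSupport η) (hs : tsupport η ⊆ Set.Ioo 0 T) (hT : 0 < T) :
    IsTest Λ T fun p : Vec d × ℝ => η p.2 * e p.1 := by
  refine ⟨(hη.comp contDiff_snd).mul (he.comp contDiff_fst), fun t x i => by
    simp only [hp x i], ?_⟩
  rcases (tsupport η).eq_empty_or_nonempty with h0 | h0
  -- If the support is empty, any times in (0, T) are valid bounds.
  · refine ⟨T / 2, T / 2, by linarith, by linarith, fun x t hne => ?_⟩
    have := subset_tsupport η (Function.mem_support.2 (left_ne_zero_of_mul hne))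
    simp [h0] at this
  · obtain ⟨a, ha, hmin⟩ := hc.isCompact.exists_isMinOn h0 continuousOn_id
    obtain ⟨b, hb, hmax⟩ := hc.isCompact.exists_isMaxOn h0 continuousOn_id
    refine ⟨a, b, (hs ha).1, (hs hb).2, fun x t hne => ?_⟩
    have := subset_tsupport η (Function.mem_support.2 (left_ne_zero_of_mul hne))
    exact ⟨hmin this, hmax this⟩

lemma sum_mul_time_eq_zero (hΛ : 0 < Λ) (hT : 0 < T) (H : SchemeLimit Λ T E u0 h u D ut) :
    ∀ᵐ p ∂cylinderMeasure d Λ T, ∑ a, u a p * ut a p = 0 := by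
  have := isFiniteMeasure_cylinderMeasure d hΛ T
  have hm : MemLp (fun p => ∑ a, u a p * ut a p) 2 (cylinderMeasure d Λ T) :=
    memLp_finsetSum _ fun a _ => H.memLp_mul a (H.memLp_time a)
  have key : ∀ {e : Vec d → ℝ}, ContDiff ℝ ∞ e → BddPeriodic Λ e →
      ∀ᵐ t ∂volume.restrict (Set.Ioo 0 T),
        ∫ x, e x * ∑ a, u a (x, t) * ut a (x, t) ∂torusMeasure d Λ = 0 := by
    intro e he hb
    refine ae_slice_eq_zero_of_smooth (F := fun p => e p.1 * ∑ a, u a p * ut a p) hΛ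
      (integrable_mode_mul (hm.integrable one_le_two) hb) fun η h1 h2 h3 => ?_
    simp_rw [← mul_assoc]
    exact H.integral_mul_sum_mul_time hΛ hT (isTest_mul he hb.periodic h1 h2 h3 hT)
  exact ae_eq_zero_of_modes hΛ hm (fun n => key (contDiff_cosW n) (bddPeriodic_cosW hΛ n))
    fun n => key (contDiff_sinW n) (bddPeriodic_sinW hΛ n)

end SchemeLimit

end HMHF

namespace HMHF

variable {d N : ℕ} {Λ T E : ℝ} {u0 : Vec d → Vec N}

namespace SchemeLimit

variable {ψ : Vec d × ℝ → ℝ} {Dψ : Fin d → Vec d × ℝ → ℝ} {h : ℕ → ℝ} {u : Fin N → Vec d × ℝ → ℝ}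
  {D : Fin d → Fin N → Vec d × ℝ → ℝ} {ut : Fin N → Vec d × ℝ → ℝ}

/-! ### The harmonic map heat flow -/

lemma memLp_wedge (H : SchemeLimit Λ T E u0 h u D ut) (a b : Fin N) {f g : Vec d × ℝ → ℝ}
    (hf : MemLp f 2 (cylinderMeasure d Λ T)) (hg : MemLp g 2 (cylinderMeasure d Λ T)) :
    MemLp (fun p => u a p * f p - u b p * g p) 2 (cylinderMeasure d Λ T) :=
  (H.memLp_mul a hf).sub (H.memLp_mul b hg)

/-- The wedge equation, tested with `ψ u_b`. -/
lemma wedge_equation_mul (hΛ : 0 < Λ) (hT : 0 < T) (H : SchemeLimit Λ T E u0 h u D ut)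
    (hψ : TameFam Λ T ψ Dψ) (a b : Fin N) :
    ∫ p, ψ p * u b p * (u a p * ut b p - u b p * ut a p) ∂cylinderMeasure d Λ T +
      ∑ i, ∫ p, (Dψ i p * u b p + ψ p * D i b p) * (u a p * D i b p - u b p * D i a p)
        ∂cylinderMeasure d Λ T = 0 := by
  obtain ⟨C, hC, hCD⟩ := hψ.bound hΛ
  have hψm := hψ.measurable.aestronglyMeasurable (μ := cylinderMeasure d Λ T)
  have hDm := fun i => (hψ.measurable_grad i).aestronglyMeasurable (μ := cylinderMeasure d Λ T)
  -- Truncations of u_b make the product with ψ admissible. The wedges are in L² because u is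
  -- bounded, so L² convergence of the truncations and of their gradients is enough.
  have s1 := (H.strongConv_trunc hΛ b).bdd_mul hψm hC
  have s2 := fun i => ((H.strongConv_trunc hΛ b).bdd_mul (hDm i) (hCD i)).add
    ((H.strongConv_truncGrad hΛ hT i b).bdd_mul hψm hC)
  have t1 := (s1.weakConv.tendsto _ (H.memLp_wedge a b (H.memLp_time b) (H.memLp_time a))).add
    (tendsto_finsetSum Finset.univ fun i _ => (s2 i).weakConv.tendsto _
      (H.memLp_wedge a b (H.memLp_grad i b) (H.memLp_grad i a)))
  refine tendsto_nhds_unique t1 (tendsto_const_nhds.congr fun k => ?_)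
  exact (H.wedge_equation hΛ hT (hψ.mul (H.tameFam_trunc hΛ b k)) a b).symm

lemma integrable_density (hΛ : 0 < Λ) (H : SchemeLimit Λ T E u0 h u D ut)
    (hψ : TameFam Λ T ψ Dψ) (a : Fin N) :
    Integrable (fun p => ψ p * u a p * ∑ i, ∑ b, D i b p ^ 2) (cylinderMeasure d Λ T) := by
  simp_rw [Finset.mul_sum]
  refine integrable_finsetSum _ fun i _ => integrable_finsetSum _ fun b _ => ?_
  refine (integrable_mul_of_memLp (hψ.memLp_mul hΛ (H.memLp_grad i b))
    (H.memLp_mul a (H.memLp_grad i b))).congr (Eventually.of_forall fun p => ?_)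
  change ψ p * D i b p * (u a p * D i b p) = ψ p * u a p * D i b p ^ 2
  ring

/-- The harmonic map heat flow for the components of the limit. -/
lemma flow_equation (hΛ : 0 < Λ) (hT : 0 < T) (H : SchemeLimit Λ T E u0 h u D ut)
    (hψ : TameFam Λ T ψ Dψ) (a : Fin N) :
    ∫ p, (ψ p * ut a p + ∑ i, Dψ i p * D i a p) ∂cylinderMeasure d Λ T =
      ∫ p, ψ p * u a p * ∑ i, ∑ b, D i b p ^ 2 ∂cylinderMeasure d Λ T := by
  have i1 : ∀ b, Integrable (fun p => ψ p * u b p * (u a p * ut b p - u b p * ut a p))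
      (cylinderMeasure d Λ T) := fun b => integrable_mul_of_memLp (hψ.memLp_mul hΛ (H.memLp b))
    (H.memLp_wedge a b (H.memLp_time b) (H.memLp_time a))
  have i2 : ∀ b i, Integrable (fun p => (Dψ i p * u b p + ψ p * D i b p) *
      (u a p * D i b p - u b p * D i a p)) (cylinderMeasure d Λ T) := fun b i =>
    integrable_mul_of_memLp ((hψ.memLp_grad_mul hΛ i (H.memLp b)).add
      (hψ.memLp_mul hΛ (H.memLp_grad i b))) (H.memLp_wedge a b (H.memLp_grad i b) (H.memLp_grad i a))
  have h1 : ∀ b, ∫ p, (ψ p * u b p * (u a p * ut b p - u b p * ut a p) +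
      ∑ i, (Dψ i p * u b p + ψ p * D i b p) * (u a p * D i b p - u b p * D i a p))
        ∂cylinderMeasure d Λ T = 0 := fun b => by
    rw [integral_add (i1 b) (integrable_finsetSum _ fun i _ => i2 b i),
      integral_finsetSum _ fun i _ => i2 b i]
    exact H.wedge_equation_mul hΛ hT hψ a b
  have i3 : Integrable (fun p => ψ p * ut a p + ∑ i, Dψ i p * D i a p) (cylinderMeasure d Λ T) :=
    (integrable_mul_of_memLp (hψ.memLp hΛ) (H.memLp_time a)).add (integrable_finsetSum _
      fun i _ => integrable_mul_of_memLp (hψ.memLp_grad hΛ i) (H.memLp_grad i a))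
  have i4 : Integrable (fun p => ψ p * u a p * ∑ i, ∑ b, D i b p ^ 2)
      (cylinderMeasure d Λ T) := H.integrable_density hΛ hψ a
  have h2 : ∫ p, ∑ b, (ψ p * u b p * (u a p * ut b p - u b p * ut a p) +
      ∑ i, (Dψ i p * u b p + ψ p * D i b p) * (u a p * D i b p - u b p * D i a p))
        ∂cylinderMeasure d Λ T = 0 := by
    refine (integral_finsetSum (μ := cylinderMeasure d Λ T) _ fun b _ => (i1 b).add
      (integrable_finsetSum _ fun i _ => i2 b i)).trans (Finset.sum_eq_zero fun b _ => h1 b)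
  rw [eq_comm, ← sub_eq_zero, ← integral_sub i4 i3, ← h2]
  refine integral_congr_ae ?_
  filter_upwards [H.sum_sq_eq_one hΛ hT, H.sum_mul_time_eq_zero hΛ hT,
    ae_all_iff.2 (H.sum_mul_grad_eq_zero hΛ hT)] with p hp1 hpt hpD
  rw [Finset.sum_add_distrib, Finset.sum_comm (s := (Finset.univ : Finset (Fin N)))]
  -- Orthogonality of u and ∂ₜu removes one term, unit length evaluates the other.
  have e1 : ∑ b, ψ p * u b p * (u a p * ut b p - u b p * ut a p) = -(ψ p * ut a p) := by
    have : ∑ b, ψ p * u b p * (u a p * ut b p - u b p * ut a p) =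
        ψ p * u a p * ∑ b, u b p * ut b p - ψ p * ut a p * ∑ b, u b p ^ 2 := by
      rw [Finset.mul_sum, Finset.mul_sum, ← Finset.sum_sub_distrib]
      exact Finset.sum_congr rfl fun b _ => by ring
    rw [this, hpt, hp1]
    ring
  -- The derivative falling on u_b produces the density |∂ᵢu|²; all terms containing u · ∂ᵢu vanish.
  have e2 : ∀ i, ∑ b, (Dψ i p * u b p + ψ p * D i b p) * (u a p * D i b p - u b p * D i a p) =
      ψ p * u a p * ∑ b, D i b p ^ 2 - Dψ i p * D i a p := fun i => by
    have : ∑ b, (Dψ i p * u b p + ψ p * D i b p) * (u a p * D i b p - u b p * D i a p) =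
        (Dψ i p * u a p - ψ p * D i a p) * ∑ b, u b p * D i b p +
          ψ p * u a p * ∑ b, D i b p ^ 2 - Dψ i p * D i a p * ∑ b, u b p ^ 2 := by
      rw [Finset.mul_sum, Finset.mul_sum, Finset.mul_sum, ← Finset.sum_add_distrib,
        ← Finset.sum_sub_distrib]
      exact Finset.sum_congr rfl fun b _ => by ring
    rw [this, hpD i, hp1]
    ring
  rw [e1, Finset.sum_congr rfl fun i _ => e2 i, Finset.sum_sub_distrib, ← Finset.mul_sum]
  ring

end SchemeLimit

/-! ### Smooth test functions are tame -/

/-- The first and second derivatives are continuous and periodic, hence bounded for times in [0, T];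
the bound on the second is a Lipschitz constant for the spatial gradient. -/
lemma tameFam_of_contDiff (hΛ : 0 < Λ) {φ : Vec d × ℝ → ℝ} (hφ : ContDiff ℝ ∞ φ)
    (hper : ∀ t, IsPeriodic Λ fun x => φ (x, t)) :
    TameFam Λ T φ fun i p => fderiv ℝ φ p (spaceDir i) := by
  have h1 : ContDiff ℝ ∞ (fderiv ℝ φ) := hφ.fderiv_right (by simp)
  have h2 : ContDiff ℝ ∞ (fderiv ℝ (fderiv ℝ φ)) := h1.fderiv_right (by simp)
  obtain ⟨C0, hC0⟩ := exists_bound_of_periodic hΛ hφ.continuous hper 0 T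
  obtain ⟨C1, hC1⟩ := exists_bound_of_periodic hΛ h1.continuous (isPeriodic_fderiv hper) 0 T
  obtain ⟨C2, hC2⟩ := exists_bound_of_periodic hΛ h2.continuous
    (isPeriodic_fderiv (isPeriodic_fderiv hper)) 0 T
  have hinl : ‖ContinuousLinearMap.inl ℝ (Vec d) ℝ‖ ≤ 1 :=
    ContinuousLinearMap.norm_inl_le_one ℝ (Vec d) ℝ
  have hpair : ∀ (t : ℝ) (x : Vec d),
      HasFDerivAt (fun y : Vec d => (y, t)) (ContinuousLinearMap.inl ℝ (Vec d) ℝ) x :=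
    fun t x => hasFDerivAt_prodMk_left x t
  have hd : ∀ t x, HasFDerivAt (fun y => φ (y, t))
      ((fderiv ℝ φ (x, t)).comp (ContinuousLinearMap.inl ℝ (Vec d) ℝ)) x := fun t x =>
    (hφ.differentiable (by simp) (x, t)).hasFDerivAt.comp x (hpair t x)
  have hd' : ∀ t x, HasFDerivAt (fun y => fderiv ℝ φ (y, t))
      ((fderiv ℝ (fderiv ℝ φ) (x, t)).comp (ContinuousLinearMap.inl ℝ (Vec d) ℝ)) x := fun t x =>
    (h1.differentiable (by simp) (x, t)).hasFDerivAt.comp x (hpair t x)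
  refine ⟨hφ.continuous.measurable, fun i => (h1.continuous.clm_apply continuous_const).measurable,
    max C0 (max C1 C2), fun t ht => ?_⟩
  have ht' : t ∈ Set.Icc 0 T := ⟨ht.1.le, ht.2.le⟩
  have hle : ∀ {F : Type} [NormedAddCommGroup F] [NormedSpace ℝ F] (L : Vec d × ℝ →L[ℝ] F),
      ‖L.comp (ContinuousLinearMap.inl ℝ (Vec d) ℝ)‖ ≤ ‖L‖ := fun L =>
    (L.opNorm_comp_le _).trans (mul_le_of_le_one_right (norm_nonneg _) hinl)
  have h3 := Tame.of_lipschitz_fderiv (Λ := Λ) (C := max C0 (max C1 C2)) (φ := fun x => φ (x, t))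
    (hper t) (fun x => (hC0 x t ht').trans (le_max_left _ _))
    (fun x => (hd t x).differentiableAt) (fun x => ?_) (fun x y => ?_)
  · convert h3 using 3 with i x
    rw [(hd t x).fderiv]
    rfl
  · rw [(hd t x).fderiv]
    exact (hle _).trans ((hC1 x t ht').trans ((le_max_left _ _).trans (le_max_right _ _)))
  · rw [(hd t x).fderiv, (hd t y).fderiv, ← ContinuousLinearMap.sub_comp]
    refine (hle _).trans ?_
    have h4 := convex_univ.norm_image_sub_le_of_norm_hasFDerivWithin_le (C := C2)
      (fun z _ => (hd' t z).hasFDerivWithinAt) (fun z _ => (hle _).trans (hC2 z t ht'))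
      (Set.mem_univ y) (Set.mem_univ x)
    exact h4.trans (mul_le_mul_of_nonneg_right ((le_max_right _ _).trans (le_max_right _ _))
      (norm_nonneg _))

/-! ### From components to vectors -/

lemma inner_eq_sum (v w : Vec N) : inner ℝ v w = ∑ a, v a * w a := by
  simp [PiLp.inner_apply, mul_comm]

lemma tendstoWeaklyL2_of_components {X : Type} [MeasurableSpace X] {μ : Measure X}
    {f : ℕ → X → Vec N} {g : X → Vec N}
    (h : ∀ a, WeakConv μ (fun k x => f k x a) fun x => g x a) : TendstoWeaklyL2 μ f g := by
  refine ⟨fun k => memLp_vec fun a => (h a).memLp k, memLp_vec fun a => (h a).memLp_lim,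
    fun ψ hψ => ?_⟩
  simp_rw [inner_eq_sum]
  simp_rw [fun k => integral_finsetSum Finset.univ fun a _ =>
    integrable_mul_of_memLp ((h a).memLp k) (memLp_apply hψ a),
    integral_finsetSum Finset.univ fun a _ =>
      integrable_mul_of_memLp (h a).memLp_lim (memLp_apply hψ a)]
  exact tendsto_finsetSum _ fun a _ => (h a).tendsto _ (memLp_apply hψ a)

lemma hasWeakDerivAlong_of_components (hΛ : 0 < Λ) (hT : 0 < T) {e : Vec d × ℝ}
    {u w : Vec d × ℝ → Vec N} (hu : MemLp u 2 (cylinderMeasure d Λ T))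
    (hw : MemLp w 2 (cylinderMeasure d Λ T))
    (hb : ∀ φ, IsTest Λ T φ → ∃ C, ∀ᵐ p ∂cylinderMeasure d Λ T, |fderiv ℝ φ p e| ≤ C)
    (h : ∀ φ, IsTest Λ T φ → ∀ a, ∫ p, fderiv ℝ φ p e * u p a ∂cylinderMeasure d Λ T =
      -∫ p, φ p * w p a ∂cylinderMeasure d Λ T) : HasWeakDerivAlong Λ T e u w := by
  have := isFiniteMeasure_cylinderMeasure d hΛ T
  intro φ h1 h2 h3
  have hφ : IsTest Λ T φ := ⟨h1, h2, h3⟩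
  obtain ⟨C, hC⟩ := hb φ hφ
  obtain ⟨C', hC', -⟩ := hφ.bound hΛ hT
  have i1 : Integrable (fun p => fderiv ℝ φ p e • u p) (cylinderMeasure d Λ T) :=
    (hu.integrable one_le_two).bdd_smul C (hφ.continuous_fderiv e).aestronglyMeasurable hC
  have i2 : Integrable (fun p => φ p • w p) (cylinderMeasure d Λ T) :=
    (hw.integrable one_le_two).bdd_smul C' hφ.contDiff.continuous.aestronglyMeasurable
      (Eventually.of_forall hC')
  ext a
  rw [PiLp.neg_apply, integral_apply i1, integral_apply i2]
  exact h φ hφ a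

end HMHF

namespace HMHF

variable {d N : ℕ} {Λ T : ℝ} {u0 v0 : Vec d → Vec N}

/-! ### Dependence on the initial values -/

/-- A periodic map to the unit sphere agrees a.e. with a Borel map to the unit ball. -/
lemma exists_ballMap (hΛ : 0 < Λ) (hper : IsPeriodic Λ u0)
    (hm : AEStronglyMeasurable u0 (torusMeasure d Λ))
    (h1 : ∀ᵐ x ∂torusMeasure d Λ, ‖u0 x‖ = 1) :
    ∃ v0 : Vec d → Vec N, BallMap Λ v0 ∧ v0 =ᵐ[volume] u0 := by
  classical
  let g := hm.mk u0
  have hg : Measurable g := hm.stronglyMeasurable_mk.measurable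
  let c : Vec N → Vec N := fun v => if ‖v‖ ≤ 1 then v else 0
  have hc : Measurable c := Measurable.ite (measurableSet_le measurable_norm measurable_const)
    measurable_id measurable_const
  have hp := isPeriodic_comp_cellFract hΛ fun x => c (g x)
  refine ⟨fun x => c (g (cellFract Λ x)), ⟨(hc.comp hg).comp (measurable_cellFract Λ), hp,
    fun x => ?_⟩, ?_⟩
  · simp only [c]
    split_ifs with h
    · exact h
    · simp
  -- Both sides are periodic, so agreement on the cell is enough.
  · refine ae_of_ae_torusMeasure hΛ (p := fun x => c (g (cellFract Λ x)) = u0 x)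
      (fun x i => ?_) ?_
    · have h2 := hp x i
      simp only at h2 ⊢
      rw [h2, hper x i]
    have hmem : ∀ᵐ x ∂torusMeasure d Λ, x ∈ cell d Λ := ae_restrict_mem (measurableSet_cell d hΛ)
    filter_upwards [h1, hm.ae_eq_mk, hmem] with x hx1 hx hxm
    have hgx : g x = u0 x := hx.symm
    rw [cellFract_of_mem hΛ hxm, hgx]
    exact if_pos hx1.le

lemma heatConv_congr (h : ℝ) (huv : v0 =ᵐ[volume] u0) : heatConv h v0 = heatConv h u0 :=
  convolution_congr _ EventuallyEq.rfl huv

lemma gradHeatConv_congr (h : ℝ) (i : Fin d) (huv : v0 =ᵐ[volume] u0) :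
    gradHeatConv h i v0 = gradHeatConv h i u0 :=
  convolution_congr _ EventuallyEq.rfl huv

/-- Convolution does not see null sets, so after one step the two schemes agree everywhere and not
only almost everywhere. -/
lemma iterate_succ_congr (h : ℝ) (huv : v0 =ᵐ[volume] u0) (n : ℕ) :
    iterate h v0 (n + 1) = iterate h u0 (n + 1) := by
  induction n with
  | zero => simp only [iterate, heatConv_congr h huv]
  | succ n ih => rw [iterate_succ, ih, ← iterate_succ]

lemma iterate_congr (h : ℝ) (huv : v0 =ᵐ[volume] u0) (n : ℕ) :
    iterate h v0 n =ᵐ[volume] iterate h u0 n := by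
  cases n with
  | zero => exact huv
  | succ n => rw [iterate_succ_congr h huv n]

lemma approxGrad_congr (h : ℝ) (huv : v0 =ᵐ[volume] u0) (i : Fin d) :
    approxGrad h v0 i = approxGrad h u0 i := by
  funext p
  rw [approxGrad, approxGrad, interp, interp, gradHeatConv_congr h i (iterate_congr h huv _)]

lemma approxTimeDeriv_congr (h : ℝ) (huv : v0 =ᵐ[volume] u0) :
    approxTimeDeriv h v0 = approxTimeDeriv h u0 := by
  funext p
  simp only [approxTimeDeriv, interp]
  rw [heatConv_congr h (iterate_congr h huv _), heatConv_congr h (iterate_congr h huv _)]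

lemma approx_congr (hΛ : 0 < Λ) (h : ℝ) (huv : v0 =ᵐ[volume] u0) :
    approx h v0 =ᵐ[cylinderMeasure d Λ T] approx h u0 := by
  have := isFiniteMeasure_torusMeasure d hΛ
  rw [cylinderMeasure_eq_prod]
  have h1 : v0 =ᵐ[torusMeasure d Λ] u0 := ae_restrict_of_ae huv
  filter_upwards [Measure.quasiMeasurePreserving_fst.ae h1] with p hp
  simp only [approx, interp]
  cases ⌊p.2 / h⌋₊ with
  | zero => exact hp
  | succ n => rw [iterate_succ_congr h huv n]

lemma HasWeakPartial.congr {i : Fin d} {w : Vec d → Vec N} (h : HasWeakPartial Λ i u0 w)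
    (huv : v0 =ᵐ[volume] u0) : HasWeakPartial Λ i v0 w := by
  intro φ h1 h2
  rw [← h φ h1 h2]
  refine integral_congr_ae ?_
  have huv' : v0 =ᵐ[torusMeasure d Λ] u0 := ae_restrict_of_ae huv
  filter_upwards [huv'] with x hx
  rw [hx]

lemma TendstoStronglyL2.congr {X : Type} [MeasurableSpace X] {μ : Measure X} {f f' : ℕ → X → Vec N}
    {g : X → Vec N} (h : TendstoStronglyL2 μ f g) (hf : ∀ k, f k =ᵐ[μ] f' k) :
    TendstoStronglyL2 μ f' g :=
  ⟨fun k => (memLp_congr_ae (hf k)).1 (h.1 k), h.2.1, h.2.2.congr fun k =>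
    eLpNorm_congr_ae ((hf k).sub EventuallyEq.rfl)⟩

/-! ### The limit as a weak solution -/

namespace SchemeLimit

variable {E : ℝ} {h : ℕ → ℝ} {u : Vec d × ℝ → Vec N} {D : Fin d → Fin N → Vec d × ℝ → ℝ}
  {ut : Fin N → Vec d × ℝ → ℝ}

lemma isCylinderH1 (hΛ : 0 < Λ) (hT : 0 < T)
    (H : SchemeLimit Λ T E u0 h (fun a p => u p a) D ut)
    (hper : ∀ t, IsPeriodic Λ fun x => u (x, t)) :
    IsCylinderH1 Λ T u (fun i p => WithLp.toLp 2 fun a => D i a p)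
      (fun p => WithLp.toLp 2 fun a => ut a p) := by
  have m0 : MemLp u 2 (cylinderMeasure d Λ T) := memLp_vec H.memLp
  have m1 : ∀ i, MemLp (fun p => (WithLp.toLp 2 fun a => D i a p : Vec N)) 2
      (cylinderMeasure d Λ T) := fun i => memLp_vec fun a => H.memLp_grad i a
  have m2 : MemLp (fun p => (WithLp.toLp 2 fun a => ut a p : Vec N)) 2
      (cylinderMeasure d Λ T) := memLp_vec fun a => H.memLp_time a
  refine ⟨hper, m0, m1, m2, fun i => hasWeakDerivAlong_of_components hΛ hT m0 (m1 i)
    (fun φ hφ => ?_) fun φ hφ a => ?_, hasWeakDerivAlong_of_components hΛ hT m0 m2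
    (fun φ hφ => hφ.ae_bound_time hΛ hT) fun φ hφ a => H.integral_time_mul hΛ hT hφ a⟩
  · obtain ⟨C, -, hC⟩ := (tameFam_of_contDiff (T := T) hΛ hφ.contDiff hφ.periodic).bound hΛ
    exact ⟨C, hC i⟩
  · exact H.integral_grad_mul hΛ hT (tameFam_of_contDiff hΛ hφ.contDiff hφ.periodic) i a

lemma fderiv_apply {φ : Vec d × ℝ → Vec N} (hφ : ContDiff ℝ ∞ φ) (p e : Vec d × ℝ) (a : Fin N) :
    fderiv ℝ (fun p => φ p a) p e = fderiv ℝ φ p e a := by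
  have h1 := (EuclideanSpace.proj (𝕜 := ℝ) a).hasFDerivAt.comp p
    (hφ.differentiable (by simp) p).hasFDerivAt
  exact congrArg (fun L => L e) h1.fderiv

lemma isWeakSolution (hΛ : 0 < Λ) (hT : 0 < T)
    (H : SchemeLimit Λ T E u0 h (fun a p => u p a) D ut)
    (hper : ∀ t, IsPeriodic Λ fun x => u (x, t)) :
    IsWeakSolution Λ T u (fun i p => WithLp.toLp 2 fun a => D i a p)
      (fun p => WithLp.toLp 2 fun a => ut a p) := by
  refine ⟨H.isCylinderH1 hΛ hT hper, ?_, fun φ hφ hφper => ?_⟩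
  · filter_upwards [H.sum_sq_eq_one hΛ hT] with p hp
    rw [← norm_sq_eq_sum] at hp
    exact (pow_eq_one_iff_of_nonneg (norm_nonneg _) two_ne_zero).1 hp
  · have hcomp : ∀ a, TameFam Λ T (fun p => φ p a) fun i p => fderiv ℝ φ p (spaceDir i) a := by
      intro a
      have := tameFam_of_contDiff (T := T) hΛ (φ := fun p => φ p a)
        ((EuclideanSpace.proj (𝕜 := ℝ) a).contDiff.comp hφ) fun t x i => by
          simp only [hφper t x i]
      simpa only [fderiv_apply hφ] using this
    have i1 : ∀ a, Integrable (fun p => φ p a * ut a p +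
        ∑ i, fderiv ℝ φ p (spaceDir i) a * D i a p) (cylinderMeasure d Λ T) := fun a =>
      (integrable_mul_of_memLp ((hcomp a).memLp hΛ) (H.memLp_time a)).add (integrable_finsetSum _
        fun i _ => integrable_mul_of_memLp ((hcomp a).memLp_grad hΛ i) (H.memLp_grad i a))
    have i2 : ∀ a, Integrable (fun p => φ p a * u p a * ∑ i, ∑ b, D i b p ^ 2)
        (cylinderMeasure d Λ T) := fun a => H.integrable_density hΛ (hcomp a) a
    have e1 : ∀ p, inner ℝ (WithLp.toLp 2 fun a => ut a p : Vec N) (φ p) +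
        ∑ i, inner ℝ (WithLp.toLp 2 fun a => D i a p : Vec N) (fderiv ℝ φ p (spaceDir i)) =
        ∑ a, (φ p a * ut a p + ∑ i, fderiv ℝ φ p (spaceDir i) a * D i a p) := fun p => by
      simp_rw [inner_eq_sum]
      rw [Finset.sum_add_distrib, Finset.sum_comm (s := (Finset.univ : Finset (Fin d)))]
      simp_rw [mul_comm]
    have e2 : ∀ p, (∑ i, ‖(WithLp.toLp 2 fun a => D i a p : Vec N)‖ ^ 2) * inner ℝ (u p) (φ p) =
        ∑ a, φ p a * u p a * ∑ i, ∑ b, D i b p ^ 2 := fun p => by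
      simp_rw [inner_eq_sum, norm_sq_eq_sum]
      rw [← Finset.sum_mul, mul_comm]
      simp_rw [mul_comm (u p _)]
    simp_rw [e1, e2]
    rw [integral_finsetSum _ fun a _ => i1 a, integral_finsetSum _ fun a _ => i2 a]
    exact Finset.sum_congr rfl fun a _ => H.flow_equation hΛ hT (hcomp a) a

end SchemeLimit

end HMHF

theorem mainTheorem7 {d N : ℕ} (Λ T : ℝ) (hΛ : 0 < Λ) (hT : 0 < T)
    (u0 : HMHF.Vec d → HMHF.Vec N) (hu0 : HMHF.IsTorusH1 Λ u0)
    (hu0_norm : ∀ᵐ x ∂HMHF.torusMeasure d Λ, ‖u0 x‖ = 1)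
    (h : ℕ → ℝ) (h_pos : ∀ k, 0 < h k) (h_lim : Tendsto h atTop (𝓝 0)) :
    ∃ (σ : ℕ → ℕ) (u : HMHF.Vec d × ℝ → HMHF.Vec N)
      (Du : Fin d → HMHF.Vec d × ℝ → HMHF.Vec N) (ut : HMHF.Vec d × ℝ → HMHF.Vec N),
      StrictMono σ ∧
      HMHF.IsCylinderH1 Λ T u Du ut ∧
      (∀ᵐ p ∂HMHF.cylinderMeasure d Λ T, ‖u p‖ ≤ 1) ∧
      HMHF.TendstoStronglyL2 (HMHF.cylinderMeasure d Λ T)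
        (fun k => HMHF.approx (h (σ k)) u0) u ∧
      (∀ i, HMHF.TendstoWeaklyL2 (HMHF.cylinderMeasure d Λ T)
        (fun k => HMHF.approxGrad (h (σ k)) u0 i) (Du i)) ∧
      HMHF.TendstoWeaklyL2 (HMHF.cylinderMeasure d Λ T)
        (fun k => HMHF.approxTimeDeriv (h (σ k)) u0) ut ∧
      HMHF.IsWeakSolution Λ T u Du ut := by
  obtain ⟨hper, hmem, Du0, hDu0⟩ := hu0
  -- The argument is run from a Borel representative with values in the ball; the conclusions return
  -- to the given initial map by the congruence lemmas.
  obtain ⟨v0, hv, hvu⟩ := HMHF.exists_ballMap hΛ hper hmem.1 hu0_norm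
  have hvu' : v0 =ᵐ[HMHF.torusMeasure d Λ] u0 := ae_restrict_of_ae hvu
  have hv1 : ∀ᵐ x ∂HMHF.torusMeasure d Λ, ‖v0 x‖ = 1 := by
    filter_upwards [hu0_norm, hvu'] with x hx hx'
    rw [hx', hx]
  -- The uniform constant E of all estimates is the Dirichlet integral of the initial map.
  have hE := fun s (hs : 0 < s) => HMHF.energy_initial_le hΛ hs hv hv1
    fun i => ⟨(hDu0 i).1, (hDu0 i).2.congr hvu⟩
  obtain ⟨σ, u, D, ut, hσ, huper, hu1, hconv, H⟩ :=
    HMHF.exists_schemeLimit hΛ hT hv hE h_pos h_lim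
  refine ⟨σ, u, fun i p => WithLp.toLp 2 fun a => D i a p, fun p => WithLp.toLp 2 fun a => ut a p,
    hσ, H.isCylinderH1 hΛ hT huper, Eventually.of_forall hu1,
    hconv.congr fun k => HMHF.approx_congr hΛ _ hvu, fun i => ?_, ?_,
    H.isWeakSolution hΛ hT huper⟩
  · simp_rw [← HMHF.approxGrad_congr _ hvu]
    refine HMHF.tendstoWeaklyL2_of_components fun a => ?_
    simp_rw [HMHF.approxGrad_apply hv (h_pos _)]
    exact H.conv_grad i a
  · simp_rw [← HMHF.approxTimeDeriv_congr _ hvu]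
    refine HMHF.tendstoWeaklyL2_of_components fun a => ?_
    simp_rw [HMHF.approxTimeDeriv_apply hv (h_pos _)]
    exact H.conv_time a
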